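/- Let $N\ge 1$, $m\ge 1$, $T>0$, $0<\rho\le 1$. Let $D_j=-i\,\partial/\partial x_j$ and let $A(D)=\sum_{|\alpha|=m}a_\alpha D^\alpha$ be a homogeneous differential operator of order $m$ with constant (complex) coefficients which is elliptic ($A(\xi)\ne 0$ for all $\xi\in\mathbb R^N\setminus\{0\}$) and which is symmetric and positive (that is, $(A(D)v,v)\ge 0$) in $L_2(\mathbb T^N)$, $\mathbb T^N=(-\pi,\pi]^N$, on the functions of $C^m(\mathbb R^N)$ that are $2\pi$-periodic in each variable. For a $2\pi$-periodic $g\in L_2(\mathbb T^N)$ put $g_n=(2\pi)^{-N}\int_{\mathbb T^N}g(x)e^{-inx}\,dx$, $n\in\mathbb Z^N$; $g$ belongs to $L_2^a(\mathbb T^N)$ if $\sum_{n}(1+|n|^2)^a|g_n|^2<\infty$. Let $D_t^\rho$ be the Caputo derivative, $D_t^\rho v(t)=\frac1{\Gamma(1-\rho)}\int_0^t\frac{v'(s)\,ds}{(t-s)^\rho}$ for $0<\rho<1$ and $D_t^1v=v'$, and let $E_{\rho,\mu}(z)=\sum_{k\ge 0}\frac{z^k}{\Gamma(\rho k+\mu)}$.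 Consider the inverse problem of finding $\{u,f\}$ with $$D_t^\rho u(x,t)+A(D)u(x,t)=f(x)\quad (x\in\mathbb T^N,\ 0<t\le T),\qquad u(x,0)=\varphi(x),\qquad u(x,T)=\Psi(x).$$ A periodic classical solution is a pair $\{u,f\}$ of functions, $2\pi$-periodic in each $x_j$, such that $f\in C(\mathbb T^N)$, $u\in C(\mathbb T^N\times[0,T])$, $u(\cdot,t)\in C^m$ for $0<t\le T$, the derivative $D_t^\rho u$ exists on $\mathbb T^N\times(0,T]$ (for $\rho<1$: $u(x,\cdot)$ is differentiable on $(0,T)$ and the integral converges absolutely), $D_t^\rho u,\ A(D)u\in C(\mathbb T^N\times(0,T])$, the equation holds, and the two conditions at $t=0$ and $t=T$ hold as equalities of elements of $L_2(\mathbb T^N)$ (hence everywhere, for the continuous representatives of $\varphi$ and $\Psi$). Theorem. Let $\tau>N/2$, $\varphi\in L_2^{\tau}(\mathbb T^N)$ and $\Psi\in L_2^{\tau+m}(\mathbb T^N)$. Then the inverse problem has a unique periodic classical solution $\{u,f\}$. It is given, for $x\in\mathbb T^N$ and $0\le t\le T$, by the absolutely convergent series $$u(x,t)=\sum_{n\in\mathbb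 Z^N}\varphi_nE_{\rho,1}(-A(n)t^\rho)e^{inx}+\sum_{n\in\mathbb Z^N}f_n\,t^\rho E_{\rho,\rho+1}(-A(n)t^\rho)e^{inx},$$ $$f(x)=\sum_{n\in\mathbb Z^N}\frac{\Psi_n}{T^\rho E_{\rho,\rho+1}(-A(n)T^\rho)}e^{inx}-\sum_{n\in\mathbb Z^N}\frac{\varphi_nE_{\rho,1}(-A(n)T^\rho)}{T^\rho E_{\rho,\rho+1}(-A(n)T^\rho)}e^{inx},$$ where $$f_n=\frac{\Psi_n-\varphi_nE_{\rho,1}(-A(n)T^\rho)}{T^\rho E_{\rho,\rho+1}(-A(n)T^\rho)}.$$ -/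

import Mathlib

open MeasureTheory Set

noncomputable section

namespace Subdiffusion

/-- The fundamental cube `(-π, π]^N` of the torus `𝕋^N`. -/
def cube (N : ℕ) : Set (Fin N → ℝ) :=
  Set.pi Set.univ fun _ => Set.Ioc (-Real.pi) Real.pi

/-- `g` is `2π`-periodic in each variable. -/
def IsPeriodic {N : ℕ} (g : (Fin N → ℝ) → ℂ) : Prop :=
  ∀ (x : Fin N → ℝ) (j : Fin N), g (x + Pi.single j (2 * Real.pi)) = g x

/-- The exponential `e^{inx}`. -/
def expMode {N : ℕ} (n : Fin N → ℤ) (x : Fin N → ℝ) : ℂ :=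
  Complex.exp (Complex.I * ∑ j, (n j : ℂ) * (x j : ℂ))

/-- The Fourier coefficient `g_n = (2π)^{-N} ∫_{𝕋^N} g(x) e^{-inx} dx`, normalised so that the
Fourier series of `g` is `∑ g_n e^{inx}`. -/
def fourierCoef {N : ℕ} (g : (Fin N → ℝ) → ℂ) (n : Fin N → ℤ) : ℂ :=
  ((2 * Real.pi : ℝ) : ℂ)⁻¹ ^ N * ∫ x in cube N, g x * expMode (-n) x

/-- Membership in the Sobolev (Liouville) space `L_2^a(𝕋^N)`: a `2π`-periodic function, square
integrable over the torus, with `∑ (1 + |n|²)^a |g_n|² < ∞`. -/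
structure MemSobolev {N : ℕ} (a : ℝ) (g : (Fin N → ℝ) → ℂ) : Prop where
  periodic : IsPeriodic g
  memLp : MemLp g 2 (volume.restrict (cube N))
  summable : Summable fun n : Fin N → ℤ =>
    (1 + ∑ j, (n j : ℝ) ^ 2) ^ a * ‖fourierCoef g n‖ ^ 2

/-- `D_j = -i ∂/∂x_j`. -/
def partialD {N : ℕ} (j : Fin N) (v : (Fin N → ℝ) → ℂ) : (Fin N → ℝ) → ℂ :=
  fun x => -Complex.I * fderiv ℝ v x (Pi.single j 1)

/-- `D^α = D_1^{α_1} ⋯ D_N^{α_N}`. -/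
def multiD {N : ℕ} (α : Fin N →₀ ℕ) (v : (Fin N → ℝ) → ℂ) : (Fin N → ℝ) → ℂ :=
  (List.finRange N).foldr (fun j w => (partialD j)^[α j] w) v

/-- The constant-coefficient operator `A(D) = ∑_α a_α D^α` attached to the polynomial
`A(ξ) = ∑_α a_α ξ^α`. -/
def diffOp {N : ℕ} (A : MvPolynomial (Fin N) ℂ) (v : (Fin N → ℝ) → ℂ) : (Fin N → ℝ) → ℂ :=
  fun x => ∑ α ∈ A.support, A.coeff α * multiD α v x

/-- The value `A(n)` of the symbol at `n ∈ ℤ^N`. -/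
def symbolAt {N : ℕ} (A : MvPolynomial (Fin N) ℂ) (n : Fin N → ℤ) : ℂ :=
  MvPolynomial.eval (fun j => (n j : ℂ)) A

/-- `A(D)` is a homogeneous elliptic symmetric positive operator of order `m`. Symmetry and
positivity are those of the operator `A(D)` in `L_2(𝕋^N)` with domain the `2π`-periodic functions
in `C^m(ℝ^N)`. -/
structure IsEllipticSymmPos {N : ℕ} (m : ℕ) (A : MvPolynomial (Fin N) ℂ) : Prop where
  homogeneous : A.IsHomogeneous m
  elliptic : ∀ ξ : Fin N → ℝ, ξ ≠ 0 → MvPolynomial.eval (fun j => (ξ j : ℂ)) A ≠ 0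
  symmetric : ∀ v w : (Fin N → ℝ) → ℂ, IsPeriodic v → IsPeriodic w →
    ContDiff ℝ m v → ContDiff ℝ m w →
    ∫ x in cube N, diffOp A v x * (starRingEnd ℂ) (w x) =
      ∫ x in cube N, v x * (starRingEnd ℂ) (diffOp A w x)
  positive : ∀ v : (Fin N → ℝ) → ℂ, IsPeriodic v → ContDiff ℝ m v →
    0 ≤ (∫ x in cube N, diffOp A v x * (starRingEnd ℂ) (v x)).re

/-- The two-parameter Mittag-Leffler function `E_{ρ,μ}(z) = ∑_k z^k / Γ(ρk + μ)`. -/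
def mittagLeffler (ρ μ : ℝ) (z : ℂ) : ℂ :=
  ∑' k : ℕ, z ^ k / (Real.Gamma (ρ * k + μ) : ℂ)

/-- Existence at `t ∈ (0, T]` of the Caputo derivative of order `ρ ∈ (0, 1]` of a function `v`
on `[0, T]`. For `ρ = 1` it is the ordinary derivative (one-sided at `t = T`). -/
def HasCaputo (ρ T : ℝ) (v : ℝ → ℂ) (t : ℝ) : Prop :=
  if ρ = 1 then DifferentiableWithinAt ℝ v (Set.Icc 0 T) t
  else (∀ s ∈ Set.Ioo 0 t, DifferentiableAt ℝ v s) ∧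
    IntegrableOn (fun s => (((t - s) ^ (-ρ) : ℝ) : ℂ) * deriv v s) (Set.Ioo 0 t)

/-- The Caputo derivative `D_t^ρ v(t) = Γ(1-ρ)⁻¹ ∫_0^t v'(s) (t-s)^{-ρ} ds` for `0 < ρ < 1`, and
`v'(t)` for `ρ = 1`. -/
def caputo (ρ T : ℝ) (v : ℝ → ℂ) (t : ℝ) : ℂ :=
  if ρ = 1 then derivWithin v (Set.Icc 0 T) t
  else ((Real.Gamma (1 - ρ) : ℝ) : ℂ)⁻¹ *
    ∫ s in Set.Ioo 0 t, (((t - s) ^ (-ρ) : ℝ) : ℂ) * deriv v s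

/-- `{u, f}` is a periodic classical solution of the inverse problem
`D_t^ρ u + A(D) u = f(x)`, `u(x,0) = φ(x)`, `u(x,T) = Ψ(x)`. As `φ` and `Ψ` are elements of `L_2`,
the last two are equalities almost everywhere; where `φ`, `Ψ` are continuous they hold
everywhere, since `u` is continuous. -/
structure IsSolution {N : ℕ} (m : ℕ) (A : MvPolynomial (Fin N) ℂ) (ρ T : ℝ)
    (φ Ψ : (Fin N → ℝ) → ℂ) (u : (Fin N → ℝ) → ℝ → ℂ) (f : (Fin N → ℝ) → ℂ) : Prop where
  periodic_f : IsPeriodic f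
  continuous_f : Continuous f
  periodic_u : ∀ t ∈ Set.Icc 0 T, IsPeriodic fun x => u x t
  continuous_u : ContinuousOn (fun p : (Fin N → ℝ) × ℝ => u p.1 p.2)
    (Set.univ ×ˢ Set.Icc 0 T)
  contDiff_u : ∀ t ∈ Set.Ioc 0 T, ContDiff ℝ m fun x => u x t
  continuous_diffOp : ContinuousOn
    (fun p : (Fin N → ℝ) × ℝ => diffOp A (fun x => u x p.2) p.1) (Set.univ ×ˢ Set.Ioc 0 T)
  hasCaputo : ∀ x, ∀ t ∈ Set.Ioc 0 T, HasCaputo ρ T (u x) t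
  continuous_caputo : ContinuousOn
    (fun p : (Fin N → ℝ) × ℝ => caputo ρ T (u p.1) p.2) (Set.univ ×ˢ Set.Ioc 0 T)
  equation : ∀ x, ∀ t ∈ Set.Ioc 0 T, caputo ρ T (u x) t + diffOp A (fun y => u y t) x = f x
  initial : (fun x => u x 0) =ᵐ[volume] φ
  final : (fun x => u x T) =ᵐ[volume] Ψ

/-- `E_{ρ,μ}(-A(n) t^ρ)`. -/
def mlMode {N : ℕ} (A : MvPolynomial (Fin N) ℂ) (ρ μ t : ℝ) (n : Fin N → ℤ) : ℂ :=
  mittagLeffler ρ μ (-symbolAt A n * ((t ^ ρ : ℝ) : ℂ))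

/-- The part of the coefficient `f_n` that comes from `Ψ`:
`Ψ_n / (T^ρ E_{ρ,ρ+1}(-A(n)T^ρ))`. -/
def sourceCoefFinal {N : ℕ} (A : MvPolynomial (Fin N) ℂ) (ρ T : ℝ)
    (Ψ : (Fin N → ℝ) → ℂ) (n : Fin N → ℤ) : ℂ :=
  fourierCoef Ψ n / (((T ^ ρ : ℝ) : ℂ) * mlMode A ρ (ρ + 1) T n)

/-- The part of the coefficient `f_n` that comes from `φ`:
`φ_n E_{ρ,1}(-A(n)T^ρ) / (T^ρ E_{ρ,ρ+1}(-A(n)T^ρ))`. -/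
def sourceCoefInitial {N : ℕ} (A : MvPolynomial (Fin N) ℂ) (ρ T : ℝ)
    (φ : (Fin N → ℝ) → ℂ) (n : Fin N → ℤ) : ℂ :=
  fourierCoef φ n * mlMode A ρ 1 T n / (((T ^ ρ : ℝ) : ℂ) * mlMode A ρ (ρ + 1) T n)

/-- The coefficient `f_n`. -/
def sourceCoef {N : ℕ} (A : MvPolynomial (Fin N) ℂ) (ρ T : ℝ)
    (φ Ψ : (Fin N → ℝ) → ℂ) (n : Fin N → ℤ) : ℂ :=
  sourceCoefFinal A ρ T Ψ n - sourceCoefInitial A ρ T φ n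

/-- `h` is the sum of the (absolutely) convergent series `∑ c_n` and `∑ d_n`. -/
def IsSumOfTwoSeries {ι : Type*} (h : ℂ) (c d : ι → ℂ) : Prop :=
  Summable c ∧ Summable d ∧ h = (∑' n, c n) + (∑' n, d n)

end Subdiffusion

end

/-!
The `n`-th Fourier coefficient in `x` of a classical solution satisfies the scalar relaxation
equation `D_t^ρ y + A(n) y = f_n`, where symmetry and positivity give `A(n) ≥ 0`. Its solution is
`φ_n M₁(t) + f_n M_{ρ+1}(t)` with `M_μ(t) = t^(μ-1) E_{ρ,μ}(-A(n) t^ρ)`, and the final condition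
determines `f_n` because `M_{ρ+1}(T) > 0`.

Uniqueness: nothing bounds `D_t^ρ u` uniformly in `x` as `t → 0`, so the Fourier coefficients are
taken in the equation integrated over `[a, t]`, and then `a → 0`. The difference of two solutions of
the resulting scalar equation solves a homogeneous Abel–Volterra equation, and iterating that
equation shows that it vanishes.

Existence: the functions `M_μ` are nonnegative for `μ ≥ ρ`, since they are limits of convolutions of
positive kernels. With the relation `M_1 = 1 - A(n) M_{ρ+1}` this yields `0 ≤ M_1 ≤ 1`,
`A(n) M_1(t) ≤ C t^{-ρ}` and `M_{ρ+1}(T)⁻¹ ≤ C (1 + A(n))`. As `τ > N/2` makes `∑ |φ_n|` and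
`∑ (1 + |n|)^m |Ψ_n|` finite, these bounds dominate the series of `u`, `f`, `A(D) u` and
`D_t^ρ u`.
-/

noncomputable section

namespace Subdiffusion

open Filter Topology

/-! ### Riemann–Liouville integrals -/

/-- The Riemann–Liouville kernel `r^{b-1} / Γ(b)`. -/
def fracKernel (b r : ℝ) : ℝ := r ^ (b - 1) / Real.Gamma b

lemma fracKernel_pos {b r : ℝ} (hb : 0 < b) (hr : 0 < r) : 0 < fracKernel b r :=
  div_pos (Real.rpow_pos_of_pos hr _) (Real.Gamma_pos_of_pos hb)

lemma fracKernel_nonneg {b r : ℝ} (hb : 0 < b) (hr : 0 ≤ r) : 0 ≤ fracKernel b r :=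
  div_nonneg (Real.rpow_nonneg hr _) (Real.Gamma_pos_of_pos hb).le

lemma measurable_fracKernel (b : ℝ) : Measurable (fracKernel b) := by
  unfold fracKernel
  fun_prop

lemma fracKernel_one (r : ℝ) : fracKernel 1 r = 1 := by
  simp [fracKernel]

lemma fracKernel_add_one (b r : ℝ) : fracKernel (b + 1) r = r ^ b / Real.Gamma (b + 1) := by
  rw [fracKernel, add_sub_cancel_right]

lemma mul_fracKernel_add_one {b r : ℝ} (hb : 0 < b) (hr : 0 < r) :
    b * fracKernel (b + 1) r = r * fracKernel b r := by
  have := (Real.Gamma_pos_of_pos hb).ne'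
  rw [fracKernel_add_one, fracKernel, Real.Gamma_add_one hb.ne', Real.rpow_sub_one hr.ne']
  field_simp

lemma fracKernel_le_of_le {b r s : ℝ} (hb : 0 < b) (hb1 : b ≤ 1) (hr : 0 < r) (hrs : r ≤ s) :
    fracKernel b s ≤ fracKernel b r :=
  div_le_div_of_nonneg_right (Real.rpow_le_rpow_of_nonpos hr hrs (by linarith))
    (Real.Gamma_pos_of_pos hb).le

lemma fracKernel_mono {b r s : ℝ} (hb : 1 ≤ b) (hr : 0 ≤ r) (hrs : r ≤ s) :
    fracKernel b r ≤ fracKernel b s :=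
  div_le_div_of_nonneg_right (Real.rpow_le_rpow hr hrs (by linarith))
    (Real.Gamma_pos_of_pos (by linarith)).le

lemma fracKernel_mul_le {b s t t₀ : ℝ} (hb : 0 < b) (hb1 : b ≤ 1) (hs : 0 < s) (hst : s < t)
    (htt : t ≤ t₀) :
    fracKernel b t * fracKernel b (t₀ - s) ≤ fracKernel b t₀ * fracKernel b (t - s) := by
  have h : (t * (t₀ - s)) ^ (b - 1) ≤ (t₀ * (t - s)) ^ (b - 1) :=
    Real.rpow_le_rpow_of_nonpos (mul_pos (by linarith) (by linarith)) (by nlinarith) (by linarith)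
  rw [Real.mul_rpow (by linarith) (by linarith), Real.mul_rpow (by linarith) (by linarith)] at h
  have := Real.Gamma_pos_of_pos hb
  simp only [fracKernel, div_mul_div_comm]
  gcongr

lemma integral_fracKernel_mul_fracKernel {a b t : ℝ} (ha : 0 < a) (hb : 0 < b) (ht : 0 < t) :
    ∫ s in Ioo 0 t, fracKernel a (t - s) * fracKernel b s = fracKernel (a + b) t := by
  have hreal : ∫ x in (0 : ℝ)..t, (x : ℂ) ^ ((b : ℂ) - 1) * ((t : ℂ) - x) ^ ((a : ℂ) - 1) =
      ((∫ x in Ioo 0 t, x ^ (b - 1) * (t - x) ^ (a - 1) : ℝ) : ℂ) := by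
    rw [intervalIntegral.integral_of_le ht.le, integral_Ioc_eq_integral_Ioo,
      ← integral_complex_ofReal]
    refine setIntegral_congr_fun measurableSet_Ioo fun x hx => ?_
    rw [Complex.ofReal_mul, Complex.ofReal_cpow hx.1.le, Complex.ofReal_cpow (sub_pos.2 hx.2).le]
    push_cast
    rfl
  have hbeta := Complex.betaIntegral_scaled (b : ℂ) (a : ℂ) ht
  rw [Complex.betaIntegral_eq_Gamma_mul_div _ _ (by simpa) (by simpa), hreal,
    ← Complex.ofReal_add, Complex.Gamma_ofReal, Complex.Gamma_ofReal, Complex.Gamma_ofReal,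
    ← Complex.ofReal_one, ← Complex.ofReal_sub, ← Complex.ofReal_cpow ht.le] at hbeta
  norm_cast at hbeta
  have hGa := (Real.Gamma_pos_of_pos ha).ne'
  have hGb := (Real.Gamma_pos_of_pos hb).ne'
  have hfactor (s : ℝ) : fracKernel a (t - s) * fracKernel b s =
      (Real.Gamma a * Real.Gamma b)⁻¹ * (s ^ (b - 1) * (t - s) ^ (a - 1)) := by
    simp only [fracKernel]
    field_simp
  simp_rw [hfactor]
  rw [integral_const_mul, hbeta, fracKernel, add_comm b a]
  field_simp

lemma integrableOn_fracKernel_mul_fracKernel {a b : ℝ} (t : ℝ) (ha : 0 < a) (hb : 0 < b) :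
    IntegrableOn (fun s => fracKernel a (t - s) * fracKernel b s) (Ioo 0 t) := by
  rcases le_or_gt t 0 with ht | ht
  · simp [Ioo_eq_empty_of_le ht]
  -- A non-integrable function would have integral `0`, but the Beta integral is positive.
  by_contra h
  have hbeta := integral_fracKernel_mul_fracKernel ha hb ht
  rw [integral_undef h] at hbeta
  exact (fracKernel_pos (add_pos ha hb) ht).ne hbeta

section Translate

variable {a b r t : ℝ}

lemma integrableOn_fracKernel_mul_fracKernel_sub (ha : 0 < a) (hb : 0 < b) :
    IntegrableOn (fun s => fracKernel a (t - s) * fracKernel b (s - r)) (Ioo r t) := by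
  have h := ((measurePreserving_sub_right volume r).integrableOn_comp_preimage
    (Homeomorph.subRight r).measurableEmbedding).2
    (integrableOn_fracKernel_mul_fracKernel (t - r) ha hb)
  simpa [Function.comp_def, preimage_sub_const_Ioo] using h

lemma integral_fracKernel_mul_fracKernel_sub (ha : 0 < a) (hb : 0 < b) (hrt : r < t) :
    ∫ s in Ioo r t, fracKernel a (t - s) * fracKernel b (s - r) = fracKernel (a + b) (t - r) := by
  have h := (measurePreserving_sub_right volume r).setIntegral_preimage_emb
    (Homeomorph.subRight r).measurableEmbedding
    (fun s => fracKernel a (t - r - s) * fracKernel b s) (Ioo 0 (t - r))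
  rw [integral_fracKernel_mul_fracKernel ha hb (sub_pos.2 hrt)] at h
  simpa [preimage_sub_const_Ioo] using h

lemma integrableOn_fracKernel_sub (ha : 0 < a) :
    IntegrableOn (fun s => fracKernel a (t - s)) (Ioo r t) := by
  simpa only [fracKernel_one, mul_one] using integrableOn_fracKernel_mul_fracKernel_sub ha one_pos

lemma integral_fracKernel_sub (ha : 0 < a) (hrt : r < t) :
    ∫ s in Ioo r t, fracKernel a (t - s) = fracKernel (a + 1) (t - r) := by
  simpa only [fracKernel_one, mul_one] using
    integral_fracKernel_mul_fracKernel_sub ha one_pos hrt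

end Translate

section FracInt

variable {E : Type*} [NormedAddCommGroup E] [NormedSpace ℝ E] {a b t : ℝ} {f g : ℝ → E}

/-- The Riemann–Liouville integral of order `b` started at `0`. -/
def fracInt (b : ℝ) (f : ℝ → E) (t : ℝ) : E :=
  ∫ s in Ioo 0 t, fracKernel b (t - s) • f s

lemma fracInt_of_nonpos (b : ℝ) (f : ℝ → E) (ht : t ≤ 0) : fracInt b f t = 0 := by
  simp [fracInt, Ioo_eq_empty_of_le ht]

lemma fracInt_one (f : ℝ → E) (t : ℝ) : fracInt 1 f t = ∫ s in Ioo 0 t, f s := by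
  simp [fracInt, fracKernel_one]

lemma fracInt_one_eq_intervalIntegral (f : ℝ → E) (ht : 0 ≤ t) :
    fracInt 1 f t = ∫ s in (0 : ℝ)..t, f s := by
  rw [fracInt_one, intervalIntegral.integral_of_le ht, integral_Ioc_eq_integral_Ioo]

lemma fracInt_congr (h : ∀ s ∈ Ioo 0 t, f s = g s) : fracInt b f t = fracInt b g t :=
  setIntegral_congr_fun measurableSet_Ioo fun s hs => by simp only [h s hs]

lemma fracInt_const_mul {𝕜 : Type*} [RCLike 𝕜] (b t : ℝ) (c : 𝕜) (f : ℝ → 𝕜) :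
    fracInt b (fun s => c * f s) t = c * fracInt b f t := by
  simp only [fracInt, ← integral_const_mul, mul_smul_comm]

lemma fracInt_ofReal (b t : ℝ) (f : ℝ → ℝ) :
    fracInt b (fun s => (f s : ℂ)) t = ((fracInt b f t : ℝ) : ℂ) := by
  rw [fracInt, fracInt, ← integral_complex_ofReal]
  simp

lemma fracInt_pos {f : ℝ → ℝ} (hb : 0 < b) (ht : 0 < t)
    (hfi : IntegrableOn (fun s => fracKernel b (t - s) * f s) (Ioo 0 t))
    (hf : ∀ s ∈ Ioo 0 t, 0 < f s) : 0 < fracInt b f t := by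
  have hpos : ∀ s ∈ Ioo 0 t, 0 < fracKernel b (t - s) * f s := fun s hs =>
    mul_pos (fracKernel_pos hb (sub_pos.2 hs.2)) (hf s hs)
  refine (setIntegral_pos_iff_support_of_nonneg_ae ?_ hfi).2 ?_
  · filter_upwards [ae_restrict_mem measurableSet_Ioo] with s hs using (hpos s hs).le
  · have hsub : Ioo 0 t ⊆ Function.support fun s => fracKernel b (t - s) * f s :=
      fun s hs => (hpos s hs).ne'
    rw [inter_eq_right.2 hsub]
    simpa using ht

lemma integrableOn_fracKernel_smul {T : ℝ} (hb : 0 < b) (hf : ContinuousOn f (Icc 0 T))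
    (htT : t ≤ T) : IntegrableOn (fun s => fracKernel b (t - s) • f s) (Ioo 0 t) := by
  obtain ⟨M, hM⟩ := isCompact_Icc.exists_bound_of_continuousOn hf
  have hsub : Ioo 0 t ⊆ Icc 0 T := fun s hs => ⟨hs.1.le, hs.2.le.trans htT⟩
  refine Integrable.smul_bdd (C := M) (integrableOn_fracKernel_sub hb)
    ((hf.mono hsub).aestronglyMeasurable measurableSet_Ioo) ?_
  filter_upwards [ae_restrict_mem measurableSet_Ioo] with s hs using hM s (hsub hs)

lemma fracInt_sub {T : ℝ} (hb : 0 < b) (hf : ContinuousOn f (Icc 0 T))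
    (hg : ContinuousOn g (Icc 0 T)) (htT : t ≤ T) :
    fracInt b (fun s => f s - g s) t = fracInt b f t - fracInt b g t := by
  simp only [fracInt, smul_sub]
  exact integral_sub (integrableOn_fracKernel_smul hb hf htT)
    (integrableOn_fracKernel_smul hb hg htT)

lemma norm_fracInt_le_fracInt {h : ℝ → ℝ} (hb : 0 < b)
    (hh : IntegrableOn (fun s => fracKernel b (t - s) * h s) (Ioo 0 t))
    (hfh : ∀ s ∈ Ioo 0 t, ‖f s‖ ≤ h s) : ‖fracInt b f t‖ ≤ fracInt b h t := by
  refine norm_integral_le_of_norm_le hh ?_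
  filter_upwards [ae_restrict_mem measurableSet_Ioo] with s hs
  have hk := (fracKernel_pos hb (sub_pos.2 hs.2)).le
  rw [norm_smul, Real.norm_of_nonneg hk]
  exact mul_le_mul_of_nonneg_left (hfh s hs) hk

lemma norm_fracInt_le {M : ℝ} (hb : 0 < b) (ht : 0 < t) (hM : ∀ s ∈ Ioo 0 t, ‖f s‖ ≤ M) :
    ‖fracInt b f t‖ ≤ fracKernel (b + 1) t * M := by
  refine (norm_fracInt_le_fracInt hb ((integrableOn_fracKernel_sub hb).mul_const M) hM).trans ?_
  simp only [fracInt, smul_eq_mul]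
  rw [integral_mul_const, integral_fracKernel_sub hb ht, sub_zero]

end FracInt

section Semigroup

/-- The open triangle `a < r < s < t` in the coordinates `(s, r)`: the domain of integration of an
iterated Volterra integral. -/
def triangle (a t : ℝ) : Set (ℝ × ℝ) := {p | a < p.2 ∧ p.2 < p.1 ∧ p.1 < t}

lemma measurableSet_triangle (a t : ℝ) : MeasurableSet (triangle a t) :=
  (measurableSet_lt measurable_const measurable_snd).inter
    ((measurableSet_lt measurable_snd measurable_fst).inter
      (measurableSet_lt measurable_fst measurable_const))

lemma indicator_triangle_left {M : Type*} [Zero M] (F : ℝ → ℝ → M) (a t s r : ℝ) :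
    (triangle a t).indicator (Function.uncurry F) (s, r) =
      (Ioo a t).indicator (fun s => (Ioo a s).indicator (F s) r) s := by
  simp only [triangle, indicator_apply, mem_ofPred_eq, mem_Ioo, Function.uncurry_apply_pair]
  grind

lemma indicator_triangle_right {M : Type*} [Zero M] (F : ℝ → ℝ → M) (a t s r : ℝ) :
    (triangle a t).indicator (Function.uncurry F) (s, r) =
      (Ioo a t).indicator (fun r => (Ioo r t).indicator (F · r) s) r := by
  simp only [triangle, indicator_apply, mem_ofPred_eq, mem_Ioo, Function.uncurry_apply_pair]
  grind

variable {E : Type*} [NormedAddCommGroup E] [NormedSpace ℝ E] {a t : ℝ} {F : ℝ → ℝ → E}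

lemma integral_indicator_triangle_left (F : ℝ → ℝ → E) (a t s : ℝ) :
    ∫ r, (triangle a t).indicator (Function.uncurry F) (s, r) =
      (Ioo a t).indicator (fun s => ∫ r in Ioo a s, F s r) s := by
  simp only [indicator_triangle_left]
  by_cases hs : s ∈ Ioo a t
  · simp only [indicator_of_mem hs, integral_indicator measurableSet_Ioo]
  · simp only [indicator_of_notMem hs, integral_zero]

lemma integral_indicator_triangle_right (F : ℝ → ℝ → E) (a t r : ℝ) :
    ∫ s, (triangle a t).indicator (Function.uncurry F) (s, r) =
      (Ioo a t).indicator (fun r => ∫ s in Ioo r t, F s r) r := by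
  simp only [indicator_triangle_right]
  by_cases hr : r ∈ Ioo a t
  · simp only [indicator_of_mem hr, integral_indicator measurableSet_Ioo]
  · simp only [indicator_of_notMem hr, integral_zero]

lemma integrableOn_integral_of_triangle (hF : IntegrableOn (Function.uncurry F) (triangle a t)) :
    IntegrableOn (fun s => ∫ r in Ioo a s, F s r) (Ioo a t) := by
  rw [← integrable_indicator_iff (measurableSet_triangle a t)] at hF
  rw [← integrable_indicator_iff measurableSet_Ioo]
  simpa only [integral_indicator_triangle_left] using hF.integral_prod_left

lemma integral_integral_swap_triangle (hF : IntegrableOn (Function.uncurry F) (triangle a t)) :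
    ∫ s in Ioo a t, ∫ r in Ioo a s, F s r = ∫ r in Ioo a t, ∫ s in Ioo r t, F s r := by
  rw [← integrable_indicator_iff (measurableSet_triangle a t)] at hF
  have h := integral_integral_swap
    (f := fun s r => (triangle a t).indicator (Function.uncurry F) (s, r)) hF
  simpa only [integral_indicator_triangle_left, integral_indicator_triangle_right,
    integral_indicator measurableSet_Ioo] using h

lemma integrableOn_triangle {G : Type*} [NormedAddCommGroup G] {F : ℝ → ℝ → G}
    (hm : AEStronglyMeasurable (Function.uncurry F) (volume.prod volume))
    (hF : ∀ r ∈ Ioo a t, IntegrableOn (F · r) (Ioo r t))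
    (hF' : IntegrableOn (fun r => ∫ s in Ioo r t, ‖F s r‖) (Ioo a t)) :
    IntegrableOn (Function.uncurry F) (triangle a t) := by
  rw [← integrable_indicator_iff (measurableSet_triangle a t),
    Measure.volume_eq_prod, integrable_prod_iff' (hm.indicator (measurableSet_triangle a t))]
  constructor
  · refine Eventually.of_forall fun r => ?_
    simp only [indicator_triangle_right]
    by_cases hr : r ∈ Ioo a t
    · simpa only [indicator_of_mem hr] using (hF r hr).integrable_indicator measurableSet_Ioo
    · simp [indicator_of_notMem hr]
  · simp only [norm_indicator_eq_indicator_norm]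
    refine (hF'.integrable_indicator measurableSet_Ioo).congr (Eventually.of_forall fun r => ?_)
    exact (integral_indicator_triangle_right (fun s r => ‖F s r‖) a t r).symm

variable {b : ℝ} {f : ℝ → E}

lemma integrableOn_triangle_fracKernel_mul_fracKernel_smul (ha : 0 < a) (hb : 0 < b)
    (hab : 1 ≤ a + b) (hf : IntegrableOn f (Ioo 0 t)) :
    IntegrableOn (Function.uncurry fun s r =>
      (fracKernel a (t - s) * fracKernel b (s - r)) • (Ioo 0 t).indicator f r) (triangle 0 t) := by
  have hka : Measurable fun p : ℝ × ℝ => fracKernel a (t - p.1) :=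
    (measurable_fracKernel a).comp (measurable_const.sub measurable_fst)
  have hkb : Measurable fun p : ℝ × ℝ => fracKernel b (p.1 - p.2) :=
    (measurable_fracKernel b).comp (measurable_fst.sub measurable_snd)
  have hf' : Integrable ((Ioo 0 t).indicator f) := hf.integrable_indicator measurableSet_Ioo
  refine integrableOn_triangle
    ((hka.mul hkb).aestronglyMeasurable.smul hf'.aestronglyMeasurable.comp_snd)
    (fun _ _ => (integrableOn_fracKernel_mul_fracKernel_sub ha hb).smul_const _) ?_
  have hnorm : ∀ r ∈ Ioo 0 t, ∫ s in Ioo r t,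
      ‖(fracKernel a (t - s) * fracKernel b (s - r)) • (Ioo 0 t).indicator f r‖ =
        fracKernel (a + b) (t - r) * ‖f r‖ := by
    intro r hr
    rw [← integral_fracKernel_mul_fracKernel_sub ha hb hr.2, ← integral_mul_const]
    refine setIntegral_congr_fun measurableSet_Ioo fun s hs => ?_
    have hk := mul_pos (fracKernel_pos ha (sub_pos.2 hs.2)) (fracKernel_pos hb (sub_pos.2 hs.1))
    simp only [indicator_of_mem hr, norm_smul, Real.norm_of_nonneg hk.le]
  refine (integrableOn_congr_fun hnorm measurableSet_Ioo).2 ?_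
  refine Integrable.bdd_mul (c := fracKernel (a + b) t) hf.norm
    ((measurable_fracKernel _).comp (measurable_const.sub measurable_id)).aestronglyMeasurable ?_
  filter_upwards [ae_restrict_mem measurableSet_Ioo] with r hr
  rw [Real.norm_of_nonneg (fracKernel_pos (add_pos ha hb) (sub_pos.2 hr.2)).le]
  exact fracKernel_mono hab (sub_pos.2 hr.2).le (by linarith [hr.1])

lemma fracKernel_smul_fracInt {s : ℝ} (hs : s ∈ Ioo 0 t) :
    fracKernel a (t - s) • fracInt b f s = ∫ r in Ioo 0 s,
      (fracKernel a (t - s) * fracKernel b (s - r)) • (Ioo 0 t).indicator f r := by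
  rw [fracInt, ← integral_smul]
  refine setIntegral_congr_fun measurableSet_Ioo fun r hr => ?_
  simp only [smul_smul, indicator_of_mem (Ioo_subset_Ioo_right hs.2.le hr)]

lemma integrableOn_fracKernel_smul_fracInt (ha : 0 < a) (hb : 0 < b) (hab : 1 ≤ a + b)
    (hf : IntegrableOn f (Ioo 0 t)) :
    IntegrableOn (fun s => fracKernel a (t - s) • fracInt b f s) (Ioo 0 t) :=
  (integrableOn_congr_fun (fun _ hs => fracKernel_smul_fracInt hs) measurableSet_Ioo).2
    (integrableOn_integral_of_triangle
      (integrableOn_triangle_fracKernel_mul_fracKernel_smul ha hb hab hf))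

theorem fracInt_fracInt [CompleteSpace E] (ha : 0 < a) (hb : 0 < b) (hab : 1 ≤ a + b)
    (hf : IntegrableOn f (Ioo 0 t)) : fracInt a (fracInt b f) t = fracInt (a + b) f t := by
  rw [fracInt, setIntegral_congr_fun measurableSet_Ioo fun _ hs => fracKernel_smul_fracInt hs,
    integral_integral_swap_triangle
      (integrableOn_triangle_fracKernel_mul_fracKernel_smul ha hb hab hf)]
  refine setIntegral_congr_fun measurableSet_Ioo fun r hr => ?_
  rw [integral_smul_const, integral_fracKernel_mul_fracKernel_sub ha hb hr.2, indicator_of_mem hr]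

end Semigroup

/-! ### Mittag-Leffler functions -/

/-- The Mittag-Leffler function `E_{ρ,μ}` of a real argument. -/
def realML (ρ μ x : ℝ) : ℝ := ∑' k : ℕ, x ^ k / Real.Gamma (ρ * k + μ)

/-- The function `t^{μ-1} E_{ρ,μ}(-lam t^ρ)`: for `μ = 1` the relaxation function of the equation
`D_t^ρ v + lam v = 0`, for `μ = ρ` its resolvent kernel, for `μ = ρ + 1` the solution with zero
initial value and source `1`. -/
def mlFun (ρ lam μ t : ℝ) : ℝ := t ^ (μ - 1) * realML ρ μ (-lam * t ^ ρ)

lemma rpow_mul_exp_le_Gamma {R x : ℝ} (hR : 0 < R) (hx : 1 ≤ x) :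
    R ^ (x - 1) * Real.exp (-(R + 1)) ≤ Real.Gamma x := by
  have hx0 : 0 < x := by linarith
  rw [Real.Gamma_eq_integral hx0]
  have hsub : Ioo R (R + 1) ⊆ Ioi 0 := fun y hy => hR.trans hy.1
  have hint := Real.GammaIntegral_convergent hx0
  calc R ^ (x - 1) * Real.exp (-(R + 1))
      = ∫ _ in Ioo R (R + 1), R ^ (x - 1) * Real.exp (-(R + 1)) := by simp
    _ ≤ ∫ y in Ioo R (R + 1), Real.exp (-y) * y ^ (x - 1) := by
        refine setIntegral_mono_on (integrableOn_const (by simp)) (hint.mono_set hsub)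
          measurableSet_Ioo fun y hy => ?_
        rw [mul_comm]
        have := hy.1
        have := hy.2
        gcongr
    _ ≤ _ := by
        refine setIntegral_mono_set hint ?_ hsub.eventuallyLE
        filter_upwards [ae_restrict_mem measurableSet_Ioi] with y hy
        exact mul_nonneg (Real.exp_pos _).le (Real.rpow_nonneg (le_of_lt hy) _)

section Series

variable {ρ lam t : ℝ}

lemma summable_norm_realML (hρ : 0 < ρ) (μ x : ℝ) :
    Summable fun k : ℕ => ‖x ^ k / Real.Gamma (ρ * k + μ)‖ := by
  -- With `R ^ ρ = 2|x| + 1`, the bound `Γ(y) ≥ R ^ (y - 1) e ^ (-(R + 1))` beats `|x| ^ k`.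
  obtain ⟨R, hR0, hRρ⟩ : ∃ R : ℝ, 0 < R ∧ R ^ ρ = 2 * |x| + 1 :=
    ⟨(2 * |x| + 1) ^ ρ⁻¹, by positivity, Real.rpow_inv_rpow (by positivity) hρ.ne'⟩
  have hg : Summable fun k : ℕ => Real.exp (R + 1) * R ^ (1 - μ) * (1 / 2 : ℝ) ^ k :=
    (summable_geometric_of_lt_one (by norm_num) (by norm_num)).mul_left _
  refine Summable.of_norm_bounded_eventually_nat hg ?_
  have hlim : Tendsto (fun k : ℕ => ρ * (k : ℝ) + μ) atTop atTop :=
    tendsto_atTop_add_const_right _ _ (tendsto_natCast_atTop_atTop.const_mul_atTop hρ)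
  filter_upwards [hlim.eventually_ge_atTop 1] with k hk
  have hG := rpow_mul_exp_le_Gamma hR0 hk
  have hpos : 0 < R ^ (ρ * k + μ - 1) * Real.exp (-(R + 1)) := by positivity
  have hsplit : R ^ (ρ * k + μ - 1) = (2 * |x| + 1) ^ k * (R ^ (1 - μ))⁻¹ := by
    rw [← Real.rpow_neg hR0.le, ← hRρ, ← Real.rpow_natCast (R ^ ρ), ← Real.rpow_mul hR0.le,
      ← Real.rpow_add hR0]
    ring_nf
  have hhalf : |x| / (2 * |x| + 1) ≤ 1 / 2 := by
    rw [div_le_iff₀ (by positivity)]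
    linarith
  rw [norm_norm, norm_div, norm_pow, Real.norm_eq_abs, Real.norm_of_nonneg (hpos.le.trans hG)]
  calc |x| ^ k / Real.Gamma (ρ * k + μ)
      ≤ |x| ^ k / (R ^ (ρ * k + μ - 1) * Real.exp (-(R + 1))) := by gcongr
    _ = Real.exp (R + 1) * R ^ (1 - μ) * (|x| / (2 * |x| + 1)) ^ k := by
        rw [hsplit, Real.exp_neg, div_pow]
        field_simp
    _ ≤ Real.exp (R + 1) * R ^ (1 - μ) * (1 / 2) ^ k := by gcongr

lemma mittagLeffler_ofReal (ρ μ x : ℝ) : mittagLeffler ρ μ (x : ℂ) = realML ρ μ x := by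
  rw [mittagLeffler, realML, Complex.ofReal_tsum]
  simp

lemma continuous_realML (hρ : 0 < ρ) (μ : ℝ) : Continuous (realML ρ μ) := by
  refine continuous_iff_continuousAt.2 fun x => ?_
  have h : ContinuousOn (realML ρ μ) (Metric.ball 0 (|x| + 1)) := by
    refine continuousOn_tsum (fun k => by fun_prop) (summable_norm_realML hρ μ (|x| + 1)) ?_
    intro k y hy
    rw [norm_div, norm_div, norm_pow, norm_pow]
    have h1 : ‖y‖ ≤ ‖|x| + 1‖ := by
      rw [Real.norm_of_nonneg (by positivity : 0 ≤ |x| + 1)]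
      exact (mem_ball_zero_iff.1 hy).le
    gcongr
  exact h.continuousAt (Metric.isOpen_ball.mem_nhds (by simp))

lemma realML_zero (ρ μ : ℝ) : realML ρ μ 0 = 1 / Real.Gamma μ := by
  rw [realML, tsum_eq_single 0 fun k hk => by simp [hk]]
  simp

lemma realML_eq_add (hρ : 0 < ρ) (μ x : ℝ) :
    realML ρ μ x = 1 / Real.Gamma μ + x * realML ρ (μ + ρ) x := by
  rw [realML, (summable_norm_realML hρ μ x).of_norm.tsum_eq_zero_add, realML, ← tsum_mul_left]
  congr 1
  · simp
  · congr 1 with k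
    push_cast
    rw [pow_succ']
    ring_nf

lemma mlFun_zero (hρ : 0 < ρ) (lam μ : ℝ) : mlFun ρ lam μ 0 = fracKernel μ 0 := by
  rw [mlFun, Real.zero_rpow hρ.ne', mul_zero, realML_zero, mul_one_div, fracKernel]

lemma mlFun_one (ρ lam t : ℝ) : mlFun ρ lam 1 t = realML ρ 1 (-lam * t ^ ρ) := by
  simp [mlFun]

lemma mlFun_add_one (ρ lam t : ℝ) :
    mlFun ρ lam (ρ + 1) t = t ^ ρ * realML ρ (ρ + 1) (-lam * t ^ ρ) := by
  simp [mlFun]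

lemma mlFun_one_zero (hρ : 0 < ρ) (lam : ℝ) : mlFun ρ lam 1 0 = 1 := by
  rw [mlFun_zero hρ, fracKernel_one]

lemma mlFun_add_one_zero (hρ : 0 < ρ) (lam : ℝ) : mlFun ρ lam (ρ + 1) 0 = 0 := by
  rw [mlFun_add_one, Real.zero_rpow hρ.ne', zero_mul]

lemma mlFun_one_eq (hρ : 0 < ρ) (lam t : ℝ) :
    mlFun ρ lam 1 t = 1 - lam * mlFun ρ lam (ρ + 1) t := by
  rw [mlFun_one, mlFun_add_one, realML_eq_add hρ, Real.Gamma_one, add_comm 1 ρ]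
  ring

lemma mlFun_eq_sub (hρ : 0 < ρ) (lam μ : ℝ) (ht : 0 < t) :
    mlFun ρ lam μ t = fracKernel μ t - lam * mlFun ρ lam (μ + ρ) t := by
  rw [mlFun, realML_eq_add hρ, mlFun, fracKernel, add_sub_right_comm, Real.rpow_add ht]
  ring

lemma hasSum_mlFun (hρ : 0 < ρ) (lam μ : ℝ) (ht : 0 < t) :
    HasSum (fun k : ℕ => (-lam) ^ k * fracKernel (ρ * k + μ) t) (mlFun ρ lam μ t) := by
  have h := ((summable_norm_realML hρ μ (-lam * t ^ ρ)).of_norm.hasSum).mul_left (t ^ (μ - 1))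
  refine (congrArg (HasSum · _) (funext fun k => ?_)).mpr h
  have : t ^ (ρ * k + μ - 1) = t ^ (μ - 1) * (t ^ ρ) ^ k := by
    rw [← Real.rpow_natCast (t ^ ρ), ← Real.rpow_mul ht.le, ← Real.rpow_add ht]
    ring_nf
  rw [fracKernel, this, mul_pow]
  ring

lemma continuous_realML_comp (hρ : 0 < ρ) (lam μ : ℝ) :
    Continuous fun t : ℝ => realML ρ μ (-lam * t ^ ρ) :=
  (continuous_realML hρ μ).comp (continuous_const.mul (Real.continuous_rpow_const hρ.le))

lemma continuousOn_mlFun (hρ : 0 < ρ) (lam μ : ℝ) : ContinuousOn (mlFun ρ lam μ) (Ioi 0) :=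
  fun t ht => ((Real.continuousAt_rpow_const t _ (Or.inl (ne_of_gt ht))).mul
    (continuous_realML_comp hρ lam μ).continuousAt).continuousWithinAt

lemma continuous_mlFun (hρ : 0 < ρ) (lam : ℝ) {μ : ℝ} (hμ : 1 ≤ μ) :
    Continuous (mlFun ρ lam μ) :=
  (Real.continuous_rpow_const (by linarith)).mul (continuous_realML_comp hρ lam μ)

variable {b μ : ℝ}

lemma integrableOn_fracKernel_mul_mlFun (hρ : 0 < ρ) (lam : ℝ) (hb : 0 < b) (hμ : 0 < μ)
    (t : ℝ) : IntegrableOn (fun s => fracKernel b (t - s) * mlFun ρ lam μ s) (Ioo 0 t) := by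
  have hG := (Real.Gamma_pos_of_pos hμ).ne'
  have hfactor : (fun s => fracKernel b (t - s) * mlFun ρ lam μ s) = fun s =>
      (Real.Gamma μ * realML ρ μ (-lam * s ^ ρ)) * (fracKernel b (t - s) * fracKernel μ s) := by
    ext s
    simp only [mlFun, fracKernel]
    field_simp
  have hc : Continuous fun s : ℝ => Real.Gamma μ * realML ρ μ (-lam * s ^ ρ) :=
    continuous_const.mul (continuous_realML_comp hρ lam μ)
  obtain ⟨C, hC⟩ := (isCompact_Icc (a := 0) (b := t)).exists_bound_of_continuousOn hc.continuousOn
  rw [hfactor]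
  refine Integrable.bdd_mul (c := C) (integrableOn_fracKernel_mul_fracKernel t hb hμ)
    hc.aestronglyMeasurable ?_
  filter_upwards [ae_restrict_mem measurableSet_Ioo] with s hs
  exact hC s (Ioo_subset_Icc_self hs)

lemma integrableOn_mlFun (hρ : 0 < ρ) (lam : ℝ) (hμ : 0 < μ) (t : ℝ) :
    IntegrableOn (mlFun ρ lam μ) (Ioo 0 t) := by
  simpa only [fracKernel_one, one_mul] using
    integrableOn_fracKernel_mul_mlFun hρ lam one_pos hμ t

theorem fracInt_mlFun (hρ : 0 < ρ) (lam : ℝ) (hb : 0 < b) (hμ : 0 < μ) (ht : 0 < t) :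
    fracInt b (mlFun ρ lam μ) t = mlFun ρ lam (μ + b) t := by
  have hk (k : ℕ) : 0 < ρ * k + μ := by positivity
  have hterm (k : ℕ) (c : ℝ) : ∫ s in Ioo 0 t, fracKernel b (t - s) *
      (c * fracKernel (ρ * k + μ) s) = c * fracKernel (ρ * k + (μ + b)) t := by
    simp_rw [mul_left_comm _ c]
    rw [integral_const_mul, integral_fracKernel_mul_fracKernel hb (hk k) ht]
    ring_nf
  have hint (k : ℕ) : IntegrableOn
      (fun s => fracKernel b (t - s) * ((-lam) ^ k * fracKernel (ρ * k + μ) s)) (Ioo 0 t) := by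
    simp_rw [mul_left_comm _ ((-lam) ^ k)]
    exact (integrableOn_fracKernel_mul_fracKernel t hb (hk k)).const_mul _
  have hsum := hasSum_mlFun hρ lam (μ + b) ht
  have h := hasSum_integral_of_summable_integral_norm hint ?_
  · simp_rw [hterm] at h
    rw [← h.unique hsum, fracInt]
    refine setIntegral_congr_fun measurableSet_Ioo fun s hs => ?_
    rw [smul_eq_mul, ← (hasSum_mlFun hρ lam μ hs.1).tsum_eq, tsum_mul_left]
  · refine hsum.summable.norm.congr fun k => ?_
    rw [norm_mul, Real.norm_of_nonneg (fracKernel_pos (by positivity) ht).le, ← hterm]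
    refine setIntegral_congr_fun measurableSet_Ioo fun s hs => ?_
    rw [norm_mul, norm_mul, Real.norm_of_nonneg (fracKernel_pos hb (sub_pos.2 hs.2)).le,
      Real.norm_of_nonneg (fracKernel_pos (hk k) hs.1).le]

end Series

lemma setIntegral_Ioo_add_Ioo {E : Type*} [NormedAddCommGroup E] [NormedSpace ℝ E] {f : ℝ → E}
    {a b c : ℝ} (hf : IntegrableOn f (Ioo a c)) (hab : a ≤ b) (hbc : b ≤ c) :
    (∫ x in Ioo a b, f x) + ∫ x in Ioo b c, f x = ∫ x in Ioo a c, f x := by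
  rw [← integrableOn_Ioc_iff_integrableOn_Ioo] at hf
  simp only [← integral_Ioc_eq_integral_Ioo]
  rw [← Ioc_union_Ioc_eq_Ioc hab hbc, setIntegral_union (Ioc_disjoint_Ioc_of_le le_rfl)
    measurableSet_Ioc (hf.mono_set (Ioc_subset_Ioc_right hbc))
    (hf.mono_set (Ioc_subset_Ioc_left hab))]

lemma nonpos_of_le_setIntegral_mul {a b : ℝ} {z h : ℝ → ℝ} (hab : a ≤ b)
    (hz : ContinuousOn z (Icc a b)) (hh : IntegrableOn h (Ioo a b)) (hh0 : ∀ r ∈ Ioo a b, 0 ≤ h r)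
    (hh1 : ∫ r in Ioo a b, h r < 1) (hzb : z b ≤ 0)
    (hle : ∀ s ∈ Ico a b, z s ≤ ∫ r in Ioo s b, h r * z r) : z a ≤ 0 := by
  by_contra! hza
  obtain ⟨s, hs, hmax⟩ := isCompact_Icc.exists_isMaxOn (nonempty_Icc.2 hab) hz
  have hzs : 0 < z s := hza.trans_le (hmax (left_mem_Icc.2 hab))
  have hsb : s < b := hs.2.lt_of_ne fun h => (h ▸ hzs).not_ge hzb
  obtain ⟨M, hM⟩ := isCompact_Icc.exists_bound_of_continuousOn hz
  have hhz : IntegrableOn (fun r => h r * z r) (Ioo a b) := by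
    refine Integrable.mul_bdd (c := M) hh
      ((hz.mono Ioo_subset_Icc_self).aestronglyMeasurable measurableSet_Ioo) ?_
    filter_upwards [ae_restrict_mem measurableSet_Ioo] with r hr
      using hM r (Ioo_subset_Icc_self hr)
  have hsub : Ioo s b ⊆ Ioo a b := Ioo_subset_Ioo_left hs.1
  have : z s < 1 * z s :=
    calc z s ≤ ∫ r in Ioo s b, h r * z r := hle s ⟨hs.1, hsb⟩
      _ ≤ ∫ r in Ioo s b, h r * z s := by
          refine setIntegral_mono_on (hhz.mono_set hsub) ((hh.mono_set hsub).mul_const _)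
            measurableSet_Ioo fun r hr => ?_
          exact mul_le_mul_of_nonneg_left (hmax (Ioo_subset_Icc_self (hsub hr))) (hh0 r (hsub hr))
      _ = (∫ r in Ioo s b, h r) * z s := integral_mul_const _ _
      _ ≤ (∫ r in Ioo a b, h r) * z s := by
          refine mul_le_mul_of_nonneg_right (setIntegral_mono_set hh ?_ hsub.eventuallyLE) hzs.le
          filter_upwards [ae_restrict_mem measurableSet_Ioo] with r hr using hh0 r hr
      _ < 1 * z s := by gcongr
  linarith

lemma exists_first_nonpos {g : ℝ → ℝ} {t : ℝ} (hg : Continuous g) (h0 : 0 < g 0) (ht : 0 ≤ t)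
    (hgt : g t ≤ 0) : ∃ t₀ > 0, g t₀ ≤ 0 ∧ ∀ s ∈ Ioo 0 t₀, 0 < g s := by
  obtain ⟨t₀, ⟨ht₀, hgt₀⟩, hmin⟩ := (isCompact_Icc.inter_right
    (isClosed_Iic.preimage hg)).exists_isLeast (⟨t, ⟨ht, le_rfl⟩, hgt⟩ :
      (Icc 0 t ∩ g ⁻¹' Iic 0).Nonempty)
  have hpos : 0 < t₀ := ht₀.1.lt_of_ne fun h => h0.not_ge (h ▸ hgt₀)
  refine ⟨t₀, hpos, hgt₀, fun s hs => ?_⟩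
  by_contra! hgs
  exact hs.2.not_ge (hmin ⟨⟨hs.1.le, hs.2.le.trans ht₀.2⟩, hgs⟩)

section Positivity

variable {ρ lam t t₀ : ℝ}

lemma mlFun_self_eq_sub_fracInt (hρ : 0 < ρ) (lam : ℝ) (ht : 0 < t) :
    mlFun ρ lam ρ t = fracKernel ρ t - lam * fracInt ρ (mlFun ρ lam ρ) t := by
  rw [mlFun_eq_sub hρ lam ρ ht, fracInt_mlFun hρ lam hρ hρ ht]

lemma fracKernel_mul_mlFun_le (hρ : 0 < ρ) (hρ1 : ρ ≤ 1) (hlam : 0 ≤ lam)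
    (hpos : ∀ r ∈ Ioo 0 t₀, 0 < mlFun ρ lam ρ r) (ht₀ : mlFun ρ lam ρ t₀ ≤ 0) (ht : t ∈ Ioo 0 t₀) :
    fracKernel ρ t₀ * mlFun ρ lam ρ t ≤
      fracKernel ρ t * (lam * ∫ r in Ioo t t₀, fracKernel ρ (t₀ - r) * mlFun ρ lam ρ r) := by
  have hint (s : ℝ) := integrableOn_fracKernel_mul_mlFun hρ lam hρ hρ s
  have hsplit : fracInt ρ (mlFun ρ lam ρ) t₀ =
      (∫ r in Ioo 0 t, fracKernel ρ (t₀ - r) * mlFun ρ lam ρ r) +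
        ∫ r in Ioo t t₀, fracKernel ρ (t₀ - r) * mlFun ρ lam ρ r :=
    (setIntegral_Ioo_add_Ioo (hint t₀) ht.1.le ht.2.le).symm
  have hpast : fracKernel ρ t * ∫ r in Ioo 0 t, fracKernel ρ (t₀ - r) * mlFun ρ lam ρ r ≤
      fracKernel ρ t₀ * fracInt ρ (mlFun ρ lam ρ) t := by
    rw [fracInt, ← integral_const_mul, ← integral_const_mul]
    refine setIntegral_mono_on (((hint t₀).mono_set (Ioo_subset_Ioo_right ht.2.le)).const_mul _)
      ((hint t).const_mul _) measurableSet_Ioo fun r hr => ?_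
    rw [smul_eq_mul, ← mul_assoc, ← mul_assoc]
    exact mul_le_mul_of_nonneg_right (fracKernel_mul_le hρ hρ1 hr.1 hr.2 ht.2.le)
      (hpos r ⟨hr.1, hr.2.trans ht.2⟩).le
  rw [mlFun_self_eq_sub_fracInt hρ lam (ht.1.trans ht.2), hsplit] at ht₀
  rw [mlFun_self_eq_sub_fracInt hρ lam ht.1]
  nlinarith [mul_le_mul_of_nonneg_left hpast hlam,
    mul_nonneg (fracKernel_pos hρ ht.1).le (neg_nonneg.2 ht₀)]

lemma mlFun_self_pos_of_pos_before (hρ : 0 < ρ) (hρ1 : ρ ≤ 1) (hlam : 0 ≤ lam) (ht₀ : 0 < t₀)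
    (hpos : ∀ r ∈ Ioo 0 t₀, 0 < mlFun ρ lam ρ r) : 0 < mlFun ρ lam ρ t₀ := by
  by_contra! hneg
  have hk₀ := fracKernel_pos hρ ht₀
  set C := lam * fracKernel ρ (t₀ / 2) / fracKernel ρ t₀
  have hC : 0 ≤ C := div_nonneg (mul_nonneg hlam (fracKernel_pos hρ (half_pos ht₀)).le) hk₀.le
  obtain ⟨a, ha1, ha2, hat⟩ : ∃ a, C * fracKernel (ρ + 1) (t₀ - a) < 1 ∧ t₀ / 2 < a ∧ a < t₀ := by
    have hcont : Continuous fun a => C * fracKernel (ρ + 1) (t₀ - a) := by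
      simp only [fracKernel_add_one]
      exact continuous_const.mul (((continuous_const.sub continuous_id).rpow_const
        fun _ => Or.inr hρ.le).div_const _)
    have hlim : Tendsto (fun a => C * fracKernel (ρ + 1) (t₀ - a)) (𝓝[<] t₀) (𝓝 0) := by
      simpa [fracKernel_add_one, Real.zero_rpow hρ.ne'] using
        (hcont.tendsto t₀).mono_left nhdsWithin_le_nhds
    exact ((hlim.eventually_lt_const one_pos).and (Ioo_mem_nhdsLT (half_lt_self ht₀))).exists
  have ha0 : 0 < a := (half_pos ht₀).trans ha2
  refine (hpos a ⟨ha0, hat⟩).not_ge (nonpos_of_le_setIntegral_mul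
    (h := fun r => C * fracKernel ρ (t₀ - r)) hat.le
    ((continuousOn_mlFun hρ lam ρ).mono fun r hr => ha0.trans_le hr.1)
    ((integrableOn_fracKernel_sub hρ).const_mul C)
    (fun r hr => mul_nonneg hC (fracKernel_pos hρ (sub_pos.2 hr.2)).le) ?_ hneg fun s hs => ?_)
  · rwa [integral_const_mul, integral_fracKernel_sub hρ hat]
  · have hs0 : 0 < s := ha0.trans_le hs.1
    have hmem : 0 ≤ lam * ∫ r in Ioo s t₀, fracKernel ρ (t₀ - r) * mlFun ρ lam ρ r :=
      mul_nonneg hlam (setIntegral_nonneg measurableSet_Ioo fun r hr =>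
        mul_nonneg (fracKernel_pos hρ (sub_pos.2 hr.2)).le (hpos r ⟨hs0.trans hr.1, hr.2⟩).le)
    have hks := fracKernel_le_of_le hρ hρ1 (half_pos ht₀) (ha2.le.trans hs.1)
    simp only [mul_assoc, C]
    rw [integral_const_mul, div_mul_eq_mul_div, le_div_iff₀ hk₀, mul_comm]
    refine (fracKernel_mul_mlFun_le hρ hρ1 hlam hpos hneg ⟨hs0, hs.2⟩).trans ?_
    refine (mul_le_mul_of_nonneg_right hks hmem).trans_eq ?_
    ring

lemma mlFun_self_pos (hρ : 0 < ρ) (hρ1 : ρ ≤ 1) (hlam : 0 ≤ lam) (ht : 0 < t) :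
    0 < mlFun ρ lam ρ t := by
  have hiff {s : ℝ} (hs : 0 < s) : 0 < mlFun ρ lam ρ s ↔ 0 < realML ρ ρ (-lam * s ^ ρ) :=
    mul_pos_iff_of_pos_left (Real.rpow_pos_of_pos hs _)
  by_contra! hneg
  obtain ⟨t₀, ht₀, hgt₀, hpos⟩ := exists_first_nonpos (continuous_realML_comp hρ lam ρ)
    (by simpa [Real.zero_rpow hρ.ne', realML_zero] using Real.Gamma_pos_of_pos hρ) ht.le
    (not_lt.1 fun h => hneg.not_gt ((hiff ht).2 h))
  exact hgt₀.not_gt ((hiff ht₀).1 (mlFun_self_pos_of_pos_before hρ hρ1 hlam ht₀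
    fun r hr => (hiff hr.1).2 (hpos r hr)))

variable {μ : ℝ}

theorem mlFun_pos (hρ : 0 < ρ) (hρ1 : ρ ≤ 1) (hlam : 0 ≤ lam) (hμ : ρ ≤ μ) (ht : 0 < t) :
    0 < mlFun ρ lam μ t := by
  rcases hμ.eq_or_lt with rfl | hμ
  · exact mlFun_self_pos hρ hρ1 hlam ht
  have h := fracInt_mlFun hρ lam (sub_pos.2 hμ) hρ ht
  rw [add_sub_cancel] at h
  rw [← h]
  exact fracInt_pos (sub_pos.2 hμ) ht
    (integrableOn_fracKernel_mul_mlFun hρ lam (sub_pos.2 hμ) hρ t)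
    fun s hs => mlFun_self_pos hρ hρ1 hlam hs.1

end Positivity

section Bounds

variable {ρ lam μ s t : ℝ}

lemma mlFun_nonneg (hρ : 0 < ρ) (hρ1 : ρ ≤ 1) (hlam : 0 ≤ lam) (hμ : ρ ≤ μ) (ht : 0 ≤ t) :
    0 ≤ mlFun ρ lam μ t := by
  rcases ht.eq_or_lt with rfl | ht
  · rw [mlFun_zero hρ]
    exact fracKernel_nonneg (hρ.trans_le hμ) le_rfl
  · exact (mlFun_pos hρ hρ1 hlam hμ ht).le

lemma mlFun_le_fracKernel (hρ : 0 < ρ) (hρ1 : ρ ≤ 1) (hlam : 0 ≤ lam) (hμ : ρ ≤ μ) (ht : 0 ≤ t) :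
    mlFun ρ lam μ t ≤ fracKernel μ t := by
  rcases ht.eq_or_lt with rfl | ht
  · exact (mlFun_zero hρ lam μ).le
  · rw [mlFun_eq_sub hρ lam μ ht, sub_le_self_iff]
    exact mul_nonneg hlam (mlFun_nonneg hρ hρ1 hlam (by linarith) ht.le)

lemma mlFun_one_le_one (hρ : 0 < ρ) (hρ1 : ρ ≤ 1) (hlam : 0 ≤ lam) (ht : 0 ≤ t) :
    mlFun ρ lam 1 t ≤ 1 :=
  (mlFun_le_fracKernel hρ hρ1 hlam hρ1 ht).trans_eq (fracKernel_one t)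

lemma mul_mlFun_add_one_le_one (hρ : 0 < ρ) (hρ1 : ρ ≤ 1) (hlam : 0 ≤ lam) (ht : 0 ≤ t) :
    lam * mlFun ρ lam (ρ + 1) t ≤ 1 := by
  have h := mlFun_nonneg hρ hρ1 hlam hρ1 ht
  rw [mlFun_one_eq hρ] at h
  linarith

lemma mlFun_add_one_mono (hρ : 0 < ρ) (hρ1 : ρ ≤ 1) (hlam : 0 ≤ lam) (hs : 0 < s)
    (hst : s ≤ t) : mlFun ρ lam (ρ + 1) s ≤ mlFun ρ lam (ρ + 1) t := by
  rw [← fracInt_mlFun hρ lam one_pos hρ hs, ← fracInt_mlFun hρ lam one_pos hρ (hs.trans_le hst),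
    fracInt_one, fracInt_one]
  refine setIntegral_mono_set (integrableOn_mlFun hρ lam hρ t) ?_
    (Ioo_subset_Ioo_right hst).eventuallyLE
  filter_upwards [ae_restrict_mem measurableSet_Ioo] with r hr
  exact (mlFun_self_pos hρ hρ1 hlam hr.1).le

lemma mlFun_one_le_of_le (hρ : 0 < ρ) (hρ1 : ρ ≤ 1) (hlam : 0 ≤ lam) (hs : 0 < s)
    (hst : s ≤ t) : mlFun ρ lam 1 t ≤ mlFun ρ lam 1 s := by
  rw [mlFun_one_eq hρ, mlFun_one_eq hρ]
  linarith [mul_le_mul_of_nonneg_left (mlFun_add_one_mono hρ hρ1 hlam hs hst) hlam]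

lemma rpow_mul_mlFun_one_le (hρ : 0 < ρ) (hρ1 : ρ ≤ 1) (hlam : 0 ≤ lam) (ht : 0 < t) :
    t ^ ρ * mlFun ρ lam 1 t ≤ Real.Gamma (ρ + 1) * mlFun ρ lam (ρ + 1) t := by
  have h : fracKernel (ρ + 1) t * mlFun ρ lam 1 t ≤ mlFun ρ lam (ρ + 1) t := by
    rw [add_comm ρ, ← fracInt_mlFun hρ lam hρ one_pos ht, add_comm, ← sub_zero (t : ℝ),
      ← integral_fracKernel_sub hρ ht, ← integral_mul_const, sub_zero]
    exact setIntegral_mono_on ((integrableOn_fracKernel_sub hρ).mul_const _)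
      (integrableOn_fracKernel_mul_mlFun hρ lam hρ one_pos t) measurableSet_Ioo fun s hs =>
        mul_le_mul_of_nonneg_left (mlFun_one_le_of_le hρ hρ1 hlam hs.1 hs.2.le)
          (fracKernel_pos hρ (sub_pos.2 hs.2)).le
  rwa [fracKernel_add_one, div_mul_eq_mul_div, div_le_iff₀' (Real.Gamma_pos_of_pos (by linarith))]
    at h

lemma mul_mlFun_one_le (hρ : 0 < ρ) (hρ1 : ρ ≤ 1) (hlam : 0 ≤ lam) (ht : 0 < t) :
    lam * mlFun ρ lam 1 t ≤ Real.Gamma (ρ + 1) / t ^ ρ := by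
  have hG := Real.Gamma_pos_of_pos (add_pos hρ one_pos)
  rw [le_div_iff₀ (Real.rpow_pos_of_pos ht ρ)]
  nlinarith [mul_le_mul_of_nonneg_left (rpow_mul_mlFun_one_le hρ hρ1 hlam ht) hlam,
    mul_le_mul_of_nonneg_left (mul_mlFun_add_one_le_one hρ hρ1 hlam ht.le) hG.le]

lemma rpow_le_mul_mlFun_add_one (hρ : 0 < ρ) (hρ1 : ρ ≤ 1) (hlam : 0 ≤ lam) (ht : 0 < t) :
    t ^ ρ ≤ (Real.Gamma (ρ + 1) + lam * t ^ ρ) * mlFun ρ lam (ρ + 1) t := by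
  have h := rpow_mul_mlFun_one_le hρ hρ1 hlam ht
  rw [mlFun_one_eq hρ] at h
  linarith

lemma mul_mlFun_le_mul_mlFun_add_one (hρ : 0 < ρ) (hρ1 : ρ ≤ 1) (hlam : 0 ≤ lam) (hμ : 0 < μ)
    (ht : 0 < t) : t * mlFun ρ lam μ t ≤ μ * mlFun ρ lam (μ + 1) t := by
  have hμ1 : 0 < μ + 1 := by linarith
  have hconv : μ * mlFun ρ lam (μ + 1 + ρ) t ≤ t * mlFun ρ lam (μ + ρ) t := by
    rw [add_comm _ ρ, add_comm _ ρ, ← fracInt_mlFun hρ lam hμ hρ ht,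
      ← fracInt_mlFun hρ lam hμ1 hρ ht, fracInt, fracInt, ← integral_const_mul,
      ← integral_const_mul]
    refine setIntegral_mono_on
      ((integrableOn_fracKernel_mul_mlFun hρ lam hμ1 hρ t).const_mul _)
      ((integrableOn_fracKernel_mul_mlFun hρ lam hμ hρ t).const_mul _)
      measurableSet_Ioo fun s hs => ?_
    have hz := mlFun_self_pos hρ hρ1 hlam hs.1
    have hk := fracKernel_pos hμ (sub_pos.2 hs.2)
    rw [smul_eq_mul, smul_eq_mul, ← mul_assoc, ← mul_assoc,
      mul_fracKernel_add_one hμ (sub_pos.2 hs.2)]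
    gcongr
    linarith [hs.1]
  rw [mlFun_eq_sub hρ lam μ ht, mlFun_eq_sub hρ lam (μ + 1) ht]
  nlinarith [mul_le_mul_of_nonneg_left hconv hlam, mul_fracKernel_add_one hμ ht]

lemma mul_mlFun_self_le (hρ : 0 < ρ) (hρ1 : ρ ≤ 1) (hlam : 0 ≤ lam) (ht : 0 < t) :
    lam * mlFun ρ lam ρ t ≤ ρ / t := by
  rw [le_div_iff₀ ht]
  nlinarith [mul_le_mul_of_nonneg_left (mul_mlFun_le_mul_mlFun_add_one hρ hρ1 hlam hρ ht) hlam,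
    mul_le_mul_of_nonneg_left (mul_mlFun_add_one_le_one hρ hρ1 hlam ht.le) hρ.le]

end Bounds

section Deriv

variable {ρ t : ℝ}

lemma hasDerivAt_mlFun_add_one (hρ : 0 < ρ) (lam : ℝ) (ht : 0 < t) :
    HasDerivAt (mlFun ρ lam (ρ + 1)) (mlFun ρ lam ρ t) t := by
  have hii : IntervalIntegrable (mlFun ρ lam ρ) volume 0 t := by
    rw [intervalIntegrable_iff_integrableOn_Ioo_of_le ht.le]
    exact integrableOn_mlFun hρ lam hρ t
  have h := intervalIntegral.integral_hasDerivAt_right hii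
    ((continuousOn_mlFun hρ lam ρ).stronglyMeasurableAtFilter isOpen_Ioi t ht)
    ((continuousOn_mlFun hρ lam ρ).continuousAt (Ioi_mem_nhds ht))
  refine h.congr_of_eventuallyEq ?_
  filter_upwards [Ioi_mem_nhds ht] with s hs
  rw [← fracInt_mlFun hρ lam one_pos hρ hs, fracInt_one_eq_intervalIntegral _ (le_of_lt hs)]

lemma hasDerivAt_mlFun_one (hρ : 0 < ρ) (lam : ℝ) (ht : 0 < t) :
    HasDerivAt (mlFun ρ lam 1) (-lam * mlFun ρ lam ρ t) t := by
  rw [neg_mul, funext (mlFun_one_eq hρ lam)]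
  exact ((hasDerivAt_mlFun_add_one hρ lam ht).const_mul lam).const_sub 1

end Deriv

/-! ### Abel–Volterra equations and the Caputo derivative -/

section Volterra

variable {ρ T t : ℝ} {lam : ℂ} {Y : ℝ → ℂ}

lemma norm_le_of_eq_fracInt {M : ℝ} (hρ : 0 < ρ) (hM : ∀ t ∈ Ioc 0 T, ‖Y t‖ ≤ M)
    (h : ∀ t ∈ Ioc 0 T, Y t = lam * fracInt ρ Y t) (k : ℕ) :
    ∀ t ∈ Ioc 0 T, ‖Y t‖ ≤ M * ‖lam‖ ^ k * fracKernel (ρ * k + 1) t := by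
  induction k with
  | zero => simpa [fracKernel_one] using hM
  | succ k ih =>
    intro t ht
    have hk : 0 < ρ * k + 1 := by positivity
    have hiter : ‖fracInt ρ Y t‖ ≤
        ∫ s in Ioo 0 t, fracKernel ρ (t - s) * (M * ‖lam‖ ^ k * fracKernel (ρ * k + 1) s) := by
      refine norm_fracInt_le_fracInt hρ ?_ fun s hs => ih s ⟨hs.1, hs.2.le.trans ht.2⟩
      simp_rw [mul_left_comm _ (M * ‖lam‖ ^ k)]
      exact (integrableOn_fracKernel_mul_fracKernel t hρ hk).const_mul _
    simp_rw [mul_left_comm _ (M * ‖lam‖ ^ k)] at hiter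
    rw [integral_const_mul, integral_fracKernel_mul_fracKernel hρ hk ht.1] at hiter
    rw [h t ht, norm_mul]
    refine (mul_le_mul_of_nonneg_left hiter (norm_nonneg lam)).trans_eq ?_
    rw [show ρ * ((k + 1 : ℕ) : ℝ) + 1 = ρ + (ρ * k + 1) by push_cast; ring, pow_succ]
    ring

theorem eq_zero_of_eq_fracInt (hρ : 0 < ρ) (hY : ContinuousOn Y (Icc 0 T))
    (h : ∀ t ∈ Ioc 0 T, Y t = lam * fracInt ρ Y t) : ∀ t ∈ Ioc 0 T, Y t = 0 := by
  obtain ⟨M, hM⟩ := isCompact_Icc.exists_bound_of_continuousOn hY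
  intro t ht
  have hlim := (hasSum_mlFun hρ (-‖lam‖) 1 ht.1).summable.tendsto_atTop_zero.const_mul M
  simp only [neg_neg, mul_zero, ← mul_assoc] at hlim
  exact norm_le_zero_iff.1 (ge_of_tendsto' hlim fun k =>
    norm_le_of_eq_fracInt hρ (fun s hs => hM s (Ioc_subset_Icc_self hs)) h k t ht)

variable {D : ℝ → ℂ}

lemma integrableOn_Ioo_of_continuousOn (hD : ContinuousOn D (Icc 0 T)) (ht : t ≤ T) :
    IntegrableOn D (Ioo 0 t) :=
  hD.integrableOn_Icc.mono_set fun _ hs => ⟨hs.1.le, hs.2.le.trans ht⟩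

lemma continuousOn_fracInt_one (hD : ContinuousOn D (Icc 0 T)) :
    ContinuousOn (fracInt 1 D) (Icc 0 T) := by
  rcases le_or_gt 0 T with hT | hT
  · have h := intervalIntegral.continuousOn_primitive_interval
      (f := D) (μ := volume) (a := 0) (b := T)
      (by simpa only [uIcc_of_le hT] using hD.integrableOn_Icc)
    rw [uIcc_of_le hT] at h
    exact h.congr fun t ht => fracInt_one_eq_intervalIntegral D ht.1
  · simp [Icc_eq_empty_of_lt hT]

lemma eq_zero_of_fracInt_one_eq_zero (hT : 0 < T) (hD : ContinuousOn D (Icc 0 T))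
    (h : ∀ t ∈ Icc 0 T, fracInt 1 D t = 0) : ∀ t ∈ Icc 0 T, D t = 0 := by
  intro t ht
  have : Fact (t ∈ Icc 0 T) := ⟨ht⟩
  have hii : IntervalIntegrable D volume 0 t :=
    (hD.mono (by rw [uIcc_of_le ht.1]; exact Icc_subset_Icc_right ht.2)).intervalIntegrable
  have hprim : HasDerivWithinAt (fun t => ∫ s in (0 : ℝ)..t, D s) (D t) (Icc 0 T) t :=
    intervalIntegral.integral_hasDerivWithinAt_right hii
      (hD.stronglyMeasurableAtFilter_nhdsWithin measurableSet_Icc t) (hD t ht)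
  have hzero : HasDerivWithinAt (fun t => ∫ s in (0 : ℝ)..t, D s) 0 (Icc 0 T) t :=
    (hasDerivWithinAt_const t _ 0).congr
      (fun s hs => by rw [← fracInt_one_eq_intervalIntegral D hs.1, h s hs])
      (by rw [← fracInt_one_eq_intervalIntegral D ht.1, h t ht])
  exact (uniqueDiffOn_Icc hT t ht).eq_deriv _ hprim hzero

theorem eq_zero_of_fracInt_eq (hρ : 0 < ρ) (hρ1 : ρ < 1) (hT : 0 < T)
    (hD : ContinuousOn D (Icc 0 T))
    (h : ∀ t ∈ Ioc 0 T, fracInt (1 - ρ) D t = lam * fracInt 1 D t) :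
    ∀ t ∈ Icc 0 T, D t = 0 := by
  -- Applying `fracInt ρ` shows that the primitive of `D` solves an Abel–Volterra equation.
  have hprim : ∀ t ∈ Ioc 0 T, fracInt 1 D t = lam * fracInt ρ (fracInt 1 D) t := by
    intro t ht
    have hsemi := fracInt_fracInt hρ (sub_pos.2 hρ1) (by linarith)
      (integrableOn_Ioo_of_continuousOn hD ht.2)
    rw [add_sub_cancel] at hsemi
    rw [← hsemi, ← fracInt_const_mul]
    exact fracInt_congr fun s hs => h s ⟨hs.1, hs.2.le.trans ht.2⟩
  refine eq_zero_of_fracInt_one_eq_zero hT hD fun t ht => ?_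
  rcases ht.1.eq_or_lt with rfl | ht0
  · exact fracInt_of_nonpos _ _ le_rfl
  · exact eq_zero_of_eq_fracInt hρ (continuousOn_fracInt_one hD) hprim t ⟨ht0, ht.2⟩

lemma eq_integral_of_tendsto_zero {J G : ℝ → ℂ} (ht : 0 < t) (hG : IntegrableOn G (Icc 0 t))
    (hJ : ∀ a ∈ Ioc 0 t, J t - J a = ∫ s in a..t, G s) (hlim : Tendsto J (𝓝[>] 0) (𝓝 0)) :
    J t = ∫ s in (0 : ℝ)..t, G s := by
  have hcont := intervalIntegral.continuousOn_primitive_interval_left (f := G) (a := 0) (b := t)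
    (by rwa [uIcc_of_le ht.le])
  rw [uIcc_of_le ht.le] at hcont
  have hint : Tendsto (fun a => ∫ s in a..t, G s) (𝓝[>] 0) (𝓝 (∫ s in (0 : ℝ)..t, G s)) :=
    (hcont 0 (left_mem_Icc.2 ht.le)).mono_left
      (nhdsWithin_le_of_mem (mem_of_superset (Ioc_mem_nhdsGT ht) Ioc_subset_Icc_self))
  have hdiff : Tendsto (fun a => J t - J a) (𝓝[>] 0) (𝓝 (J t)) := by
    simpa only [sub_zero] using tendsto_const_nhds.sub hlim
  refine tendsto_nhds_unique (hdiff.congr' ?_) hint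
  filter_upwards [Ioc_mem_nhdsGT ht] with a ha using hJ a ha

end Volterra

section Caputo

variable {ρ T t : ℝ} {v : ℝ → ℂ}

lemma rpow_neg_eq_fracKernel (hρ1 : ρ < 1) (r : ℝ) :
    r ^ (-ρ) = Real.Gamma (1 - ρ) * fracKernel (1 - ρ) r := by
  rw [fracKernel, mul_div_cancel₀ _ (Real.Gamma_pos_of_pos (sub_pos.2 hρ1)).ne']
  ring_nf

lemma caputo_eq_fracInt (hρ1 : ρ < 1) (T : ℝ) (v : ℝ → ℂ) (t : ℝ) :
    caputo ρ T v t = fracInt (1 - ρ) (deriv v) t := by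
  have hG := (Real.Gamma_pos_of_pos (sub_pos.2 hρ1)).ne'
  rw [caputo, if_neg hρ1.ne, fracInt, ← integral_const_mul]
  congr 1 with s
  rw [rpow_neg_eq_fracKernel hρ1, Complex.real_smul, Complex.ofReal_mul, mul_assoc,
    inv_mul_cancel_left₀ (by exact_mod_cast hG)]

lemma hasCaputo_iff (hρ1 : ρ < 1) : HasCaputo ρ T v t ↔
    (∀ s ∈ Ioo 0 t, DifferentiableAt ℝ v s) ∧
      IntegrableOn (fun s => fracKernel (1 - ρ) (t - s) • deriv v s) (Ioo 0 t) := by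
  have hG := (Real.Gamma_pos_of_pos (sub_pos.2 hρ1)).ne'
  have hker : (fun s => (((t - s) ^ (-ρ) : ℝ) : ℂ) * deriv v s) =
      fun s => (Real.Gamma (1 - ρ) : ℂ) * (fracKernel (1 - ρ) (t - s) • deriv v s) := by
    ext s
    rw [rpow_neg_eq_fracKernel hρ1, Complex.real_smul, Complex.ofReal_mul, mul_assoc]
  rw [HasCaputo, if_neg hρ1.ne, hker]
  exact and_congr_right fun _ =>
    integrable_const_mul_iff (isUnit_iff_ne_zero.2 (by exact_mod_cast hG)) _

lemma HasCaputo.integrableOn_deriv (hρ : 0 < ρ) (hρ1 : ρ < 1) (hv : HasCaputo ρ T v t) :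
    IntegrableOn (deriv v) (Ioo 0 t) := by
  have hk : ∀ s ∈ Ioo 0 t, fracKernel (1 - ρ) t ≤ fracKernel (1 - ρ) (t - s) := fun s hs =>
    fracKernel_le_of_le (by linarith) (by linarith) (sub_pos.2 hs.2) (by linarith [hs.1])
  rcases le_or_gt t 0 with ht | ht
  · simp [Ioo_eq_empty_of_le ht]
  have hkt := fracKernel_pos (sub_pos.2 hρ1) ht
  refine ((((hasCaputo_iff hρ1).1 hv).2.norm.const_mul (fracKernel (1 - ρ) t)⁻¹).mono'
    (measurable_deriv v).aestronglyMeasurable ?_)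
  filter_upwards [ae_restrict_mem measurableSet_Ioo] with s hs
  rw [norm_smul, Real.norm_of_nonneg (hkt.le.trans (hk s hs)), inv_mul_eq_div, le_div_iff₀ hkt,
    mul_comm]
  exact mul_le_mul_of_nonneg_right (hk s hs) (norm_nonneg _)

lemma HasCaputo.fracInt_one_deriv (hρ : 0 < ρ) (hρ1 : ρ < 1) (hv : HasCaputo ρ T v t)
    (hvc : ContinuousOn v (Icc 0 t)) {s : ℝ} (hs : s ∈ Ioo 0 t) :
    fracInt 1 (deriv v) s = v s - v 0 := by
  rw [fracInt_one_eq_intervalIntegral _ hs.1.le]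
  refine intervalIntegral.integral_eq_sub_of_hasDerivAt_of_le hs.1.le
    (hvc.mono (Icc_subset_Icc_right hs.2.le))
    (fun r hr => (((hasCaputo_iff hρ1).1 hv).1 r ⟨hr.1, hr.2.trans hs.2⟩).hasDerivAt) ?_
  rw [intervalIntegrable_iff_integrableOn_Ioo_of_le hs.1.le]
  exact (hv.integrableOn_deriv hρ hρ1).mono_set (Ioo_subset_Ioo_right hs.2.le)

lemma HasCaputo.integrableOn_caputo (hρ : 0 < ρ) (hρ1 : ρ < 1) (hv : HasCaputo ρ T v t) :
    IntegrableOn (caputo ρ T v) (Ioo 0 t) := by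
  rw [funext (caputo_eq_fracInt hρ1 T v)]
  simpa only [fracKernel_one, one_smul] using integrableOn_fracKernel_smul_fracInt one_pos
    (sub_pos.2 hρ1) (by linarith) (hv.integrableOn_deriv hρ hρ1)

lemma HasCaputo.integral_caputo (hρ : 0 < ρ) (hρ1 : ρ < 1) (hv : HasCaputo ρ T v t)
    (hvc : ContinuousOn v (Icc 0 t)) :
    ∫ s in Ioo 0 t, caputo ρ T v s = fracInt (1 - ρ) (fun s => v s - v 0) t := by
  have h1ρ : 0 < 1 - ρ := sub_pos.2 hρ1
  have hd := hv.integrableOn_deriv hρ hρ1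
  rw [funext (caputo_eq_fracInt hρ1 T v), ← fracInt_one, fracInt_fracInt one_pos h1ρ (by linarith)
    hd, add_comm, ← fracInt_fracInt h1ρ one_pos (by linarith) hd]
  exact fracInt_congr fun s hs => hv.fracInt_one_deriv hρ hρ1 hvc hs

end Caputo

/-! ### Trigonometric series -/

section TrigSeries

variable {N : ℕ}

/-- The trigonometric series `∑ c_n e^{inx}`. -/
def trigSeries (c : (Fin N → ℤ) → ℂ) (x : Fin N → ℝ) : ℂ := ∑' n, c n * expMode n x

/-- Summability of `c` with the weight `(1 + ‖n‖)^k`, which makes `trigSeries c` a `C^k` function.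
The norm of `n : Fin N → ℤ` is the sup norm. -/
def WeightSummable (k : ℕ) (c : (Fin N → ℤ) → ℂ) : Prop :=
  Summable fun n => (1 + ‖n‖) ^ k * ‖c n‖

/-- The real-linear form `x ↦ ∑ n_j x_j` in the exponent of `expMode n`, with values in `ℂ`. -/
def phase (n : Fin N → ℤ) : (Fin N → ℝ) →L[ℝ] ℂ :=
  ∑ j, (n j : ℂ) • (Complex.ofRealCLM.comp (ContinuousLinearMap.proj j))

variable (n : Fin N → ℤ) (x : Fin N → ℝ)

lemma phase_apply : phase n x = ∑ j, (n j : ℂ) * (x j : ℂ) := by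
  simp [phase]

lemma phase_single (j : Fin N) (r : ℝ) : phase n (Pi.single j r) = n j * r := by
  rw [phase_apply, Finset.sum_eq_single_of_mem j (Finset.mem_univ j) fun i _ hi => by simp [hi]]
  simp

lemma norm_phase_le : ‖phase n‖ ≤ N * ‖n‖ := by
  refine ContinuousLinearMap.opNorm_le_bound _ (by positivity) fun x => ?_
  rw [phase_apply]
  calc ‖∑ j, (n j : ℂ) * (x j : ℂ)‖ ≤ ∑ _j : Fin N, ‖n‖ * ‖x‖ := by
        refine norm_sum_le_of_le _ fun j _ => ?_
        rw [norm_mul, Complex.norm_real, Complex.norm_intCast, ← Int.norm_eq_abs]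
        gcongr
        exacts [norm_le_pi_norm n j, norm_le_pi_norm x j]
    _ = N * ‖n‖ * ‖x‖ := by simp [mul_assoc]

lemma expMode_eq_exp_phase : expMode n = fun x => Complex.exp (Complex.I * phase n x) := by
  ext x
  rw [expMode, phase_apply]

lemma norm_expMode : ‖expMode n x‖ = 1 := by
  have h : ∑ j, (n j : ℂ) * (x j : ℂ) = ((∑ j, (n j : ℝ) * x j : ℝ) : ℂ) := by push_cast; rfl
  rw [expMode, h, mul_comm, Complex.norm_exp_ofReal_mul_I]

lemma continuous_expMode : Continuous (expMode n) := by
  rw [expMode_eq_exp_phase]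
  fun_prop

lemma isPeriodic_expMode : IsPeriodic (expMode n) := by
  intro x j
  have h : Complex.exp (Complex.I * (n j * ((2 * Real.pi : ℝ) : ℂ))) = 1 :=
    Complex.exp_eq_one_iff.2 ⟨n j, by push_cast; ring⟩
  simp only [expMode_eq_exp_phase, map_add, phase_single, mul_add, Complex.exp_add, h, mul_one]

lemma conj_expMode : (starRingEnd ℂ) (expMode n x) = expMode (-n) x := by
  simp [expMode, ← Complex.exp_conj]

lemma hasFDerivAt_expMode :
    HasFDerivAt (expMode n) ((expMode n x * Complex.I) • phase n) x := by
  have h := (((phase n).hasFDerivAt (x := x)).const_mul Complex.I).cexp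
  rw [expMode_eq_exp_phase]
  rwa [smul_smul] at h

variable {n x} {c : (Fin N → ℤ) → ℂ} {k l : ℕ}

lemma weightSummable_zero : WeightSummable 0 c ↔ Summable fun n => ‖c n‖ := by
  simp [WeightSummable]

namespace WeightSummable

lemma mono (h : WeightSummable l c) (hkl : k ≤ l) : WeightSummable k c := by
  refine Summable.of_nonneg_of_le (fun n => by positivity) (fun n => ?_) h
  gcongr
  exact le_add_of_nonneg_right (norm_nonneg n)

lemma norm (h : WeightSummable k c) : Summable fun n => ‖c n‖ :=
  weightSummable_zero.1 (h.mono (Nat.zero_le k))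

lemma mul_coord (h : WeightSummable (k + 1) c) (j : Fin N) :
    WeightSummable k fun n => (n j : ℂ) * c n := by
  refine Summable.of_nonneg_of_le (fun n => by positivity) (fun n => ?_) h
  rw [norm_mul, Complex.norm_intCast, ← Int.norm_eq_abs, pow_succ, mul_assoc]
  gcongr
  exact (norm_le_pi_norm n j).trans (le_add_of_nonneg_left zero_le_one)

lemma mul_coord_pow (h : WeightSummable (k + l) c) (j : Fin N) :
    WeightSummable k fun n => (n j : ℂ) ^ l * c n := by
  induction l generalizing k with
  | zero => simpa using h
  | succ l ih =>
    have := (ih (k := k + 1) (by rwa [add_right_comm])).mul_coord j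
    simpa only [pow_succ', mul_assoc] using this

lemma mul_list_prod_coord_pow (α : Fin N →₀ ℕ) (L : List (Fin N))
    (h : WeightSummable (k + (L.map α).sum) c) :
    WeightSummable k fun n => (L.map fun j => (n j : ℂ) ^ α j).prod * c n := by
  induction L generalizing k with
  | nil => simpa using h
  | cons a L ih =>
    rw [List.map_cons, List.sum_cons, ← add_assoc] at h
    simpa only [List.map_cons, List.prod_cons, mul_assoc] using (ih h).mul_coord_pow a

lemma mul_prod_coord_pow (α : Fin N →₀ ℕ) (h : WeightSummable (∑ j, α j) c) :
    WeightSummable 0 fun n => (∏ j, (n j : ℂ) ^ α j) * c n := by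
  have := mul_list_prod_coord_pow (k := 0) (c := c) α (List.finRange N)
    (by rwa [zero_add, ← List.ofFn_eq_map, List.sum_ofFn])
  simpa only [← List.ofFn_eq_map, List.prod_ofFn] using this

end WeightSummable

lemma summable_trigSeries (h : Summable fun n => ‖c n‖) (x : Fin N → ℝ) :
    Summable fun n => c n * expMode n x :=
  Summable.of_norm (by simpa only [norm_mul, norm_expMode, mul_one] using h)

lemma continuous_trigSeries (h : Summable fun n => ‖c n‖) : Continuous (trigSeries c) :=
  continuous_tsum (fun n => continuous_const.mul (continuous_expMode n)) h
    fun n x => by rw [norm_mul, norm_expMode, mul_one]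

lemma isPeriodic_trigSeries (c : (Fin N → ℤ) → ℂ) : IsPeriodic (trigSeries c) := by
  intro x j
  simp only [trigSeries, isPeriodic_expMode _ x j]

lemma norm_smul_phase_le (c : ℂ) (n : Fin N → ℤ) (x : Fin N → ℝ) :
    ‖(c * (expMode n x * Complex.I)) • phase n‖ ≤ N * ((1 + ‖n‖) ^ 1 * ‖c‖) := by
  rw [norm_smul, norm_mul, norm_mul, norm_expMode, Complex.norm_I, mul_one, mul_one, pow_one]
  calc ‖c‖ * ‖phase n‖ ≤ ‖c‖ * (N * (1 + ‖n‖)) := by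
        gcongr
        exact (norm_phase_le n).trans (by gcongr; exact le_add_of_nonneg_left zero_le_one)
    _ = N * ((1 + ‖n‖) * ‖c‖) := by ring

lemma hasFDerivAt_trigSeries (h : WeightSummable 1 c) (x : Fin N → ℝ) :
    HasFDerivAt (trigSeries c) (∑' n, (c n * (expMode n x * Complex.I)) • phase n) x := by
  refine hasFDerivAt_tsum (f := fun n x => c n * expMode n x) (Summable.mul_left (N : ℝ) h)
    (fun n x => ?_) (fun n x => norm_smul_phase_le (c n) n x)
    (x₀ := 0) (summable_trigSeries h.norm 0) x
  have := (hasFDerivAt_expMode n x).const_mul (c n)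
  rwa [smul_smul] at this

lemma fderiv_trigSeries_apply (h : WeightSummable 1 c) (x y : Fin N → ℝ) :
    fderiv ℝ (trigSeries c) x y =
      ∑ j, Complex.I * (y j : ℂ) * trigSeries (fun n => (n j : ℂ) * c n) x := by
  have hs : Summable fun n => (c n * (expMode n x * Complex.I)) • phase n :=
    Summable.of_norm_bounded (Summable.mul_left (N : ℝ) h) fun n => norm_smul_phase_le (c n) n x
  have hj : ∀ j ∈ Finset.univ, Summable fun n : Fin N → ℤ =>
      Complex.I * (y j : ℂ) * ((n j : ℂ) * c n * expMode n x) := fun j _ =>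
    (summable_trigSeries (WeightSummable.mul_coord (k := 0) h j).norm x).mul_left _
  calc fderiv ℝ (trigSeries c) x y
      = ∑' n, ((c n * (expMode n x * Complex.I)) • phase n) y := by
        rw [(hasFDerivAt_trigSeries h x).fderiv]
        exact (ContinuousLinearMap.apply ℝ ℂ y).map_tsum hs
    _ = ∑' n, ∑ j, Complex.I * (y j : ℂ) * ((n j : ℂ) * c n * expMode n x) := by
        refine tsum_congr fun n => ?_
        rw [smul_apply, phase_apply, smul_eq_mul, Finset.mul_sum]
        exact Finset.sum_congr rfl fun j _ => by ring
    _ = _ := by simp only [Summable.tsum_finsetSum hj, trigSeries, tsum_mul_left]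

lemma partialD_trigSeries (h : WeightSummable 1 c) (j : Fin N) :
    partialD j (trigSeries c) = trigSeries fun n => (n j : ℂ) * c n := by
  ext x
  rw [partialD, fderiv_trigSeries_apply h,
    Finset.sum_eq_single_of_mem j (Finset.mem_univ j) fun i _ hi => by simp [hi],
    Pi.single_eq_same, Complex.ofReal_one, mul_one, ← mul_assoc, neg_mul, Complex.I_mul_I,
    neg_neg, one_mul]

lemma contDiff_trigSeries (h : WeightSummable k c) : ContDiff ℝ k (trigSeries c) := by
  induction k generalizing c with
  | zero => exact contDiff_zero.2 (continuous_trigSeries h.norm)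
  | succ k ih =>
    have h1 : WeightSummable 1 c := h.mono (Nat.le_add_left 1 k)
    rw [Nat.cast_succ, contDiff_succ_iff_fderiv_apply]
    refine ⟨fun x => (hasFDerivAt_trigSeries h1 x).differentiableAt, by simp, fun y => ?_⟩
    simp_rw [fderiv_trigSeries_apply h1]
    exact ContDiff.sum fun j _ => contDiff_const.mul (ih (h.mul_coord j))

lemma partialD_iterate_trigSeries (h : WeightSummable l c) (j : Fin N) :
    (partialD j)^[l] (trigSeries c) = trigSeries fun n => (n j : ℂ) ^ l * c n := by
  induction l with
  | zero => simp
  | succ l ih =>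
    rw [Function.iterate_succ_apply', ih (h.mono (Nat.le_succ l)),
      partialD_trigSeries (WeightSummable.mul_coord_pow (k := 1) (by rwa [add_comm]) j)]
    simp only [pow_succ', mul_assoc]

lemma foldr_partialD_trigSeries (α : Fin N →₀ ℕ) (L : List (Fin N))
    (h : WeightSummable (L.map α).sum c) :
    L.foldr (fun j w => (partialD j)^[α j] w) (trigSeries c) =
      trigSeries fun n => (L.map fun j => (n j : ℂ) ^ α j).prod * c n := by
  induction L with
  | nil => simp
  | cons a L ih =>
    rw [List.map_cons, List.sum_cons] at h
    rw [List.foldr_cons, ih (h.mono (Nat.le_add_left _ _)),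
      partialD_iterate_trigSeries (h.mul_list_prod_coord_pow α L)]
    simp only [List.map_cons, List.prod_cons, mul_assoc]

lemma multiD_trigSeries (α : Fin N →₀ ℕ) (h : WeightSummable (∑ j, α j) c) :
    multiD α (trigSeries c) = trigSeries fun n => (∏ j, (n j : ℂ) ^ α j) * c n := by
  have := foldr_partialD_trigSeries (c := c) α (List.finRange N)
    (by rwa [← List.ofFn_eq_map, List.sum_ofFn])
  simpa only [multiD, ← List.ofFn_eq_map, List.prod_ofFn] using this

variable {A : MvPolynomial (Fin N) ℂ}

lemma diffOp_trigSeries (hA : A.totalDegree ≤ k) (h : WeightSummable k c) :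
    diffOp A (trigSeries c) = trigSeries fun n => symbolAt A n * c n := by
  have hα : ∀ α ∈ A.support, WeightSummable (∑ j, α j) c := fun α hα => by
    refine h.mono (le_trans (le_of_eq ?_) ((MvPolynomial.le_totalDegree hα).trans hA))
    exact (Finsupp.sum_fintype α (fun _ e => e) fun _ => rfl).symm
  ext x
  have hs : ∀ α ∈ A.support, Summable fun n : Fin N → ℤ =>
      A.coeff α * ((∏ j, (n j : ℂ) ^ α j) * c n * expMode n x) := fun α hαA =>
    (summable_trigSeries ((hα α hαA).mul_prod_coord_pow α).norm x).mul_left _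
  calc diffOp A (trigSeries c) x
      = ∑ α ∈ A.support, ∑' n : Fin N → ℤ,
          A.coeff α * ((∏ j, (n j : ℂ) ^ α j) * c n * expMode n x) := by
        refine Finset.sum_congr rfl fun α hαA => ?_
        rw [multiD_trigSeries α (hα α hαA), trigSeries, tsum_mul_left]
    _ = ∑' n, symbolAt A n * c n * expMode n x := by
        rw [← Summable.tsum_finsetSum hs]
        refine tsum_congr fun n => ?_
        rw [symbolAt, MvPolynomial.eval_eq', Finset.sum_mul, Finset.sum_mul]
        exact Finset.sum_congr rfl fun α _ => by ring

lemma weightSummable_single (k : ℕ) (n : Fin N → ℤ) :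
    WeightSummable k (Pi.single n (1 : ℂ)) :=
  summable_of_ne_finset_zero (s := {n}) fun l hl => by simp [Finset.notMem_singleton.1 hl]

lemma trigSeries_mul_single (n : Fin N → ℤ) :
    trigSeries (fun l => c l * (Pi.single n 1 : (Fin N → ℤ) → ℂ) l) =
      fun x => c n * expMode n x := by
  ext x
  rw [trigSeries, tsum_eq_single n fun l hl => by simp [hl], Pi.single_eq_same, mul_one]

lemma trigSeries_single (n : Fin N → ℤ) : trigSeries (Pi.single n (1 : ℂ)) = expMode n := by
  simpa only [one_mul] using trigSeries_mul_single (c := fun _ => 1) n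

lemma contDiff_expMode (k : ℕ) (n : Fin N → ℤ) : ContDiff ℝ k (expMode n) :=
  trigSeries_single n ▸ contDiff_trigSeries (weightSummable_single k n)

lemma diffOp_expMode (A : MvPolynomial (Fin N) ℂ) (n : Fin N → ℤ) :
    diffOp A (expMode n) = fun x => symbolAt A n * expMode n x := by
  rw [← trigSeries_single, diffOp_trigSeries le_rfl (weightSummable_single _ n),
    trigSeries_mul_single, trigSeries_single]

end TrigSeries

/-! ### Fourier coefficients on the cube -/

section FourierCoef

variable {N : ℕ}

lemma measurableSet_cube (N : ℕ) : MeasurableSet (cube N) :=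
  MeasurableSet.univ_pi fun _ => measurableSet_Ioc

lemma cube_subset_Icc (N : ℕ) :
    cube N ⊆ Icc (fun _ => -Real.pi) fun _ => Real.pi := by
  rw [← pi_univ_Icc]
  exact pi_mono fun _ _ => Ioc_subset_Icc_self

lemma volume_cube (N : ℕ) : volume (cube N) = ENNReal.ofReal (2 * Real.pi) ^ N := by
  rw [cube, volume_pi_pi]
  simp [two_mul]

instance isFiniteMeasure_restrict_cube : IsFiniteMeasure (volume.restrict (cube N)) :=
  ⟨by
    rw [Measure.restrict_apply_univ, volume_cube]
    exact ENNReal.pow_lt_top ENNReal.ofReal_lt_top⟩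

lemma volume_real_cube_pos (N : ℕ) : 0 < volume.real (cube N) := by
  rw [measureReal_def, volume_cube, ENNReal.toReal_pow, ENNReal.toReal_ofReal Real.two_pi_pos.le]
  exact pow_pos Real.two_pi_pos N

section Torus

local instance : MeasureSpace UnitAddCircle := ⟨AddCircle.haarAddCircle⟩

/-- The cube `(-1/2, 1/2]^N`, a fundamental domain of `ℝ^N / ℤ^N`. The right end is written
`-1/2 + 1` as in `UnitAddTorus.measurableEquivPiIoc`. -/
def unitCell (N : ℕ) : Set (Fin N → ℝ) := {x | ∀ i, x i ∈ Ioc (-1 / 2 : ℝ) (-1 / 2 + 1)}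

/-- The section with values in `cube N` of the covering `x ↦ x / 2π` of the unit torus; it
transports Mathlib's Fourier theory on `UnitAddTorus` to the cube. -/
def torusSection (N : ℕ) (y : UnitAddTorus (Fin N)) : Fin N → ℝ :=
  (2 * Real.pi) • (UnitAddTorus.measurableEquivPiIoc (fun _ : Fin N => (-1 / 2 : ℝ)) y).1

lemma measurableSet_unitCell (N : ℕ) : MeasurableSet (unitCell N) :=
  MeasurableSet.univ_pi' fun _ => measurableSet_Ioc

lemma measurableEmbedding_two_pi_smul (N : ℕ) :
    MeasurableEmbedding fun x : Fin N → ℝ => (2 * Real.pi) • x :=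
  (Homeomorph.smulOfNeZero (2 * Real.pi) Real.two_pi_pos.ne').measurableEmbedding

lemma two_pi_smul_preimage_cube (N : ℕ) :
    (fun x : Fin N → ℝ => (2 * Real.pi) • x) ⁻¹' cube N = unitCell N := by
  ext x
  have hpi := Real.pi_pos
  simp only [cube, unitCell, mem_preimage, Set.mem_pi, mem_univ, true_implies, mem_ofPred_eq,
    Pi.smul_apply, smul_eq_mul, mem_Ioc]
  refine forall_congr' fun i => and_congr ?_ ?_ <;> constructor <;> intro h <;> nlinarith

lemma measurableEmbedding_torusSection (N : ℕ) : MeasurableEmbedding (torusSection N) :=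
  (measurableEmbedding_two_pi_smul N).comp
    ((MeasurableEmbedding.subtype_coe (measurableSet_unitCell N)).comp
      (UnitAddTorus.measurableEquivPiIoc _).measurableEmbedding)

lemma map_torusSection (N : ℕ) : Measure.map (torusSection N) volume =
    ENNReal.ofReal ((2 * Real.pi) ^ N)⁻¹ • volume.restrict (cube N) := by
  have hcell : Measure.map (fun y => (UnitAddTorus.measurableEquivPiIoc
      (fun _ : Fin N => (-1 / 2 : ℝ)) y).1) volume = volume.restrict (unitCell N) := by
    rw [← map_comap_subtype_coe (measurableSet_unitCell N) volume]
    exact (Measure.map_map measurable_subtype_coe (MeasurableEquiv.measurable _)).symm.trans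
      (congrArg _ (UnitAddTorus.measurePreserving_equivPiIoc _).map_eq)
  calc Measure.map (torusSection N) volume
      = Measure.map (fun x => (2 * Real.pi) • x) (volume.restrict (unitCell N)) := by
        rw [← hcell]
        exact (Measure.map_map (measurableEmbedding_two_pi_smul N).measurable
          (measurable_subtype_coe.comp (MeasurableEquiv.measurable _))).symm
    _ = _ := by
        rw [← two_pi_smul_preimage_cube, ← (measurableEmbedding_two_pi_smul N).restrict_map,
          Measure.map_addHaar_smul _ Real.two_pi_pos.ne', Measure.restrict_smul]
        simp [abs_of_pos Real.pi_pos]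

lemma mFourier_eq_expMode (n : Fin N → ℤ) (y : UnitAddTorus (Fin N)) :
    UnitAddTorus.mFourier n y = expMode n (torusSection N y) := by
  have hy : ∀ j, y j = (((UnitAddTorus.measurableEquivPiIoc
      (fun _ : Fin N => (-1 / 2 : ℝ)) y).1 j : ℝ) : UnitAddCircle) := fun j =>
    (congrFun ((UnitAddTorus.measurableEquivPiIoc (fun _ : Fin N => (-1 / 2 : ℝ))).symm_apply_apply
      y) j).symm
  rw [expMode, Finset.mul_sum, Complex.exp_sum]
  change ∏ j, fourier (n j) (y j) = _
  refine Finset.prod_congr rfl fun j _ => ?_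
  rw [hy j, fourier_coe_apply]
  simp only [torusSection, Pi.smul_apply, smul_eq_mul]
  push_cast
  ring_nf

lemma fourierCoef_eq_mFourierCoeff (g : (Fin N → ℝ) → ℂ) (n : Fin N → ℤ) :
    fourierCoef g n = UnitAddTorus.mFourierCoeff (g ∘ torusSection N) n := by
  have h := (measurableEmbedding_torusSection N).integral_map (μ := volume)
    (fun x => expMode (-n) x * g x)
  rw [map_torusSection, integral_smul_measure, ENNReal.toReal_ofReal (by positivity)] at h
  simp only [UnitAddTorus.mFourierCoeff, mFourier_eq_expMode, smul_eq_mul, Function.comp]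
  rw [← h, fourierCoef, Complex.real_smul]
  push_cast
  rw [inv_pow]
  simp only [mul_comm]

lemma fourierCoef_expMode (l n : Fin N → ℤ) :
    fourierCoef (expMode l) n = if l = n then 1 else 0 := by
  have h := orthonormal_iff_ite.1 (UnitAddTorus.orthonormal_mFourier (d := Fin N)) n l
  simp only [ContinuousMap.inner_toLp] at h
  rw [fourierCoef_eq_mFourierCoeff, UnitAddTorus.mFourierCoeff]
  simp only [eq_comm (a := l), ← h, Function.comp, ← mFourier_eq_expMode, smul_eq_mul,
    UnitAddTorus.mFourier_neg, mul_comm]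

lemma ae_eq_zero_of_mFourierCoeff_eq_zero {G : UnitAddTorus (Fin N) → ℂ} (hG : MemLp G 2 volume)
    (h : ∀ n, UnitAddTorus.mFourierCoeff G n = 0) : G =ᵐ[volume] 0 := by
  have h0 : hG.toLp = 0 := by
    apply UnitAddTorus.mFourierBasis.repr.injective
    ext n
    rw [UnitAddTorus.mFourierBasis_repr, map_zero]
    refine Eq.trans (integral_congr_ae ?_) (h n)
    filter_upwards [hG.coeFn_toLp] with y hy
    rw [hy]
  exact hG.coeFn_toLp.symm.trans (Lp.eq_zero_iff_ae_eq_zero.1 h0)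

lemma ae_eq_zero_of_fourierCoef_eq_zero {g : (Fin N → ℝ) → ℂ}
    (hg : MemLp g 2 (volume.restrict (cube N))) (h : ∀ n, fourierCoef g n = 0) :
    g =ᵐ[volume.restrict (cube N)] 0 := by
  have hθ := measurableEmbedding_torusSection N
  have hc : ENNReal.ofReal ((2 * Real.pi) ^ N)⁻¹ ≠ 0 := by
    rw [Ne, ENNReal.ofReal_eq_zero, not_le]; positivity
  have hG : MemLp (g ∘ torusSection N) 2 volume := by
    rw [← hθ.memLp_map_measure_iff, map_torusSection]
    exact hg.smul_measure ENNReal.ofReal_ne_top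
  have hG0 := ae_eq_zero_of_mFourierCoeff_eq_zero hG fun n =>
    (fourierCoef_eq_mFourierCoeff g n).symm.trans (h n)
  have hmap : ∀ᵐ x ∂(Measure.map (torusSection N) volume), g x = 0 := hθ.ae_map_iff.2 hG0
  rw [map_torusSection] at hmap
  exact (Measure.ae_ennreal_smul_measure_iff hc).1 hmap

end Torus

variable {g h : (Fin N → ℝ) → ℂ}

lemma continuous_integrableOn_cube (hg : Continuous g) : IntegrableOn g (cube N) :=
  (hg.continuousOn.integrableOn_compact isCompact_Icc).mono_set (cube_subset_Icc N)

lemma memLp_cube_of_continuous (hg : Continuous g) : MemLp g 2 (volume.restrict (cube N)) := by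
  obtain ⟨C, hC⟩ := isCompact_Icc.exists_bound_of_continuousOn hg.continuousOn
  refine MemLp.of_bound hg.aestronglyMeasurable C ?_
  filter_upwards [ae_restrict_mem (measurableSet_cube N)] with x hx
  exact hC x (cube_subset_Icc N hx)

lemma integrableOn_mul_expMode (hg : IntegrableOn g (cube N)) (n : Fin N → ℤ) :
    IntegrableOn (fun x => g x * expMode n x) (cube N) :=
  hg.mul_bdd (continuous_expMode n).aestronglyMeasurable
    (Eventually.of_forall fun x => (norm_expMode n x).le)

lemma fourierCoef_sub (hg : IntegrableOn g (cube N)) (hh : IntegrableOn h (cube N))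
    (n : Fin N → ℤ) : fourierCoef (g - h) n = fourierCoef g n - fourierCoef h n := by
  simp only [fourierCoef, Pi.sub_apply, sub_mul]
  rw [integral_sub (integrableOn_mul_expMode hg _) (integrableOn_mul_expMode hh _), mul_sub]

lemma fourierCoef_const_mul (a : ℂ) (g : (Fin N → ℝ) → ℂ) (n : Fin N → ℤ) :
    fourierCoef (fun x => a * g x) n = a * fourierCoef g n := by
  simp only [fourierCoef, mul_assoc]
  rw [integral_const_mul, mul_left_comm]

lemma fourierCoef_trigSeries {c : (Fin N → ℤ) → ℂ} (hc : Summable fun n => ‖c n‖)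
    (n : Fin N → ℤ) : fourierCoef (trigSeries c) n = c n := by
  have hF : ∀ l : Fin N → ℤ, IntegrableOn (fun x => c l * expMode l x * expMode (-n) x)
      (cube N) := fun l => integrableOn_mul_expMode (continuous_integrableOn_cube
    (continuous_const.mul (continuous_expMode l))) _
  have hs : Summable fun l : Fin N → ℤ => ∫ x in cube N, ‖c l * expMode l x * expMode (-n) x‖ := by
    simp only [norm_mul, norm_expMode, mul_one, integral_const, smul_eq_mul]
    exact hc.mul_left _
  calc fourierCoef (trigSeries c) n
      = ∑' l, fourierCoef (fun x => c l * expMode l x) n := by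
        simp only [fourierCoef, trigSeries, ← tsum_mul_right]
        rw [← integral_tsum_of_summable_integral_norm hF hs, tsum_mul_left]
    _ = ∑' l, c l * if l = n then 1 else 0 := by
        simp only [fourierCoef_const_mul, fourierCoef_expMode]
    _ = c n := by simp

lemma IsPeriodic.add_two_pi_mul_int (hg : IsPeriodic g) (k : Fin N → ℤ) (x : Fin N → ℝ) :
    g (x + fun j => k j * (2 * Real.pi)) = g x := by
  let periods : AddSubgroup (Fin N → ℝ) :=
    { carrier := {p | ∀ x, g (x + p) = g x}
      zero_mem' := fun x => by rw [add_zero]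
      add_mem' := fun {p q} hp hq x => by rw [← add_assoc, hq, hp]
      neg_mem' := fun {p} hp x => by rw [← hp (x + -p), neg_add_cancel_right] }
  have hmem : ∑ j, k j • (Pi.single j (2 * Real.pi) : Fin N → ℝ) ∈ periods :=
    sum_mem fun j _ => zsmul_mem (show Pi.single j (2 * Real.pi) ∈ periods from fun x => hg x j) _
  have hsum : ∑ j, k j • (Pi.single j (2 * Real.pi) : Fin N → ℝ) =
      fun j => k j * (2 * Real.pi) := by
    simp only [← Pi.single_smul, zsmul_eq_mul]
    exact Finset.univ_sum_single _
  exact hsum ▸ hmem x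

lemma exists_add_two_pi_mul_int_mem_cube (x : Fin N → ℝ) :
    ∃ k : Fin N → ℤ, (x + fun j => k j * (2 * Real.pi)) ∈ cube N := by
  choose k hk using fun j => (existsUnique_add_zsmul_mem_Ioc Real.two_pi_pos (x j)
    (-Real.pi)).exists
  refine ⟨k, fun j _ => ?_⟩
  simpa only [Pi.add_apply, zsmul_eq_mul, two_mul, neg_add_cancel_left] using hk j

lemma IsPeriodic.ae_eq_zero (hg : IsPeriodic g)
    (h : g =ᵐ[volume.restrict (cube N)] 0) : g =ᵐ[volume] 0 := by
  have htranslate : ∀ k : Fin N → ℤ, ∀ᵐ x : Fin N → ℝ,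
      (x + fun j => k j * (2 * Real.pi)) ∈ cube N →
        g (x + fun j => k j * (2 * Real.pi)) = 0 := fun k =>
    (measurePreserving_add_right volume fun j => k j * (2 * Real.pi)).quasiMeasurePreserving.ae
      ((ae_restrict_iff' (measurableSet_cube N)).1 h)
  filter_upwards [ae_all_iff.2 htranslate] with x hx
  obtain ⟨k, hk⟩ := exists_add_two_pi_mul_int_mem_cube x
  exact (hg.add_two_pi_mul_int k x).symm.trans (hx k hk)

lemma IsPeriodic.sub (hg : IsPeriodic g) (hh : IsPeriodic h) : IsPeriodic (g - h) :=
  fun x j => by rw [Pi.sub_apply, Pi.sub_apply, hg x j, hh x j]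

lemma ae_eq_of_fourierCoef_eq (hg : IsPeriodic g) (hh : IsPeriodic h)
    (hgm : MemLp g 2 (volume.restrict (cube N))) (hhm : MemLp h 2 (volume.restrict (cube N)))
    (heq : ∀ n, fourierCoef g n = fourierCoef h n) : g =ᵐ[volume] h := by
  have hsub := (hg.sub hh).ae_eq_zero (ae_eq_zero_of_fourierCoef_eq_zero (hgm.sub hhm) fun n => by
    rw [fourierCoef_sub (hgm.integrable one_le_two) (hhm.integrable one_le_two), heq, sub_self])
  filter_upwards [hsub] with x hx using sub_eq_zero.1 hx

lemma eq_of_fourierCoef_eq (hg : IsPeriodic g) (hh : IsPeriodic h)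
    (hgc : Continuous g) (hhc : Continuous h)
    (heq : ∀ n, fourierCoef g n = fourierCoef h n) : g = h :=
  (hgc.ae_eq_iff_eq volume hhc).1 (ae_eq_of_fourierCoef_eq hg hh (memLp_cube_of_continuous hgc)
    (memLp_cube_of_continuous hhc) heq)

end FourierCoef

/-! ### The symbol at lattice points -/

section Symbol

variable {N m : ℕ} {A : MvPolynomial (Fin N) ℂ}

/-- The eigenvalue of `A(D)` on `e^{inx}`, as a real number: for a symmetric `A(D)` it is the value
`A(n)` of the symbol (`symbolAt_eq_eigenval`). -/
def eigenval (A : MvPolynomial (Fin N) ℂ) (n : Fin N → ℤ) : ℝ := (symbolAt A n).re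

lemma expMode_mul_expMode_neg (n : Fin N → ℤ) (x : Fin N → ℝ) :
    expMode n x * expMode (-n) x = 1 := by
  rw [← conj_expMode, Complex.mul_conj, Complex.normSq_eq_norm_sq, norm_expMode, one_pow,
    Complex.ofReal_one]

lemma symbolAt_eq_eigenval (hA : IsEllipticSymmPos m A) (n : Fin N → ℤ) :
    symbolAt A n = (eigenval A n : ℂ) := by
  have h := hA.symmetric _ _ (isPeriodic_expMode n) (isPeriodic_expMode n) (contDiff_expMode m n)
    (contDiff_expMode m n)
  simp only [diffOp_expMode, map_mul, conj_expMode, mul_assoc, mul_left_comm (expMode n _),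
    expMode_mul_expMode_neg, mul_one, setIntegral_const] at h
  have hreal : symbolAt A n = (starRingEnd ℂ) (symbolAt A n) :=
    smul_right_injective ℂ (volume_real_cube_pos N).ne' h
  exact (Complex.conj_eq_iff_re.1 hreal.symm).symm

lemma eigenval_nonneg (hA : IsEllipticSymmPos m A) (n : Fin N → ℤ) : 0 ≤ eigenval A n := by
  have h := hA.positive _ (isPeriodic_expMode n) (contDiff_expMode m n)
  simp only [diffOp_expMode, conj_expMode, mul_assoc, expMode_mul_expMode_neg, mul_one,
    setIntegral_const, Complex.smul_re, smul_eq_mul] at h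
  exact nonneg_of_mul_nonneg_right h (volume_real_cube_pos N)

lemma eigenval_eq_norm (hA : IsEllipticSymmPos m A) (n : Fin N → ℤ) :
    eigenval A n = ‖symbolAt A n‖ := by
  rw [symbolAt_eq_eigenval hA, Complex.norm_of_nonneg (eigenval_nonneg hA n)]

lemma fourierCoef_diffOp (hA : IsEllipticSymmPos m A) {v : (Fin N → ℝ) → ℂ} (hv : IsPeriodic v)
    (hvm : ContDiff ℝ m v) (n : Fin N → ℤ) :
    fourierCoef (diffOp A v) n = eigenval A n * fourierCoef v n := by
  have h := hA.symmetric _ _ hv (isPeriodic_expMode n) hvm (contDiff_expMode m n)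
  simp only [diffOp_expMode, map_mul, conj_expMode, symbolAt_eq_eigenval hA, Complex.conj_ofReal,
    mul_left_comm (v _)] at h
  rw [fourierCoef, h, fourierCoef, integral_const_mul, mul_left_comm]

lemma eval_smul_of_isHomogeneous (hA : A.IsHomogeneous m) (r : ℝ) (ξ : Fin N → ℝ) :
    MvPolynomial.eval (fun j => (((r • ξ) j : ℝ) : ℂ)) A =
      (r : ℂ) ^ m * MvPolynomial.eval (fun j => (ξ j : ℂ)) A := by
  rw [MvPolynomial.eval_eq', MvPolynomial.eval_eq', Finset.mul_sum]
  refine Finset.sum_congr rfl fun α hα => ?_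
  have hdeg : ∑ j, α j = m := by
    rw [← hA (MvPolynomial.mem_support_iff.1 hα), Finsupp.weight_apply,
      Finsupp.sum_fintype _ _ (by simp)]
    simp only [Pi.one_apply, smul_eq_mul, mul_one]
  simp only [Pi.smul_apply, smul_eq_mul, Complex.ofReal_mul, mul_pow, Finset.prod_mul_distrib,
    Finset.prod_pow_eq_pow_sum, hdeg]
  ring

lemma exists_mul_norm_pow_le_norm_eval (hA : A.IsHomogeneous m)
    (hell : ∀ ξ : Fin N → ℝ, ξ ≠ 0 → MvPolynomial.eval (fun j => (ξ j : ℂ)) A ≠ 0) :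
    ∃ c : ℝ, 0 < c ∧ ∀ ξ : Fin N → ℝ, ξ ≠ 0 →
      c * ‖ξ‖ ^ m ≤ ‖MvPolynomial.eval (fun j => (ξ j : ℂ)) A‖ := by
  have hsphere : ∃ c : ℝ, 0 < c ∧ ∀ ξ ∈ Metric.sphere (0 : Fin N → ℝ) 1,
      c ≤ ‖MvPolynomial.eval (fun j => (ξ j : ℂ)) A‖ := by
    rcases (Metric.sphere (0 : Fin N → ℝ) 1).eq_empty_or_nonempty with hempty | hne
    · exact ⟨1, one_pos, by simp [hempty]⟩
    have hcont : Continuous fun ξ : Fin N → ℝ => ‖MvPolynomial.eval (fun j => (ξ j : ℂ)) A‖ :=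
      ((MvPolynomial.continuous_eval A).comp (by fun_prop)).norm
    obtain ⟨ξ, hξ, hmin⟩ := (isCompact_sphere 0 1).exists_isMinOn hne hcont.continuousOn
    exact ⟨_, norm_pos_iff.2 (hell ξ (ne_zero_of_mem_unit_sphere ⟨ξ, hξ⟩)), fun η hη => hmin hη⟩
  obtain ⟨c, hc, hle⟩ := hsphere
  refine ⟨c, hc, fun ξ hξ => ?_⟩
  have hξ0 := norm_ne_zero_iff.2 hξ
  have hscale := eval_smul_of_isHomogeneous hA ‖ξ‖ (‖ξ‖⁻¹ • ξ)
  rw [smul_inv_smul₀ hξ0] at hscale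
  rw [hscale, norm_mul, norm_pow, Complex.norm_real, norm_norm, mul_comm]
  gcongr
  exact hle _ (by rw [mem_sphere_zero_iff_norm, norm_smul, norm_inv, norm_norm,
    inv_mul_cancel₀ hξ0])

lemma norm_intCast_comp (n : Fin N → ℤ) : ‖fun i => (n i : ℝ)‖ = ‖n‖ := by
  simp only [Pi.norm_def]
  rfl

lemma one_le_norm_of_ne_zero {n : Fin N → ℤ} (hn : n ≠ 0) : 1 ≤ ‖n‖ := by
  obtain ⟨j, hj⟩ := Function.ne_iff.1 hn
  refine le_trans ?_ (norm_le_pi_norm n j)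
  rw [Int.norm_eq_abs]
  exact_mod_cast Int.one_le_abs hj

lemma exists_one_add_norm_pow_le_eigenval (hA : IsEllipticSymmPos m A) :
    ∃ C : ℝ, 0 < C ∧ ∀ n : Fin N → ℤ, (1 + ‖n‖) ^ m ≤ C * (1 + eigenval A n) := by
  obtain ⟨c, hc, hle⟩ := exists_mul_norm_pow_le_norm_eval hA.homogeneous hA.elliptic
  refine ⟨1 + 2 ^ m / c, by positivity, fun n => ?_⟩
  have hl := eigenval_nonneg hA n
  have hCc : 0 ≤ 2 ^ m / c := by positivity
  rcases eq_or_ne n 0 with rfl | hn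
  · rw [norm_zero, add_zero, one_pow]
    nlinarith
  have hlow : c * ‖n‖ ^ m ≤ eigenval A n := by
    have h := hle (fun i => (n i : ℝ)) fun h => hn (funext fun i =>
      Int.cast_injective (α := ℝ) (by simpa using congrFun h i))
    rw [eigenval_eq_norm hA, symbolAt]
    simpa only [norm_intCast_comp, Complex.ofReal_intCast] using h
  calc (1 + ‖n‖) ^ m ≤ (2 * ‖n‖) ^ m := by
        gcongr
        linarith [one_le_norm_of_ne_zero hn]
    _ = 2 ^ m / c * (c * ‖n‖ ^ m) := by rw [mul_pow]; field_simp
    _ ≤ 2 ^ m / c * eigenval A n := by gcongr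
    _ ≤ (1 + 2 ^ m / c) * (1 + eigenval A n) := by nlinarith

lemma exists_norm_symbolAt_le (hA : A.totalDegree ≤ m) :
    ∃ C : ℝ, ∀ n : Fin N → ℤ, ‖symbolAt A n‖ ≤ C * (1 + ‖n‖) ^ m := by
  refine ⟨∑ α ∈ A.support, ‖A.coeff α‖, fun n => ?_⟩
  rw [symbolAt, MvPolynomial.eval_eq', Finset.sum_mul]
  refine norm_sum_le_of_le _ fun α hα => ?_
  have hdeg : ∑ j, α j ≤ m := by
    rw [← Finsupp.sum_fintype α (fun _ e => e) fun _ => rfl]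
    exact (MvPolynomial.le_totalDegree hα).trans hA
  rw [norm_mul, norm_prod]
  gcongr
  calc ∏ j, ‖(n j : ℂ) ^ α j‖ ≤ ∏ j, (1 + ‖n‖) ^ α j := by
        gcongr with j
        rw [norm_pow, Complex.norm_intCast, ← Int.norm_eq_abs]
        gcongr
        exact (norm_le_pi_norm n j).trans (le_add_of_nonneg_left zero_le_one)
    _ = (1 + ‖n‖) ^ ∑ j, α j := Finset.prod_pow_eq_pow_sum _ _ _
    _ ≤ (1 + ‖n‖) ^ m := pow_le_pow_right₀ (le_add_of_nonneg_right (norm_nonneg n)) hdeg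

end Symbol

/-! ### Sobolev regularity and absolute convergence -/

section Sobolev

variable {N : ℕ} {τ : ℝ}

lemma summable_norm_int_rpow {r : ℝ} (hr : r < -N) : Summable fun n : Fin N → ℤ => ‖n‖ ^ r := by
  let L : Submodule ℤ (Fin N → ℝ) := Submodule.span ℤ (Set.range (Pi.basisFun ℝ (Fin N)))
  have hrank : Module.finrank ℤ L = N := by
    rw [ZLattice.rank ℝ L, Module.finrank_fin_fun]
  have hmem : ∀ n : Fin N → ℤ, (fun i => (n i : ℝ)) ∈ L := fun n => by
    rw [Module.Basis.mem_span_iff_repr_mem]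
    exact fun i => ⟨n i, by simp⟩
  have hinj : Function.Injective fun n => (⟨fun i => (n i : ℝ), hmem n⟩ : L) := fun a b hab => by
    ext i
    have hi : (a i : ℝ) = b i := congrFun (congrArg Subtype.val hab) i
    exact_mod_cast hi
  refine ((ZLattice.summable_norm_rpow L r (by rwa [hrank])).comp_injective hinj).congr fun n => ?_
  rw [← norm_intCast_comp n]
  rfl

lemma norm_sq_le_sum_sq (n : Fin N → ℤ) : ‖n‖ ^ 2 ≤ ∑ j, (n j : ℝ) ^ 2 := by
  have h0 : 0 ≤ ∑ j, (n j : ℝ) ^ 2 := Finset.sum_nonneg fun j _ => sq_nonneg _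
  refine (Real.le_sqrt (norm_nonneg n) h0).1 ?_
  refine (pi_norm_le_iff_of_nonneg (Real.sqrt_nonneg _)).2 fun j => ?_
  rw [Int.norm_eq_abs, ← Real.sqrt_sq_eq_abs]
  exact Real.sqrt_le_sqrt (Finset.single_le_sum (f := fun j => (n j : ℝ) ^ 2)
    (fun i _ => sq_nonneg _) (Finset.mem_univ j))

lemma summable_one_add_sum_sq_rpow (hτ : (N : ℝ) / 2 < τ) :
    Summable fun n : Fin N → ℤ => (1 + ∑ j, (n j : ℝ) ^ 2) ^ (-τ) := by
  have hτ0 : 0 < τ := lt_of_le_of_lt (by positivity) hτ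
  refine Summable.of_norm_bounded_eventually
    (summable_norm_int_rpow (N := N) (r := -2 * τ) (by linarith))
    ((Set.finite_singleton (0 : Fin N → ℤ)).subset fun n hn => ?_)
  by_contra hn0
  refine hn (?_ : ‖(1 + ∑ j, (n j : ℝ) ^ 2) ^ (-τ)‖ ≤ ‖n‖ ^ (-2 * τ))
  have hpos : 0 < ‖n‖ := norm_pos_iff.2 hn0
  rw [Real.norm_of_nonneg (by positivity), neg_mul, ← mul_neg, Real.rpow_mul hpos.le,
    Real.rpow_two]
  refine Real.rpow_le_rpow_of_nonpos (by positivity) ?_ (by linarith)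
  linarith [norm_sq_le_sum_sq n]

lemma one_add_norm_pow_le (k : ℕ) (n : Fin N → ℤ) :
    (1 + ‖n‖) ^ k ≤ 2 ^ k * (1 + ∑ j, (n j : ℝ) ^ 2) ^ ((k : ℝ) / 2) := by
  have hq : 0 ≤ 1 + ∑ j, (n j : ℝ) ^ 2 := by positivity
  have hsqrt : 1 + ‖n‖ ≤ 2 * √(1 + ∑ j, (n j : ℝ) ^ 2) := by
    refine abs_le_of_sq_le_sq' ?_ (by positivity) |>.2
    rw [mul_pow, Real.sq_sqrt hq]
    nlinarith [norm_sq_le_sum_sq n, sq_nonneg (1 - ‖n‖)]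
  calc (1 + ‖n‖) ^ k ≤ (2 * √(1 + ∑ j, (n j : ℝ) ^ 2)) ^ k := by gcongr
    _ = _ := by
      rw [mul_pow, Real.sqrt_eq_rpow, ← Real.rpow_mul_natCast hq, one_div_mul_eq_div]

lemma rpow_half_mul_le {q : ℝ} (hq : 0 < q) (s r y : ℝ) :
    q ^ (r / 2) * y ≤ q ^ (-s) + q ^ (s + r) * y ^ 2 := by
  have hprod : q ^ (-s / 2) * (q ^ ((s + r) / 2) * y) = q ^ (r / 2) * y := by
    rw [← mul_assoc, ← Real.rpow_add hq]
    ring_nf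
  have hsq : ∀ a : ℝ, (q ^ (a / 2)) ^ 2 = q ^ a := fun a => by
    rw [← Real.rpow_mul_natCast hq.le]
    norm_num
  have hamgm := two_mul_le_add_sq (q ^ (-s / 2)) (q ^ ((s + r) / 2) * y)
  rw [mul_assoc, hprod, mul_pow, hsq, hsq] at hamgm
  have h1 := Real.rpow_nonneg hq.le (-s)
  have h2 := mul_nonneg (Real.rpow_nonneg hq.le (s + r)) (sq_nonneg y)
  linarith

lemma MemSobolev.weightSummable (hτ : (N : ℝ) / 2 < τ) {k : ℕ} {g : (Fin N → ℝ) → ℂ}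
    (hg : MemSobolev (τ + k) g) : WeightSummable k (fourierCoef g) := by
  refine Summable.of_nonneg_of_le (fun n => by positivity) (fun n => ?_)
    (((summable_one_add_sum_sq_rpow hτ).add hg.summable).mul_left (2 ^ k))
  calc (1 + ‖n‖) ^ k * ‖fourierCoef g n‖
      ≤ 2 ^ k * (1 + ∑ j, (n j : ℝ) ^ 2) ^ ((k : ℝ) / 2) * ‖fourierCoef g n‖ := by
        gcongr
        exact one_add_norm_pow_le k n
    _ ≤ _ := by
        rw [mul_assoc]
        gcongr
        exact rpow_half_mul_le (by positivity) τ k _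

lemma MemSobolev.trigSeries_ae_eq {g : (Fin N → ℝ) → ℂ} (hg : MemSobolev τ g)
    (hs : Summable fun n => ‖fourierCoef g n‖) : trigSeries (fourierCoef g) =ᵐ[volume] g :=
  ae_eq_of_fourierCoef_eq (isPeriodic_trigSeries _) hg.periodic
    (memLp_cube_of_continuous (continuous_trigSeries hs)) hg.memLp (fourierCoef_trigSeries hs)

end Sobolev

/-! ### The scalar relaxation equation -/

section Relaxation

variable {ρ lam t : ℝ}

/-- The solution `a E_{ρ,1}(-lam t^ρ) + b t^ρ E_{ρ,ρ+1}(-lam t^ρ)` of the relaxation equation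
`D_t^ρ y + lam y = b`, `y 0 = a`. -/
def relaxSol (ρ lam : ℝ) (a b : ℂ) (t : ℝ) : ℂ :=
  a * mlFun ρ lam 1 t + b * mlFun ρ lam (ρ + 1) t

/-- The functions `(b - lam a) t^(μ-1) E_{ρ,μ}(-lam t^ρ)`: for `μ = 1` the Caputo derivative and
for `μ = ρ` the ordinary derivative of `relaxSol ρ lam a b`. -/
def relaxRate (ρ lam μ : ℝ) (a b : ℂ) (t : ℝ) : ℂ := (b - lam * a) * mlFun ρ lam μ t

lemma relaxSol_mul (ρ lam : ℝ) (a b c : ℂ) (t : ℝ) :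
    relaxSol ρ lam (a * c) (b * c) t = relaxSol ρ lam a b t * c := by
  simp only [relaxSol]
  ring

lemma relaxRate_mul (ρ lam μ : ℝ) (a b c : ℂ) (t : ℝ) :
    relaxRate ρ lam μ (a * c) (b * c) t = relaxRate ρ lam μ a b t * c := by
  simp only [relaxRate]
  ring

lemma relaxSol_zero (hρ : 0 < ρ) (lam : ℝ) (a b : ℂ) : relaxSol ρ lam a b 0 = a := by
  simp [relaxSol, mlFun_one_zero hρ, mlFun_add_one_zero hρ]

lemma mul_relaxSol (hρ : 0 < ρ) (lam : ℝ) (a b : ℂ) (t : ℝ) :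
    lam * relaxSol ρ lam a b t = b - relaxRate ρ lam 1 a b t := by
  rw [relaxSol, relaxRate, mlFun_one_eq hρ]
  push_cast
  ring

lemma continuous_relaxSol (hρ : 0 < ρ) (lam : ℝ) (a b : ℂ) :
    Continuous (relaxSol ρ lam a b) := by
  have h1 := continuous_mlFun hρ lam le_rfl
  have h2 := continuous_mlFun hρ lam (show 1 ≤ ρ + 1 by linarith)
  unfold relaxSol
  fun_prop

lemma continuous_relaxRate_one (hρ : 0 < ρ) (lam : ℝ) (a b : ℂ) :
    Continuous (relaxRate ρ lam 1 a b) := by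
  have h := continuous_mlFun hρ lam le_rfl
  unfold relaxRate
  fun_prop

lemma hasDerivAt_relaxSol (hρ : 0 < ρ) (lam : ℝ) (a b : ℂ) (ht : 0 < t) :
    HasDerivAt (relaxSol ρ lam a b) (relaxRate ρ lam ρ a b t) t := by
  have h := ((hasDerivAt_mlFun_one hρ lam ht).ofReal_comp.const_mul a).add
    ((hasDerivAt_mlFun_add_one hρ lam ht).ofReal_comp.const_mul b)
  refine h.congr_deriv ?_
  rw [relaxRate]
  push_cast
  ring

lemma norm_relaxSol_le (hρ : 0 < ρ) (hρ1 : ρ ≤ 1) (hlam : 0 ≤ lam) (a b : ℂ) {T : ℝ}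
    (ht : t ∈ Icc 0 T) : ‖relaxSol ρ lam a b t‖ ≤ ‖a‖ + ‖b‖ * fracKernel (ρ + 1) T := by
  refine (norm_add_le _ _).trans (add_le_add ?_ ?_)
  · rw [norm_mul, Complex.norm_of_nonneg (mlFun_nonneg hρ hρ1 hlam hρ1 ht.1)]
    exact mul_le_of_le_one_right (norm_nonneg _) (mlFun_one_le_one hρ hρ1 hlam ht.1)
  · rw [norm_mul, Complex.norm_of_nonneg (mlFun_nonneg hρ hρ1 hlam (by linarith) ht.1)]
    gcongr
    exact (mlFun_le_fracKernel hρ hρ1 hlam (by linarith) ht.1).trans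
      (fracKernel_mono (by linarith) ht.1 ht.2)

lemma norm_relaxRate (hρ : 0 < ρ) (hρ1 : ρ ≤ 1) (hlam : 0 ≤ lam) {μ : ℝ} (hμ : ρ ≤ μ) (a b : ℂ)
    (ht : 0 ≤ t) : ‖relaxRate ρ lam μ a b t‖ = ‖b - lam * a‖ * mlFun ρ lam μ t := by
  rw [relaxRate, norm_mul, Complex.norm_of_nonneg (mlFun_nonneg hρ hρ1 hlam hμ ht)]

lemma norm_relaxRate_le (hρ : 0 < ρ) (hρ1 : ρ ≤ 1) (hlam : 0 ≤ lam) {μ K C : ℝ} (hμ : ρ ≤ μ)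
    (a b : ℂ) (ht : 0 ≤ t) (hK : mlFun ρ lam μ t ≤ K) (hC : lam * mlFun ρ lam μ t ≤ C) :
    ‖relaxRate ρ lam μ a b t‖ ≤ ‖b‖ * K + ‖a‖ * C := by
  have hM := mlFun_nonneg hρ hρ1 hlam hμ ht
  calc ‖relaxRate ρ lam μ a b t‖ ≤ (‖b‖ + ‖lam * a‖) * mlFun ρ lam μ t := by
        rw [norm_relaxRate hρ hρ1 hlam hμ a b ht]
        gcongr
        exact norm_sub_le _ _
    _ = ‖b‖ * mlFun ρ lam μ t + ‖a‖ * (lam * mlFun ρ lam μ t) := by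
        rw [norm_mul, Complex.norm_of_nonneg hlam]
        ring
    _ ≤ _ := by gcongr

lemma norm_relaxRate_one_le (hρ : 0 < ρ) (hρ1 : ρ ≤ 1) (hlam : 0 ≤ lam) (a b : ℂ) {ε : ℝ}
    (hε : 0 < ε) (ht : ε ≤ t) :
    ‖relaxRate ρ lam 1 a b t‖ ≤ ‖b‖ * 1 + ‖a‖ * (Real.Gamma (ρ + 1) / ε ^ ρ) := by
  have ht0 := hε.trans_le ht
  refine norm_relaxRate_le hρ hρ1 hlam hρ1 a b ht0.le (mlFun_one_le_one hρ hρ1 hlam ht0.le)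
    ((mul_mlFun_one_le hρ hρ1 hlam ht0).trans ?_)
  exact div_le_div_of_nonneg_left (Real.Gamma_pos_of_pos (by linarith)).le (by positivity)
    (Real.rpow_le_rpow hε.le ht hρ.le)

lemma norm_relaxRate_self_le (hρ : 0 < ρ) (hρ1 : ρ ≤ 1) (hlam : 0 ≤ lam) (a b : ℂ) {ε : ℝ}
    (hε : 0 < ε) (ht : ε ≤ t) :
    ‖relaxRate ρ lam ρ a b t‖ ≤ ‖b‖ * fracKernel ρ ε + ‖a‖ * (ρ / ε) := by
  have ht0 := hε.trans_le ht
  refine norm_relaxRate_le hρ hρ1 hlam le_rfl a b ht0.le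
    ((mlFun_le_fracKernel hρ hρ1 hlam le_rfl ht0.le).trans (fracKernel_le_of_le hρ hρ1 hε ht))
    ((mul_mlFun_self_le hρ hρ1 hlam ht0).trans ?_)
  gcongr

variable {β μ : ℝ}

lemma integrableOn_fracKernel_smul_relaxRate (hρ : 0 < ρ) (lam : ℝ) (hβ : 0 < β) (hμ : 0 < μ)
    (a b : ℂ) (t : ℝ) :
    IntegrableOn (fun s => fracKernel β (t - s) • relaxRate ρ lam μ a b s) (Ioo 0 t) := by
  have h := (integrableOn_fracKernel_mul_mlFun hρ lam hβ hμ t).ofReal (𝕜 := ℂ)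
  refine (h.const_mul (b - lam * a)).congr (ae_of_all _ fun s => ?_)
  simp only [relaxRate, Complex.real_smul, RCLike.ofReal_mul, Complex.coe_algebraMap]
  ring

lemma fracInt_relaxRate (hρ : 0 < ρ) (lam : ℝ) (hβ : 0 < β) (hμ : 0 < μ) (a b : ℂ) (ht : 0 < t) :
    fracInt β (relaxRate ρ lam μ a b) t = relaxRate ρ lam (μ + β) a b t := by
  rw [relaxRate, ← fracInt_mlFun hρ lam hβ hμ ht, ← fracInt_ofReal, ← fracInt_const_mul]
  rfl

lemma integral_norm_fracKernel_smul_relaxRate (hρ : 0 < ρ) (hρ1 : ρ ≤ 1) (hlam : 0 ≤ lam)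
    (hβ : 0 < β) (hμ : ρ ≤ μ) (a b : ℂ) (ht : 0 < t) :
    ∫ s in Ioo 0 t, ‖fracKernel β (t - s) • relaxRate ρ lam μ a b s‖ =
      ‖relaxRate ρ lam (μ + β) a b t‖ := by
  rw [norm_relaxRate hρ hρ1 hlam (by linarith) a b ht.le,
    ← fracInt_mlFun hρ lam hβ (hρ.trans_le hμ) ht, fracInt, ← integral_const_mul]
  refine setIntegral_congr_fun measurableSet_Ioo fun s hs => ?_
  simp only [norm_smul, norm_relaxRate hρ hρ1 hlam hμ a b hs.1.le, smul_eq_mul,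
    Real.norm_of_nonneg (fracKernel_pos hβ (sub_pos.2 hs.2)).le]
  ring

end Relaxation

/-! ### Series of relaxation functions -/

section RelaxationSeries

variable {ι : Type*} {ρ T t : ℝ} {lam : ι → ℝ} {a b : ι → ℂ}

lemma summable_norm_relaxSol (hρ : 0 < ρ) (hρ1 : ρ ≤ 1) (hlam : ∀ i, 0 ≤ lam i)
    (ha : Summable fun i => ‖a i‖) (hb : Summable fun i => ‖b i‖) (ht : 0 ≤ t) :
    Summable fun i => ‖relaxSol ρ (lam i) (a i) (b i) t‖ :=
  .of_nonneg_of_le (fun _ => norm_nonneg _)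
    (fun i => norm_relaxSol_le hρ hρ1 (hlam i) (a i) (b i) (right_mem_Icc.2 ht))
    (ha.add (hb.mul_right _))

lemma summable_norm_relaxRate_one (hρ : 0 < ρ) (hρ1 : ρ ≤ 1) (hlam : ∀ i, 0 ≤ lam i)
    (ha : Summable fun i => ‖a i‖) (hb : Summable fun i => ‖b i‖) (ht : 0 < t) :
    Summable fun i => ‖relaxRate ρ (lam i) 1 (a i) (b i) t‖ :=
  .of_nonneg_of_le (fun _ => norm_nonneg _)
    (fun i => norm_relaxRate_one_le hρ hρ1 (hlam i) (a i) (b i) ht le_rfl)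
    ((hb.mul_right _).add (ha.mul_right _))

lemma hasDerivAt_tsum_relaxSol (hρ : 0 < ρ) (hρ1 : ρ ≤ 1) (hlam : ∀ i, 0 ≤ lam i)
    (ha : Summable fun i => ‖a i‖) (hb : Summable fun i => ‖b i‖) (ht : 0 < t) :
    HasDerivAt (fun t => ∑' i, relaxSol ρ (lam i) (a i) (b i) t)
      (∑' i, relaxRate ρ (lam i) ρ (a i) (b i) t) t := by
  have hε := half_pos ht
  exact hasDerivAt_tsum_of_isPreconnected (t := Ioi (t / 2))
    ((hb.mul_right (fracKernel ρ (t / 2))).add (ha.mul_right (ρ / (t / 2)))) isOpen_Ioi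
    isPreconnected_Ioi
    (fun i s hs => hasDerivAt_relaxSol hρ (lam i) (a i) (b i) (hε.trans hs))
    (fun i s hs => norm_relaxRate_self_le hρ hρ1 (hlam i) (a i) (b i) hε (le_of_lt hs))
    (half_lt_self ht) (summable_norm_relaxSol hρ hρ1 hlam ha hb ht.le).of_norm (half_lt_self ht)

lemma integrable_tsum_of_summable_integral_norm {α ι E : Type*} [MeasurableSpace α]
    {μ : Measure α} [NormedAddCommGroup E] [Countable ι] {F : ι → α → E}
    (hF : ∀ i, Integrable (F i) μ) (hs : Summable fun i => ∫ x, ‖F i x‖ ∂μ)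
    (hm : AEStronglyMeasurable (fun x => ∑' i, F i x) μ) :
    Integrable (fun x => ∑' i, F i x) μ := by
  refine ⟨hm, ?_⟩
  calc ∫⁻ x, ‖∑' i, F i x‖ₑ ∂μ ≤ ∫⁻ x, ∑' i, ‖F i x‖ₑ ∂μ :=
        lintegral_mono fun x => enorm_tsum_le_tsum_enorm
    _ = ∑' i, ∫⁻ x, ‖F i x‖ₑ ∂μ := lintegral_tsum fun i => (hF i).1.enorm
    _ = ∑' i, ENNReal.ofReal (∫ x, ‖F i x‖ ∂μ) :=
        tsum_congr fun i => (ofReal_integral_norm_eq_lintegral_enorm (hF i)).symm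
    _ < ⊤ := by
        rw [← ENNReal.ofReal_tsum_of_nonneg (fun i => integral_nonneg fun x => norm_nonneg _) hs]
        exact ENNReal.ofReal_lt_top

lemma smul_deriv_tsum_relaxSol (hρ : 0 < ρ) (hρ1 : ρ ≤ 1) (hlam : ∀ i, 0 ≤ lam i)
    (ha : Summable fun i => ‖a i‖) (hb : Summable fun i => ‖b i‖) (c : ℝ) (ht : 0 < t) :
    c • deriv (fun t => ∑' i, relaxSol ρ (lam i) (a i) (b i) t) t =
      ∑' i, c • relaxRate ρ (lam i) ρ (a i) (b i) t := by
  rw [(hasDerivAt_tsum_relaxSol hρ hρ1 hlam ha hb ht).deriv, tsum_const_smul'']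

lemma summable_integral_norm_relaxRate (hρ : 0 < ρ) (hρ1 : ρ < 1) (hlam : ∀ i, 0 ≤ lam i)
    (ha : Summable fun i => ‖a i‖) (hb : Summable fun i => ‖b i‖) (ht : 0 < t) :
    Summable fun i => ∫ s in Ioo 0 t,
      ‖fracKernel (1 - ρ) (t - s) • relaxRate ρ (lam i) ρ (a i) (b i) s‖ := by
  simp only [integral_norm_fracKernel_smul_relaxRate hρ hρ1.le (hlam _) (sub_pos.2 hρ1) le_rfl _ _
    ht, add_sub_cancel]
  exact summable_norm_relaxRate_one hρ hρ1.le hlam ha hb ht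

variable [Countable ι]

lemma hasCaputo_tsum_relaxSol (hρ : 0 < ρ) (hρ1 : ρ ≤ 1) (hlam : ∀ i, 0 ≤ lam i)
    (ha : Summable fun i => ‖a i‖) (hb : Summable fun i => ‖b i‖) (ht : 0 < t) (T : ℝ) :
    HasCaputo ρ T (fun t => ∑' i, relaxSol ρ (lam i) (a i) (b i) t) t := by
  have hderiv (s : ℝ) (hs : 0 < s) := hasDerivAt_tsum_relaxSol hρ hρ1 hlam ha hb hs
  rcases hρ1.eq_or_lt with rfl | hρ1
  · rw [HasCaputo, if_pos rfl]
    exact (hderiv t ht).differentiableAt.differentiableWithinAt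
  refine (hasCaputo_iff hρ1).2 ⟨fun s hs => (hderiv s hs.1).differentiableAt, ?_⟩
  have hexp : EqOn _ _ (Ioo 0 t) := fun s hs =>
    smul_deriv_tsum_relaxSol hρ hρ1.le hlam ha hb (fracKernel (1 - ρ) (t - s)) hs.1
  rw [integrableOn_congr_fun hexp measurableSet_Ioo]
  refine integrable_tsum_of_summable_integral_norm
    (fun i => integrableOn_fracKernel_smul_relaxRate hρ (lam i) (sub_pos.2 hρ1) hρ _ _ t)
    (summable_integral_norm_relaxRate hρ hρ1 hlam ha hb ht) ?_
  refine AEStronglyMeasurable.congr ?_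
    ((ae_restrict_mem measurableSet_Ioo).mono fun s hs => hexp hs)
  exact (((measurable_fracKernel _).comp (by fun_prop)).smul
    (measurable_deriv _)).aestronglyMeasurable

lemma caputo_tsum_relaxSol (hρ : 0 < ρ) (hρ1 : ρ ≤ 1) (hlam : ∀ i, 0 ≤ lam i)
    (ha : Summable fun i => ‖a i‖) (hb : Summable fun i => ‖b i‖) (ht : t ∈ Ioc 0 T) :
    caputo ρ T (fun t => ∑' i, relaxSol ρ (lam i) (a i) (b i) t) t =
      ∑' i, relaxRate ρ (lam i) 1 (a i) (b i) t := by
  rcases hρ1.eq_or_lt with rfl | hρ1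
  · rw [caputo, if_pos rfl]
    exact (hasDerivAt_tsum_relaxSol hρ hρ1 hlam ha hb ht.1).hasDerivWithinAt.derivWithin
      (uniqueDiffOn_Icc (ht.1.trans_le ht.2) t (Ioc_subset_Icc_self ht))
  have h1ρ := sub_pos.2 hρ1
  rw [caputo_eq_fracInt hρ1, fracInt, setIntegral_congr_fun measurableSet_Ioo fun s hs =>
      smul_deriv_tsum_relaxSol hρ hρ1.le hlam ha hb (fracKernel (1 - ρ) (t - s)) hs.1,
    ← integral_tsum_of_summable_integral_norm
      (fun i => integrableOn_fracKernel_smul_relaxRate hρ (lam i) h1ρ hρ _ _ t)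
      (summable_integral_norm_relaxRate hρ hρ1 hlam ha hb ht.1)]
  refine tsum_congr fun i => ?_
  rw [← fracInt, fracInt_relaxRate hρ (lam i) h1ρ hρ _ _ ht.1, add_sub_cancel]

end RelaxationSeries

/-! ### The series solution -/

section SeriesSolution

variable {N m : ℕ} {A : MvPolynomial (Fin N) ℂ} {ρ T t : ℝ} {a b : (Fin N → ℤ) → ℂ}

lemma continuousOn_trigSeries_of_bound {c : ℝ → (Fin N → ℤ) → ℂ} {s : Set ℝ}
    {g : (Fin N → ℤ) → ℝ} (hc : ∀ n, ContinuousOn (fun t => c t n) s) (hg : Summable g)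
    (hcg : ∀ n, ∀ t ∈ s, ‖c t n‖ ≤ g n) :
    ContinuousOn (fun p : (Fin N → ℝ) × ℝ => trigSeries (c p.2) p.1) (univ ×ˢ s) := by
  refine continuousOn_tsum (fun n => ?_) hg fun n p hp => ?_
  · exact ((hc n).comp continuousOn_snd fun p hp => hp.2).mul
      ((continuous_expMode n).comp continuous_fst).continuousOn
  · rw [norm_mul, norm_expMode, mul_one]
    exact hcg n _ hp.2

/-- The Fourier coefficients at time `t` of the solution with initial coefficients `a` and source
coefficients `b`. -/
def solCoef (A : MvPolynomial (Fin N) ℂ) (ρ : ℝ) (a b : (Fin N → ℤ) → ℂ) (t : ℝ)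
    (n : Fin N → ℤ) : ℂ :=
  relaxSol ρ (eigenval A n) (a n) (b n) t

/-- The Fourier coefficients at time `t` of the Caputo derivative of the solution with initial
coefficients `a` and source coefficients `b`. -/
def caputoCoef (A : MvPolynomial (Fin N) ℂ) (ρ : ℝ) (a b : (Fin N → ℤ) → ℂ) (t : ℝ)
    (n : Fin N → ℤ) : ℂ :=
  relaxRate ρ (eigenval A n) 1 (a n) (b n) t

lemma trigSeries_solCoef (A : MvPolynomial (Fin N) ℂ) (ρ : ℝ) (a b : (Fin N → ℤ) → ℂ)
    (x : Fin N → ℝ) : (fun t => trigSeries (solCoef A ρ a b t) x) = fun t =>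
      ∑' n, relaxSol ρ (eigenval A n) (a n * expMode n x) (b n * expMode n x) t := by
  simp only [relaxSol_mul]
  rfl

lemma summable_norm_mul_expMode (ha : Summable fun n => ‖a n‖) (x : Fin N → ℝ) :
    Summable fun n => ‖a n * expMode n x‖ := by
  simpa only [norm_mul, norm_expMode, mul_one] using ha

section Regularity

variable (hA : IsEllipticSymmPos m A) (hρ : 0 < ρ) (hρ1 : ρ ≤ 1) (ha : Summable fun n => ‖a n‖)
  (hb : Summable fun n => ‖b n‖)
include hA hρ hρ1 ha hb

lemma summable_solCoef (ht : 0 ≤ t) : Summable fun n => ‖solCoef A ρ a b t n‖ :=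
  summable_norm_relaxSol hρ hρ1 (eigenval_nonneg hA) ha hb ht

lemma summable_caputoCoef (ht : 0 < t) : Summable fun n => ‖caputoCoef A ρ a b t n‖ :=
  summable_norm_relaxRate_one hρ hρ1 (eigenval_nonneg hA) ha hb ht

lemma continuousOn_trigSeries_solCoef (T : ℝ) :
    ContinuousOn (fun p : (Fin N → ℝ) × ℝ => trigSeries (solCoef A ρ a b p.2) p.1)
      (univ ×ˢ Icc 0 T) :=
  continuousOn_trigSeries_of_bound (fun _ => (continuous_relaxSol hρ _ _ _).continuousOn)
    (ha.add (hb.mul_right _))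
    fun n _ ht => norm_relaxSol_le hρ hρ1 (eigenval_nonneg hA n) (a n) (b n) ht

lemma continuousOn_trigSeries_caputoCoef :
    ContinuousOn (fun p : (Fin N → ℝ) × ℝ => trigSeries (caputoCoef A ρ a b p.2) p.1)
      (univ ×ˢ Ioi 0) := by
  rintro ⟨x, t⟩ ⟨-, ht⟩
  have ht0 : 0 < t := ht
  have h : ContinuousOn (fun p : (Fin N → ℝ) × ℝ => trigSeries (caputoCoef A ρ a b p.2) p.1)
      (univ ×ˢ Ioi (t / 2)) :=
    continuousOn_trigSeries_of_bound (fun _ => (continuous_relaxRate_one hρ _ _ _).continuousOn)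
      ((hb.mul_right _).add (ha.mul_right _)) fun n _ hs =>
        norm_relaxRate_one_le hρ hρ1 (eigenval_nonneg hA n) (a n) (b n) (half_pos ht0) (le_of_lt hs)
  have hmem : (x, t) ∈ (univ : Set (Fin N → ℝ)) ×ˢ Ioi (t / 2) := ⟨mem_univ x, half_lt_self ht0⟩
  exact (h.continuousAt ((isOpen_univ.prod isOpen_Ioi).mem_nhds hmem)).continuousWithinAt

lemma weightSummable_solCoef (ht : 0 < t) : WeightSummable m (solCoef A ρ a b t) := by
  obtain ⟨C, hC, hbd⟩ := exists_one_add_norm_pow_le_eigenval hA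
  refine Summable.of_nonneg_of_le (fun n => by positivity) (fun n => ?_)
    (((summable_solCoef hA hρ hρ1 ha hb ht.le).add
      (hb.add (summable_caputoCoef hA hρ hρ1 ha hb ht))).mul_left C)
  calc (1 + ‖n‖) ^ m * ‖solCoef A ρ a b t n‖
      ≤ C * (1 + eigenval A n) * ‖solCoef A ρ a b t n‖ := by
        gcongr
        exact hbd n
    _ = C * (‖solCoef A ρ a b t n‖ + ‖(eigenval A n : ℂ) * solCoef A ρ a b t n‖) := by
        rw [norm_mul, Complex.norm_of_nonneg (eigenval_nonneg hA n)]
        ring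
    _ ≤ _ := by
        gcongr
        exact (congrArg norm (mul_relaxSol hρ _ _ _ t)).trans_le (norm_sub_le _ _)

lemma diffOp_trigSeries_solCoef (ht : 0 < t) (x : Fin N → ℝ) :
    diffOp A (trigSeries (solCoef A ρ a b t)) x =
      trigSeries b x - trigSeries (caputoCoef A ρ a b t) x := by
  have hmode : ∀ n, symbolAt A n * solCoef A ρ a b t n = b n - caputoCoef A ρ a b t n := fun n => by
    rw [symbolAt_eq_eigenval hA]
    exact mul_relaxSol hρ _ _ _ t
  rw [diffOp_trigSeries hA.homogeneous.totalDegree_le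
    (weightSummable_solCoef hA hρ hρ1 ha hb ht)]
  simp only [hmode, trigSeries, sub_mul]
  exact (summable_trigSeries hb x).tsum_sub
    (summable_trigSeries (summable_caputoCoef hA hρ hρ1 ha hb ht) x)

lemma hasCaputo_trigSeries_solCoef (ht : 0 < t) (T : ℝ) (x : Fin N → ℝ) :
    HasCaputo ρ T (fun t => trigSeries (solCoef A ρ a b t) x) t := by
  rw [trigSeries_solCoef]
  exact hasCaputo_tsum_relaxSol hρ hρ1 (eigenval_nonneg hA) (summable_norm_mul_expMode ha x)
    (summable_norm_mul_expMode hb x) ht T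

lemma caputo_trigSeries_solCoef (ht : t ∈ Ioc 0 T) (x : Fin N → ℝ) :
    caputo ρ T (fun t => trigSeries (solCoef A ρ a b t) x) t =
      trigSeries (caputoCoef A ρ a b t) x := by
  rw [trigSeries_solCoef, caputo_tsum_relaxSol hρ hρ1 (eigenval_nonneg hA)
    (summable_norm_mul_expMode ha x) (summable_norm_mul_expMode hb x) ht]
  simp only [relaxRate_mul]
  rfl

end Regularity

end SeriesSolution

/-! ### The integrated equation -/

section CaputoPrimitive

variable {ρ lam T t : ℝ} {v y : ℝ → ℂ}

/-- The fractional integral of order `1 - ρ` of `v - v 0` (with the convention that the integral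
of order `0` is the identity): the primitive of the Caputo derivative of `v` vanishing at `0`. -/
def caputoPrimitive (ρ : ℝ) (v : ℝ → ℂ) (t : ℝ) : ℂ :=
  if ρ = 1 then v t - v 0 else fracInt (1 - ρ) (fun s => v s - v 0) t

lemma caputoPrimitive_one (v : ℝ → ℂ) (t : ℝ) : caputoPrimitive 1 v t = v t - v 0 := if_pos rfl

lemma caputoPrimitive_of_lt (hρ1 : ρ < 1) (v : ℝ → ℂ) (t : ℝ) :
    caputoPrimitive ρ v t = fracInt (1 - ρ) (fun s => v s - v 0) t := if_neg hρ1.ne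

lemma integral_caputo_one (hv : ∀ t ∈ Ioc 0 T, HasCaputo 1 T v t) (hvc : ContinuousOn v (Icc 0 T))
    (hc : ContinuousOn (caputo 1 T v) (Ioc 0 T)) {a : ℝ} (ha : a ∈ Ioc 0 t) (ht : t ≤ T) :
    ∫ s in a..t, caputo 1 T v s = v t - v a := by
  have hsub : Icc a t ⊆ Ioc 0 T := fun s hs => ⟨ha.1.trans_le hs.1, hs.2.trans ht⟩
  refine intervalIntegral.integral_eq_sub_of_hasDerivAt_of_le ha.2
    (hvc.mono (hsub.trans Ioc_subset_Icc_self)) (fun s hs => ?_)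
    ((hc.mono hsub).intervalIntegrable_of_Icc ha.2)
  have hdiff := hv s (hsub (Ioo_subset_Icc_self hs))
  rw [HasCaputo, if_pos rfl] at hdiff
  rw [caputo, if_pos rfl]
  exact hdiff.hasDerivWithinAt.hasDerivAt (Icc_mem_nhds (ha.1.trans hs.1) (hs.2.trans_le ht))

lemma caputoPrimitive_sub (hρ : 0 < ρ) (hρ1 : ρ ≤ 1) (hv : ∀ t ∈ Ioc 0 T, HasCaputo ρ T v t)
    (hvc : ContinuousOn v (Icc 0 T)) (hc : ContinuousOn (caputo ρ T v) (Ioc 0 T)) {a : ℝ}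
    (ha : a ∈ Ioc 0 t) (ht : t ≤ T) :
    caputoPrimitive ρ v t - caputoPrimitive ρ v a = ∫ s in a..t, caputo ρ T v s := by
  rcases hρ1.eq_or_lt with rfl | hρ1
  · rw [integral_caputo_one hv hvc hc ha ht, caputoPrimitive_one, caputoPrimitive_one,
      sub_sub_sub_cancel_right]
  have ht0 := ha.1.trans_le ha.2
  have hprim : ∀ r ∈ Ioc 0 t, caputoPrimitive ρ v r = ∫ s in (0 : ℝ)..r, caputo ρ T v s :=
    fun r hr => by
      rw [caputoPrimitive_of_lt hρ1, intervalIntegral.integral_of_le hr.1.le,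
        integral_Ioc_eq_integral_Ioo]
      exact ((hv r ⟨hr.1, hr.2.trans ht⟩).integral_caputo hρ hρ1
        (hvc.mono (Icc_subset_Icc_right (hr.2.trans ht)))).symm
  have hint : IntervalIntegrable (caputo ρ T v) volume 0 t :=
    (intervalIntegrable_iff_integrableOn_Ioo_of_le ht0.le).2
      ((hv t ⟨ht0, ht⟩).integrableOn_caputo hρ hρ1)
  rw [hprim t (right_mem_Ioc.2 ht0), hprim a ha]
  have ha' : a ∈ uIcc 0 t := by
    rw [uIcc_of_le ht0.le]
    exact Ioc_subset_Icc_self ha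
  exact intervalIntegral.integral_interval_sub_left hint
    (hint.mono_set (uIcc_subset_uIcc_left ha'))

lemma tendsto_caputoPrimitive_zero (hρ1 : ρ ≤ 1) (hT : 0 < T) (hv : ContinuousOn v (Icc 0 T)) :
    Tendsto (caputoPrimitive ρ v) (𝓝[>] 0) (𝓝 0) := by
  have hmem := Ioc_mem_nhdsGT hT
  rcases hρ1.eq_or_lt with rfl | hρ1
  · have hlim : Tendsto v (𝓝[>] 0) (𝓝 (v 0)) := (hv 0 (left_mem_Icc.2 hT.le)).mono_left
      (nhdsWithin_le_of_mem (mem_of_superset hmem Ioc_subset_Icc_self))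
    simpa only [funext (caputoPrimitive_one v), sub_self] using hlim.sub_const (v 0)
  have h1ρ := sub_pos.2 hρ1
  obtain ⟨M, hM⟩ := isCompact_Icc.exists_bound_of_continuousOn
    (hv.sub (continuousOn_const (c := v 0)))
  refine squeeze_zero_norm' (a := fun t => t ^ (1 - ρ) / Real.Gamma (1 - ρ + 1) * M) ?_ ?_
  · filter_upwards [hmem] with t ht
    rw [caputoPrimitive_of_lt hρ1, ← fracKernel_add_one]
    exact norm_fracInt_le h1ρ ht.1 fun s hs => hM s ⟨hs.1.le, hs.2.le.trans ht.2⟩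
  · have hlim := (((Real.continuous_rpow_const h1ρ.le).div_const
      (Real.Gamma (1 - ρ + 1))).mul_const M).tendsto 0
    rw [Real.zero_rpow h1ρ.ne', zero_div, zero_mul] at hlim
    exact hlim.mono_left nhdsWithin_le_nhds

lemma caputoPrimitive_sub_fun (hρ1 : ρ ≤ 1) (hv : ContinuousOn v (Icc 0 T))
    (hy : ContinuousOn y (Icc 0 T)) (ht : t ≤ T) : caputoPrimitive ρ (fun s => v s - y s) t =
      caputoPrimitive ρ v t - caputoPrimitive ρ y t := by
  rcases hρ1.eq_or_lt with rfl | hρ1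
  · simp only [caputoPrimitive_one]
    ring
  · simp only [caputoPrimitive_of_lt hρ1]
    rw [← fracInt_sub (f := fun s => v s - v 0) (g := fun s => y s - y 0) (sub_pos.2 hρ1)
      (hv.sub continuousOn_const) (hy.sub continuousOn_const) ht]
    exact fracInt_congr fun s _ => by ring

lemma eq_zero_of_caputoPrimitive_eq (hρ : 0 < ρ) (hρ1 : ρ ≤ 1) (hT : 0 < T) {lam : ℂ}
    (hv : ContinuousOn v (Icc 0 T)) (hv0 : v 0 = 0)
    (h : ∀ t ∈ Ioc 0 T, caputoPrimitive ρ v t = lam * fracInt 1 v t) :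
    ∀ t ∈ Icc 0 T, v t = 0 := by
  rcases hρ1.eq_or_lt with rfl | hρ1
  · intro t ht
    rcases ht.1.eq_or_lt with rfl | ht0
    · exact hv0
    · exact eq_zero_of_eq_fracInt one_pos hv
        (by simpa only [caputoPrimitive_one, hv0, sub_zero] using h) t ⟨ht0, ht.2⟩
  · exact eq_zero_of_fracInt_eq hρ hρ1 hT hv
      (by simpa only [caputoPrimitive_of_lt hρ1, hv0, sub_zero] using h)

lemma relaxSol_sub (hρ : 0 < ρ) (lam : ℝ) (a b : ℂ) (t : ℝ) :
    relaxSol ρ lam a b t - a = relaxRate ρ lam (ρ + 1) a b t := by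
  rw [relaxSol, relaxRate, mlFun_one_eq hρ]
  push_cast
  ring

lemma caputoPrimitive_relaxSol (hρ : 0 < ρ) (hρ1 : ρ ≤ 1) (lam : ℝ) (a b : ℂ) (ht : 0 < t) :
    caputoPrimitive ρ (relaxSol ρ lam a b) t =
      fracInt 1 (fun s => b - lam * relaxSol ρ lam a b s) t := by
  simp only [mul_relaxSol hρ, sub_sub_cancel]
  rw [fracInt_relaxRate hρ lam one_pos one_pos a b ht]
  rcases hρ1.eq_or_lt with rfl | hρ1
  · rw [caputoPrimitive_one, relaxSol_zero hρ, relaxSol_sub hρ]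
  · simp only [caputoPrimitive_of_lt hρ1, relaxSol_zero hρ, relaxSol_sub hρ]
    rw [fracInt_relaxRate hρ lam (sub_pos.2 hρ1) (by linarith) a b ht]
    ring_nf

theorem eq_relaxSol_of_caputoPrimitive_eq (hρ : 0 < ρ) (hρ1 : ρ ≤ 1) (hT : 0 < T) {b : ℂ}
    (hy : ContinuousOn y (Icc 0 T))
    (h : ∀ t ∈ Ioc 0 T, caputoPrimitive ρ y t = fracInt 1 (fun s => b - lam * y s) t) :
    ∀ t ∈ Icc 0 T, y t = relaxSol ρ lam (y 0) b t := by
  have hS := (continuous_relaxSol hρ lam (y 0) b).continuousOn (s := Icc 0 T)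
  have hzero := eq_zero_of_caputoPrimitive_eq (lam := -lam)
    (v := fun s => y s - relaxSol ρ lam (y 0) b s) hρ hρ1 hT (hy.sub hS)
    (sub_eq_zero.2 (relaxSol_zero hρ lam (y 0) b).symm) fun t ht => by
      rw [caputoPrimitive_sub_fun hρ1 hy hS ht.2, h t ht,
        caputoPrimitive_relaxSol hρ hρ1 lam (y 0) b ht.1,
        ← fracInt_sub (f := fun s => b - lam * y s)
          (g := fun s => b - lam * relaxSol ρ lam (y 0) b s) one_pos
          (continuousOn_const.sub (continuousOn_const.mul hy))
          (continuousOn_const.sub (continuousOn_const.mul hS)) ht.2, ← fracInt_const_mul]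
      exact fracInt_congr fun s _ => by ring
  exact fun t ht => sub_eq_zero.1 (hzero t ht)

end CaputoPrimitive

/-! ### Fourier coefficients of a classical solution -/

section ParametricIntegral

variable {N : ℕ} {w : (Fin N → ℝ) → ℝ → ℂ}

lemma fourierCoef_congr_ae {g h : (Fin N → ℝ) → ℂ} (hgh : g =ᵐ[volume] h) (n : Fin N → ℤ) :
    fourierCoef g n = fourierCoef h n := by
  refine congrArg _ (integral_congr_ae ?_)
  filter_upwards [ae_restrict_of_ae hgh] with x hx
  rw [hx]

section Slices

variable {s : Set ℝ} (hw : ContinuousOn (fun p : (Fin N → ℝ) × ℝ => w p.1 p.2) (univ ×ˢ s))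
include hw

lemma continuous_slice {t : ℝ} (ht : t ∈ s) : Continuous fun x => w x t :=
  hw.comp_continuous (f := fun x => (x, t)) (by fun_prop) fun _ => ⟨mem_univ _, ht⟩

lemma continuousOn_slice (x : Fin N → ℝ) : ContinuousOn (w x) s :=
  hw.comp (f := fun t => (x, t)) (by fun_prop) fun _ ht => ⟨mem_univ _, ht⟩

lemma continuousOn_sub_slice {t : ℝ} (ht : t ∈ s) :
    ContinuousOn (fun p : (Fin N → ℝ) × ℝ => w p.1 p.2 - w p.1 t) (univ ×ˢ s) :=
  hw.sub ((continuous_slice hw ht).comp continuous_fst).continuousOn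

end Slices

lemma continuousOn_fourierCoef {a b : ℝ} (hab : a ≤ b)
    (hw : ContinuousOn (fun p : (Fin N → ℝ) × ℝ => w p.1 p.2) (univ ×ˢ Icc a b))
    (n : Fin N → ℤ) : ContinuousOn (fun t => fourierCoef (fun x => w x t) n) (Icc a b) := by
  have hextend : Continuous fun p : ℝ × (Fin N → ℝ) =>
      w p.2 (projIcc a b hab p.1) * expMode (-n) p.2 :=
    (hw.comp_continuous (f := fun p : ℝ × (Fin N → ℝ) => (p.2, (projIcc a b hab p.1 : ℝ)))
      (continuous_snd.prodMk (continuous_subtype_val.comp (continuous_projIcc.comp continuous_fst)))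
      fun p => ⟨mem_univ _, (projIcc a b hab p.1).2⟩).mul
      ((continuous_expMode _).comp continuous_snd)
  have hint := continuous_parametric_integral_of_continuous (μ := volume)
    (f := fun t x => w x (projIcc a b hab t) * expMode (-n) x) hextend
    (isCompact_Icc (a := fun _ : Fin N => -Real.pi) (b := fun _ => Real.pi))
  have hcube : ∀ t, ∫ x in Icc (fun _ : Fin N => -Real.pi) (fun _ => Real.pi),
      w x (projIcc a b hab t) * expMode (-n) x =
        ∫ x in cube N, w x (projIcc a b hab t) * expMode (-n) x :=
    fun t => (setIntegral_congr_set Measure.univ_pi_Ioc_ae_eq_Icc).symm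
  simp only [hcube] at hint
  refine (hint.const_smul (((2 * Real.pi : ℝ) : ℂ)⁻¹ ^ N)).continuousOn.congr fun t ht => ?_
  simp only [fourierCoef, Pi.smul_apply, smul_eq_mul, projIcc_of_mem hab ht]

section Fubini

variable {a b : ℝ} {κ : ℝ → ℝ}
  (hw : ContinuousOn (fun p : (Fin N → ℝ) × ℝ => w p.1 p.2) (univ ×ˢ Icc a b))
  (hκ : IntegrableOn κ (Ioo a b))
include hw hκ

lemma integrable_uncurry_smul :
    Integrable (Function.uncurry fun x s => κ s • w x s)
      ((volume.restrict (cube N)).prod (volume.restrict (Ioo a b))) := by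
  have hms : MeasurableSet (cube N ×ˢ Ioo a b) := (measurableSet_cube N).prod measurableSet_Ioo
  obtain ⟨M, hM⟩ := ((isCompact_Icc (a := fun _ : Fin N => -Real.pi)
    (b := fun _ => Real.pi)).prod (isCompact_Icc (a := a) (b := b))).exists_bound_of_continuousOn
      (hw.mono (prod_mono_left (subset_univ _)))
  refine Integrable.smul_bdd (C := M) (hκ.comp_snd _) ?_ ?_
  · rw [Measure.prod_restrict]
    exact (hw.mono (prod_mono (subset_univ _) Ioo_subset_Icc_self)).aestronglyMeasurable hms
  · rw [Measure.prod_restrict]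
    filter_upwards [ae_restrict_mem hms] with p hp
    exact hM p (prod_mono (cube_subset_Icc N) Ioo_subset_Icc_self hp)

lemma integrableOn_cube_integral_smul :
    IntegrableOn (fun x => ∫ s in Ioo a b, κ s • w x s) (cube N) :=
  (integrable_uncurry_smul hw hκ).integral_prod_left

lemma fourierCoef_integral_smul (n : Fin N → ℤ) :
    fourierCoef (fun x => ∫ s in Ioo a b, κ s • w x s) n =
      ∫ s in Ioo a b, κ s • fourierCoef (fun x => w x s) n := by
  have hint := integrable_uncurry_smul (w := fun x s => w x s * expMode (-n) x)
    (hw.mul ((continuous_expMode _).comp continuous_fst).continuousOn) hκ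
  simp only [fourierCoef, ← integral_mul_const, smul_mul_assoc]
  rw [integral_integral_swap hint, ← integral_const_mul]
  simp only [integral_smul, mul_smul_comm]

end Fubini

variable {ρ T t : ℝ} (hρ1 : ρ ≤ 1)
  (hw : ContinuousOn (fun p : (Fin N → ℝ) × ℝ => w p.1 p.2) (univ ×ˢ Icc 0 T))
  (ht : t ∈ Ioc 0 T)
include hρ1 hw ht

lemma integrableOn_cube_caputoPrimitive :
    IntegrableOn (fun x => caputoPrimitive ρ (w x) t) (cube N) := by
  have h0 : (0 : ℝ) ∈ Icc 0 T := left_mem_Icc.2 (ht.1.le.trans ht.2)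
  rcases hρ1.eq_or_lt with rfl | hρ1
  · simp only [caputoPrimitive_one]
    exact continuous_integrableOn_cube
      ((continuous_slice hw (Ioc_subset_Icc_self ht)).sub (continuous_slice hw h0))
  · simp only [caputoPrimitive_of_lt hρ1, fracInt]
    exact integrableOn_cube_integral_smul (w := fun x s => w x s - w x 0)
      ((continuousOn_sub_slice hw h0).mono (prod_mono_right (Icc_subset_Icc_right ht.2)))
      (integrableOn_fracKernel_sub (sub_pos.2 hρ1))

lemma fourierCoef_caputoPrimitive (n : Fin N → ℤ) :
    fourierCoef (fun x => caputoPrimitive ρ (w x) t) n =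
      caputoPrimitive ρ (fun s => fourierCoef (fun x => w x s) n) t := by
  have h0 : (0 : ℝ) ∈ Icc 0 T := left_mem_Icc.2 (ht.1.le.trans ht.2)
  have hcoef : ∀ s ∈ Icc 0 T, fourierCoef (fun x => w x s - w x 0) n =
      fourierCoef (fun x => w x s) n - fourierCoef (fun x => w x 0) n := fun s hs =>
    fourierCoef_sub (continuous_integrableOn_cube (continuous_slice hw hs))
      (continuous_integrableOn_cube (continuous_slice hw h0)) n
  rcases hρ1.eq_or_lt with rfl | hρ1
  · simp only [caputoPrimitive_one]
    exact hcoef t (Ioc_subset_Icc_self ht)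
  · simp only [caputoPrimitive_of_lt hρ1]
    exact (fourierCoef_integral_smul (w := fun x s => w x s - w x 0)
      ((continuousOn_sub_slice hw h0).mono (prod_mono_right (Icc_subset_Icc_right ht.2)))
      (integrableOn_fracKernel_sub (sub_pos.2 hρ1)) n).trans
      (fracInt_congr fun s hs => hcoef s ⟨hs.1.le, hs.2.le.trans ht.2⟩)

end ParametricIntegral

section SolutionCoef

variable {N m : ℕ} {A : MvPolynomial (Fin N) ℂ} {ρ T t : ℝ} {φ Ψ : (Fin N → ℝ) → ℂ}
  {v : (Fin N → ℝ) → ℝ → ℂ} {g : (Fin N → ℝ) → ℂ}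

lemma IsSolution.fourierCoef_caputo (hv : IsSolution m A ρ T φ Ψ v g)
    (hA : IsEllipticSymmPos m A) (ht : t ∈ Ioc 0 T) (n : Fin N → ℤ) :
    fourierCoef (fun x => caputo ρ T (v x) t) n =
      fourierCoef g n - eigenval A n * fourierCoef (fun x => v x t) n := by
  have hcaputo : (fun x => caputo ρ T (v x) t) = g - diffOp A fun y => v y t :=
    funext fun x => eq_sub_of_add_eq (hv.equation x t ht)
  rw [hcaputo, fourierCoef_sub (continuous_integrableOn_cube hv.continuous_f)
    (continuous_integrableOn_cube (continuous_slice
      (w := fun x t => diffOp A (fun y => v y t) x) hv.continuous_diffOp ht)),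
    fourierCoef_diffOp hA (hv.periodic_u t (Ioc_subset_Icc_self ht)) (hv.contDiff_u t ht)]

lemma IsSolution.fourierCoef_integral_caputo (hv : IsSolution m A ρ T φ Ψ v g)
    (hA : IsEllipticSymmPos m A) {a : ℝ} (ha : a ∈ Ioc 0 t) (ht : t ≤ T) (n : Fin N → ℤ) :
    fourierCoef (fun x => ∫ s in a..t, caputo ρ T (v x) s) n =
      ∫ s in a..t, (fourierCoef g n - eigenval A n * fourierCoef (fun x => v x s) n) := by
  have hsub : Icc a t ⊆ Ioc 0 T := fun s hs => ⟨ha.1.trans_le hs.1, hs.2.trans ht⟩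
  have h := fourierCoef_integral_smul (w := fun x t => caputo ρ T (v x) t) (κ := fun _ => 1)
    (hv.continuous_caputo.mono (prod_mono_right hsub)) (integrableOn_const (by simp)) n
  simp only [one_smul] at h
  simp only [intervalIntegral.integral_of_le ha.2, integral_Ioc_eq_integral_Ioo]
  exact h.trans (setIntegral_congr_fun measurableSet_Ioo fun s hs =>
    hv.fourierCoef_caputo hA (hsub (Ioo_subset_Icc_self hs)) n)

variable (hv : IsSolution m A ρ T φ Ψ v g) (hA : IsEllipticSymmPos m A) (hρ : 0 < ρ) (hρ1 : ρ ≤ 1)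
include hv hA hρ hρ1

lemma IsSolution.caputoPrimitive_fourierCoef (ht : t ∈ Ioc 0 T) (n : Fin N → ℤ) :
    caputoPrimitive ρ (fun s => fourierCoef (fun x => v x s) n) t =
      fracInt 1 (fun s => fourierCoef g n - eigenval A n * fourierCoef (fun x => v x s) n) t := by
  have hT := ht.1.trans_le ht.2
  have hV := continuousOn_fourierCoef hT.le hv.continuous_u n
  have hG : ContinuousOn
      (fun s => fourierCoef g n - eigenval A n * fourierCoef (fun x => v x s) n) (Icc 0 T) :=
    continuousOn_const.sub (continuousOn_const.mul hV)
  rw [fracInt_one_eq_intervalIntegral _ ht.1.le]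
  refine eq_integral_of_tendsto_zero (J := caputoPrimitive ρ _) ht.1
    (hG.mono (Icc_subset_Icc_right ht.2)).integrableOn_Icc (fun a ha => ?_)
    (tendsto_caputoPrimitive_zero hρ1 hT hV)
  have haT : a ∈ Ioc 0 T := ⟨ha.1, ha.2.trans ht.2⟩
  have hprim : (fun x => ∫ s in a..t, caputo ρ T (v x) s) =
      (fun x => caputoPrimitive ρ (v x) t) - fun x => caputoPrimitive ρ (v x) a := by
    ext x
    exact (caputoPrimitive_sub hρ hρ1 (hv.hasCaputo x) (continuousOn_slice hv.continuous_u x)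
      (continuousOn_slice (w := fun x t => caputo ρ T (v x) t) hv.continuous_caputo x) ha
      ht.2).symm
  rw [← hv.fourierCoef_integral_caputo hA ha ht.2, hprim,
    fourierCoef_sub (integrableOn_cube_caputoPrimitive hρ1 hv.continuous_u ht)
      (integrableOn_cube_caputoPrimitive hρ1 hv.continuous_u haT),
    fourierCoef_caputoPrimitive hρ1 hv.continuous_u ht,
    fourierCoef_caputoPrimitive hρ1 hv.continuous_u haT]

theorem IsSolution.fourierCoef_eq_solCoef (hT : 0 < T) (ht : t ∈ Icc 0 T) (n : Fin N → ℤ) :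
    fourierCoef (fun x => v x t) n = solCoef A ρ (fourierCoef φ) (fourierCoef g) t n := by
  rw [solCoef, ← fourierCoef_congr_ae hv.initial]
  exact eq_relaxSol_of_caputoPrimitive_eq hρ hρ1 hT
    (continuousOn_fourierCoef hT.le hv.continuous_u n)
    (fun t ht => hv.caputoPrimitive_fourierCoef hA hρ hρ1 ht n) t ht

end SolutionCoef

/-! ### The inverse problem -/

section RelaxationInverse

variable {ρ lam t : ℝ} (hρ : 0 < ρ) (hρ1 : ρ ≤ 1) (hlam : 0 ≤ lam) (ht : 0 < t)
include hρ hρ1 hlam ht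

lemma relaxSol_eq_iff {a b c : ℂ} : relaxSol ρ lam a b t = c ↔
    b = (c - a * mlFun ρ lam 1 t) / mlFun ρ lam (ρ + 1) t := by
  have hM : (mlFun ρ lam (ρ + 1) t : ℂ) ≠ 0 := by
    exact_mod_cast (mlFun_pos hρ hρ1 hlam (by linarith) ht).ne'
  rw [relaxSol, eq_div_iff hM, eq_sub_iff_add_eq']

lemma inv_mlFun_add_one_le :
    (mlFun ρ lam (ρ + 1) t)⁻¹ ≤ (Real.Gamma (ρ + 1) / t ^ ρ + 1) * (1 + lam) := by
  have hM := mlFun_pos hρ hρ1 hlam (show ρ ≤ ρ + 1 by linarith) ht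
  have hG := Real.Gamma_pos_of_pos (show 0 < ρ + 1 by linarith)
  have hp := Real.rpow_pos_of_pos ht ρ
  calc (mlFun ρ lam (ρ + 1) t)⁻¹ ≤ (Real.Gamma (ρ + 1) + lam * t ^ ρ) / t ^ ρ := by
        rw [inv_le_comm₀ hM (by positivity), inv_div, div_le_iff₀' (by positivity)]
        exact rpow_le_mul_mlFun_add_one hρ hρ1 hlam ht
    _ = Real.Gamma (ρ + 1) / t ^ ρ + lam := by field_simp
    _ ≤ _ := by
        have := mul_nonneg (div_pos hG hp).le hlam
        linarith

lemma mlFun_one_div_mlFun_add_one_le :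
    mlFun ρ lam 1 t / mlFun ρ lam (ρ + 1) t ≤ Real.Gamma (ρ + 1) / t ^ ρ := by
  rw [div_le_div_iff₀ (mlFun_pos hρ hρ1 hlam (by linarith) ht) (Real.rpow_pos_of_pos ht ρ),
    mul_comm]
  exact rpow_mul_mlFun_one_le hρ hρ1 hlam ht

end RelaxationInverse

section InverseProblem

variable {N m : ℕ} {A : MvPolynomial (Fin N) ℂ} {ρ T : ℝ} {φ Ψ : (Fin N → ℝ) → ℂ}

lemma isSumOfTwoSeries_trigSeries {c d : (Fin N → ℤ) → ℂ} (hc : Summable fun n => ‖c n‖)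
    (hd : Summable fun n => ‖d n‖) (x : Fin N → ℝ) :
    IsSumOfTwoSeries (trigSeries (fun n => c n + d n) x) (fun n => c n * expMode n x)
      (fun n => d n * expMode n x) := by
  have hcx := summable_trigSeries hc x
  have hdx := summable_trigSeries hd x
  refine ⟨hcx, hdx, ?_⟩
  simp only [trigSeries, add_mul]
  exact hcx.tsum_add hdx

section Symbol

variable (hA : IsEllipticSymmPos m A)
include hA

lemma mlMode_eq_realML (ρ μ t : ℝ) (n : Fin N → ℤ) :
    mlMode A ρ μ t n = realML ρ μ (-eigenval A n * t ^ ρ) := by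
  rw [mlMode, symbolAt_eq_eigenval hA, ← mittagLeffler_ofReal]
  push_cast
  rfl

lemma mlMode_one (ρ t : ℝ) (n : Fin N → ℤ) :
    mlMode A ρ 1 t n = mlFun ρ (eigenval A n) 1 t := by
  rw [mlMode_eq_realML hA, mlFun_one]

lemma rpow_mul_mlMode_add_one (ρ t : ℝ) (n : Fin N → ℤ) :
    ((t ^ ρ : ℝ) : ℂ) * mlMode A ρ (ρ + 1) t n = mlFun ρ (eigenval A n) (ρ + 1) t := by
  rw [mlMode_eq_realML hA, mlFun_add_one, Complex.ofReal_mul]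

lemma solCoef_eq_mlMode (ρ : ℝ) (a b : (Fin N → ℤ) → ℂ) (t : ℝ) (n : Fin N → ℤ) :
    solCoef A ρ a b t n =
      a n * mlMode A ρ 1 t n + b n * ((t ^ ρ : ℝ) : ℂ) * mlMode A ρ (ρ + 1) t n := by
  rw [mul_assoc, rpow_mul_mlMode_add_one hA, mlMode_one hA, solCoef, relaxSol]

variable (hρ : 0 < ρ) (hρ1 : ρ ≤ 1)
include hρ hρ1

lemma norm_mlMode_one_le {t : ℝ} (ht : 0 ≤ t) (n : Fin N → ℤ) : ‖mlMode A ρ 1 t n‖ ≤ 1 := by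
  have hl := eigenval_nonneg hA n
  rw [mlMode_one hA, Complex.norm_of_nonneg (mlFun_nonneg hρ hρ1 hl hρ1 ht)]
  exact mlFun_one_le_one hρ hρ1 hl ht

lemma norm_rpow_mul_mlMode_add_one_le {t : ℝ} (ht : 0 ≤ t) (n : Fin N → ℤ) :
    ‖((t ^ ρ : ℝ) : ℂ) * mlMode A ρ (ρ + 1) t n‖ ≤ fracKernel (ρ + 1) t := by
  have hl := eigenval_nonneg hA n
  rw [rpow_mul_mlMode_add_one hA,
    Complex.norm_of_nonneg (mlFun_nonneg hρ hρ1 hl (by linarith) ht)]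
  exact mlFun_le_fracKernel hρ hρ1 hl (by linarith) ht

theorem isSumOfTwoSeries_trigSeries_solCoef {a b : (Fin N → ℤ) → ℂ}
    (ha : Summable fun n => ‖a n‖) (hb : Summable fun n => ‖b n‖) {t : ℝ} (ht : 0 ≤ t)
    (x : Fin N → ℝ) :
    IsSumOfTwoSeries (trigSeries (solCoef A ρ a b t) x)
      (fun n => a n * mlMode A ρ 1 t n * expMode n x)
      (fun n => b n * ((t ^ ρ : ℝ) : ℂ) * mlMode A ρ (ρ + 1) t n * expMode n x) := by
  rw [funext (solCoef_eq_mlMode hA ρ a b t)]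
  refine isSumOfTwoSeries_trigSeries (ha.of_nonneg_of_le (fun _ => norm_nonneg _) fun n => ?_)
    ((hb.mul_right (fracKernel (ρ + 1) t)).of_nonneg_of_le (fun _ => norm_nonneg _) fun n => ?_) x
  · rw [norm_mul]
    exact mul_le_of_le_one_right (norm_nonneg _) (norm_mlMode_one_le hA hρ hρ1 ht n)
  · rw [mul_assoc, norm_mul]
    gcongr
    exact norm_rpow_mul_mlMode_add_one_le hA hρ hρ1 ht n

variable (hT : 0 < T)
include hT

lemma summable_sourceCoefFinal (hΨ : WeightSummable m (fourierCoef Ψ)) :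
    Summable fun n => ‖sourceCoefFinal A ρ T Ψ n‖ := by
  obtain ⟨C, hsymb⟩ := exists_norm_symbolAt_le hA.homogeneous.totalDegree_le
  set K := Real.Gamma (ρ + 1) / T ^ ρ + 1
  have hK : 0 ≤ K := add_nonneg (div_nonneg (Real.Gamma_pos_of_pos (by linarith)).le
    (Real.rpow_nonneg hT.le ρ)) zero_le_one
  refine (hΨ.mul_left (K * (1 + C))).of_nonneg_of_le (fun _ => norm_nonneg _) fun n => ?_
  have hl := eigenval_nonneg hA n
  have hle : 1 + eigenval A n ≤ (1 + C) * (1 + ‖n‖) ^ m := by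
    rw [eigenval_eq_norm hA, add_mul, one_mul]
    exact add_le_add (one_le_pow₀ (le_add_of_nonneg_right (norm_nonneg n))) (hsymb n)
  rw [sourceCoefFinal, rpow_mul_mlMode_add_one hA, norm_div,
    Complex.norm_of_nonneg (mlFun_nonneg hρ hρ1 hl (by linarith) hT.le), div_eq_mul_inv]
  calc ‖fourierCoef Ψ n‖ * (mlFun ρ (eigenval A n) (ρ + 1) T)⁻¹
      ≤ ‖fourierCoef Ψ n‖ * (K * ((1 + C) * (1 + ‖n‖) ^ m)) := by
        gcongr
        exact (inv_mlFun_add_one_le hρ hρ1 hl hT).trans (mul_le_mul_of_nonneg_left hle hK)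
    _ = K * (1 + C) * ((1 + ‖n‖) ^ m * ‖fourierCoef Ψ n‖) := by ring

lemma summable_sourceCoefInitial (hφ : Summable fun n => ‖fourierCoef φ n‖) :
    Summable fun n => ‖sourceCoefInitial A ρ T φ n‖ := by
  refine (hφ.mul_right (Real.Gamma (ρ + 1) / T ^ ρ)).of_nonneg_of_le (fun _ => norm_nonneg _)
    fun n => ?_
  have hl := eigenval_nonneg hA n
  rw [sourceCoefInitial, rpow_mul_mlMode_add_one hA, mlMode_one hA, norm_div, norm_mul,
    Complex.norm_of_nonneg (mlFun_nonneg hρ hρ1 hl hρ1 hT.le),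
    Complex.norm_of_nonneg (mlFun_nonneg hρ hρ1 hl (by linarith) hT.le), mul_div_assoc]
  refine mul_le_mul_of_nonneg_left ?_ (norm_nonneg _)
  exact mlFun_one_div_mlFun_add_one_le hρ hρ1 hl hT

lemma summable_sourceCoef (hφ : Summable fun n => ‖fourierCoef φ n‖)
    (hΨ : WeightSummable m (fourierCoef Ψ)) : Summable fun n => ‖sourceCoef A ρ T φ Ψ n‖ :=
  ((summable_sourceCoefFinal hA hρ hρ1 hT hΨ).add
    (summable_sourceCoefInitial hA hρ hρ1 hT hφ)).of_nonneg_of_le (fun _ => norm_nonneg _)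
      fun _ => norm_sub_le _ _

theorem isSumOfTwoSeries_trigSeries_sourceCoef (hφ : Summable fun n => ‖fourierCoef φ n‖)
    (hΨ : WeightSummable m (fourierCoef Ψ)) (x : Fin N → ℝ) :
    IsSumOfTwoSeries (trigSeries (sourceCoef A ρ T φ Ψ) x)
      (fun n => sourceCoefFinal A ρ T Ψ n * expMode n x)
      (fun n => -(sourceCoefInitial A ρ T φ n * expMode n x)) := by
  have h := isSumOfTwoSeries_trigSeries (d := fun n => -sourceCoefInitial A ρ T φ n)
    (summable_sourceCoefFinal hA hρ hρ1 hT hΨ)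
    (by simpa only [norm_neg] using summable_sourceCoefInitial hA hρ hρ1 hT hφ) x
  simp only [neg_mul, ← sub_eq_add_neg] at h
  exact h

lemma solCoef_eq_fourierCoef_iff {b : (Fin N → ℤ) → ℂ} {n : Fin N → ℤ} :
    solCoef A ρ (fourierCoef φ) b T n = fourierCoef Ψ n ↔ b n = sourceCoef A ρ T φ Ψ n := by
  rw [solCoef, relaxSol_eq_iff hρ hρ1 (eigenval_nonneg hA n) hT, sub_div, sourceCoef,
    sourceCoefFinal, sourceCoefInitial, rpow_mul_mlMode_add_one hA, mlMode_one hA]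

theorem isSolution_trigSeries {τ σ : ℝ} (hφ : MemSobolev τ φ) (hΨ : MemSobolev σ Ψ)
    (ha : Summable fun n => ‖fourierCoef φ n‖) (hc : Summable fun n => ‖fourierCoef Ψ n‖)
    (hb : Summable fun n => ‖sourceCoef A ρ T φ Ψ n‖) :
    IsSolution m A ρ T φ Ψ
      (fun x t => trigSeries (solCoef A ρ (fourierCoef φ) (sourceCoef A ρ T φ Ψ) t) x)
      (trigSeries (sourceCoef A ρ T φ Ψ)) := by
  have hcaputo := (continuousOn_trigSeries_caputoCoef hA hρ hρ1 ha hb).mono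
    (prod_mono_right fun t (ht : t ∈ Ioc 0 T) => ht.1)
  exact
    { periodic_f := isPeriodic_trigSeries _
      continuous_f := continuous_trigSeries hb
      periodic_u := fun t _ => isPeriodic_trigSeries _
      continuous_u := continuousOn_trigSeries_solCoef hA hρ hρ1 ha hb T
      contDiff_u := fun t ht => contDiff_trigSeries (weightSummable_solCoef hA hρ hρ1 ha hb ht.1)
      continuous_diffOp :=
        (((continuous_trigSeries hb).comp continuous_fst).continuousOn.sub hcaputo).congr
          fun p hp => diffOp_trigSeries_solCoef hA hρ hρ1 ha hb hp.2.1 p.1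
      hasCaputo := fun x t ht => hasCaputo_trigSeries_solCoef hA hρ hρ1 ha hb ht.1 T x
      continuous_caputo :=
        hcaputo.congr fun p hp => caputo_trigSeries_solCoef hA hρ hρ1 ha hb hp.2 p.1
      equation := fun x t ht => by
        rw [caputo_trigSeries_solCoef hA hρ hρ1 ha hb ht]
        exact add_eq_of_eq_sub' (diffOp_trigSeries_solCoef hA hρ hρ1 ha hb ht.1 x)
      initial := by
        have h0 : solCoef A ρ (fourierCoef φ) (sourceCoef A ρ T φ Ψ) 0 = fourierCoef φ :=
          funext fun n => relaxSol_zero hρ _ _ _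
        simpa only [h0] using hφ.trigSeries_ae_eq ha
      final := by
        have hT' : solCoef A ρ (fourierCoef φ) (sourceCoef A ρ T φ Ψ) T = fourierCoef Ψ :=
          funext fun n => (solCoef_eq_fourierCoef_iff hA hρ hρ1 hT).2 rfl
        simpa only [hT'] using hΨ.trigSeries_ae_eq hc }

variable {v : (Fin N → ℝ) → ℝ → ℂ} {g : (Fin N → ℝ) → ℂ} (hv : IsSolution m A ρ T φ Ψ v g)
include hv

lemma IsSolution.fourierCoef_source : fourierCoef g = sourceCoef A ρ T φ Ψ := by
  ext n
  rw [← solCoef_eq_fourierCoef_iff hA hρ hρ1 hT,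
    ← hv.fourierCoef_eq_solCoef hA hρ hρ1 hT (right_mem_Icc.2 hT.le)]
  exact fourierCoef_congr_ae hv.final n

variable (hb : Summable fun n => ‖sourceCoef A ρ T φ Ψ n‖)
include hb

theorem IsSolution.source_eq_trigSeries : g = trigSeries (sourceCoef A ρ T φ Ψ) :=
  eq_of_fourierCoef_eq hv.periodic_f (isPeriodic_trigSeries _) hv.continuous_f
    (continuous_trigSeries hb) fun n => by
      rw [fourierCoef_trigSeries hb, hv.fourierCoef_source hA hρ hρ1 hT]

theorem IsSolution.eq_trigSeries (ha : Summable fun n => ‖fourierCoef φ n‖) {t : ℝ}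
    (ht : t ∈ Icc 0 T) (x : Fin N → ℝ) :
    v x t = trigSeries (solCoef A ρ (fourierCoef φ) (sourceCoef A ρ T φ Ψ) t) x := by
  have hs := summable_solCoef hA hρ hρ1 ha hb ht.1
  refine congrFun (eq_of_fourierCoef_eq (hv.periodic_u t ht) (isPeriodic_trigSeries _)
    (continuous_slice hv.continuous_u ht) (continuous_trigSeries hs) fun n => ?_) x
  rw [fourierCoef_trigSeries hs, hv.fourierCoef_eq_solCoef hA hρ hρ1 hT ht,
    hv.fourierCoef_source hA hρ hρ1 hT]

end Symbol

end InverseProblem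

end Subdiffusion

end

theorem theorem2p1 (N m : ℕ) (hN : 1 ≤ N) (hm : 1 ≤ m)
    (A : MvPolynomial (Fin N) ℂ) (hA : Subdiffusion.IsEllipticSymmPos m A)
    (ρ T τ : ℝ) (hρ0 : 0 < ρ) (hρ1 : ρ ≤ 1) (hT : 0 < T) (hτ : (N : ℝ) / 2 < τ)
    (φ Ψ : (Fin N → ℝ) → ℂ)
    (hφ : Subdiffusion.MemSobolev τ φ) (hΨ : Subdiffusion.MemSobolev (τ + m) Ψ) :
    ∃ (u : (Fin N → ℝ) → ℝ → ℂ) (f : (Fin N → ℝ) → ℂ),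
      Subdiffusion.IsSolution m A ρ T φ Ψ u f ∧
      (∀ (v : (Fin N → ℝ) → ℝ → ℂ) (g : (Fin N → ℝ) → ℂ),
        Subdiffusion.IsSolution m A ρ T φ Ψ v g →
          (∀ x, ∀ t ∈ Set.Icc 0 T, v x t = u x t) ∧ g = f) ∧
      (∀ x, ∀ t ∈ Set.Icc 0 T, Subdiffusion.IsSumOfTwoSeries (u x t)
        (fun n : Fin N → ℤ => Subdiffusion.fourierCoef φ n *
          Subdiffusion.mlMode A ρ 1 t n * Subdiffusion.expMode n x)
        (fun n : Fin N → ℤ => Subdiffusion.sourceCoef A ρ T φ Ψ n * ((t ^ ρ : ℝ) : ℂ) *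
          Subdiffusion.mlMode A ρ (ρ + 1) t n * Subdiffusion.expMode n x)) ∧
      (∀ x, Subdiffusion.IsSumOfTwoSeries (f x)
        (fun n : Fin N → ℤ => Subdiffusion.sourceCoefFinal A ρ T Ψ n *
          Subdiffusion.expMode n x)
        (fun n : Fin N → ℤ => -(Subdiffusion.sourceCoefInitial A ρ T φ n *
          Subdiffusion.expMode n x))) := by
  open Subdiffusion in
  have ha : Summable fun n => ‖fourierCoef φ n‖ :=
    (MemSobolev.weightSummable (k := 0) hτ (by simpa using hφ)).norm
  have hc : WeightSummable m (fourierCoef Ψ) := hΨ.weightSummable hτ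
  have hb := summable_sourceCoef hA hρ0 hρ1 hT ha hc
  exact ⟨fun x t => trigSeries (solCoef A ρ (fourierCoef φ) (sourceCoef A ρ T φ Ψ) t) x,
    trigSeries (sourceCoef A ρ T φ Ψ),
    isSolution_trigSeries hA hρ0 hρ1 hT hφ hΨ ha hc.norm hb,
    fun v g hv => ⟨fun x t ht => hv.eq_trigSeries hA hρ0 hρ1 hT hb ha ht x,
      hv.source_eq_trigSeries hA hρ0 hρ1 hT hb⟩,
    fun x t ht => isSumOfTwoSeries_trigSeries_solCoef hA hρ0 hρ1 ha hb ht.1 x,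
    isSumOfTwoSeries_trigSeries_sourceCoef hA hρ0 hρ1 hT ha hc⟩
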